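/- **Theorem 4.1.** All manifolds and maps are smooth. Let $M$ and $Y$ be closed oriented $(2n+1)$-manifolds, let $D^2\subset\mathbb{C}$ be the closed unit disk with polar coordinates $(r,\theta)$, and let $$e\colon M\to Y\times D^2,\qquad x\mapsto (p(x),f(x)),$$ be a braiding of $M$ about $Y$, i.e. a smooth embedding such that $p$ is a branched covering whose branch locus $B\subset Y$ is a smooth submanifold. Here this means: the set $\widetilde B'\subset M$ of ramified points, at which $p$ is not locally injective, is exactly the set of points where $dp$ is not an isomorphism; $B=p(\widetilde B')$; $p$ restricts to a covering map over $Y\setminus B$; and near every point of $\widetilde B'$ the map $p$ has, in suitable smooth charts, the form $(u,z)\mapsto(u,z^k)$ on $\mathbb{R}^{2n-1}\times\mathbb{C}$ with $k\ge 2$ (for $n=0$ there are no ramified points). Assume that $B$ is orientable and not multiply ramified, i.e. for each component $C$ of $B$ at most one component of $p^{-1}(C)$ contains ramified points. Then there is an orientation of $B$ with the following property. Let $\alpha$ be any contact form on $Y$, let $\phi_t\colon Y\to Y$, $t\in[0,1]$, be any ambient isotopy with $\phi_0=\mathrm{id}$ such that $\phi_1(B)$, with the orientation transported from $B$, is a positive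 transverse contact submanifold of $(Y,\ker\alpha)$, and let $\xi'$ be any contact structure on $M$ induced from $\ker\alpha$ by the branched covering $\phi_1\circ p$. Then for every open neighbourhood $U$ of $Y\times\{0\}$ in $Y\times D^2$ there is a smooth isotopy of embeddings $M\to Y\times D^2$ from $e$ to a contact embedding of $(M,\xi')$ into $(Y\times D^2,\ker(\alpha+r^2\,d\theta))$ whose image lies in $U$. Conventions. A contact form $\alpha$ on an oriented $(2k+1)$-manifold is a 1-form such that $\alpha\wedge(d\alpha)^k$ is a volume form defining the orientation; contact structures $\ker\alpha$ are co-oriented. An oriented submanifold is a positive transverse contact submanifold of $(Y,\ker\alpha)$ if $\alpha$ restricts to a contact form on it. A contact structure on $M$ is induced from $\ker\alpha$ by a branched covering $q\colon M\to Y$ whose branch locus is a positive transverse contact submanifold if it is the kernel of a contact form $\beta_1$ for which there is a smooth path of 1-forms $\beta_t$, $t\in[0,1]$, from $\beta_0=q^*\alpha$ to $\beta_1$ such that $\beta_t$ is a contact form for $t>0$ and $d\bigl(\tfrac{\partial\beta_t}{\partial t}\big|_{t=0}\bigr)$ is positive on each fibre $\ker dq_x$, $x\in\widetilde B'$, of the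 normal bundle of the ramification locus, oriented by the orientation of $M$ and the orientation of $\widetilde B'$ lifted from the branch locus. An embedding $g\colon (M,\ker\beta)\to(W,\ker\lambda)$ is a contact embedding if $g^*\lambda$ is a positive function times $\beta$. -/

import Mathlib

open scoped Manifold ContDiff Topology

noncomputable section

namespace ContactBraid

section Forms

variable {E : Type*} [NormedAddCommGroup E] [NormedSpace ℝ E]
  {H : Type*} [TopologicalSpace H]
  {E' : Type*} [NormedAddCommGroup E'] [NormedSpace ℝ E']
  {H' : Type*} [TopologicalSpace H']

/-- A (not necessarily smooth) 1-form on a manifold: a covector at every point. -/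
abbrev OneForm (I : ModelWithCorners ℝ E H) (M : Type*) [TopologicalSpace M]
    [ChartedSpace H M] : Type _ :=
  ∀ x : M, TangentSpace I x →L[ℝ] ℝ

/-- The pull-back `F^* α` of a 1-form along a differentiable map `F : M → N`. -/
def OneForm.pullback {I : ModelWithCorners ℝ E H} {J : ModelWithCorners ℝ E' H'}
    {M : Type*} [TopologicalSpace M] [ChartedSpace H M]
    {N : Type*} [TopologicalSpace N] [ChartedSpace H' N]
    (F : M → N) (α : OneForm J N) : OneForm I M :=
  fun x => (α (F x)).comp (mfderiv I J F x)

variable {I : ModelWithCorners ℝ E H} {M : Type*} [TopologicalSpace M] [ChartedSpace H M]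

/-- The expression of a 1-form in the preferred chart at `x₀`, i.e. its pull-back along the inverse
of that chart.  Only its values on the target of the chart are meaningful. -/
def OneForm.inChart (α : OneForm I M) (x₀ : M) : E → (E →L[ℝ] ℝ) :=
  OneForm.pullback (I := 𝓘(ℝ, E)) (J := I) (extChartAt I x₀).symm α

/-- A 1-form is smooth if all its chart expressions are. -/
def OneForm.IsSmooth (α : OneForm I M) : Prop :=
  ∀ x₀ : M, ContDiffOn ℝ ∞ (α.inChart x₀) (extChartAt I x₀).target

/-- A path `β t`, `t ∈ [0, 1]`, of 1-forms that is smooth jointly in the parameter and the point. -/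
def IsSmoothPath (β : ℝ → OneForm I M) : Prop :=
  ∀ x₀ : M, ContDiffOn ℝ ∞ (fun q : ℝ × E => (β q.1).inChart x₀ q.2)
    (Set.Icc (0 : ℝ) 1 ×ˢ (extChartAt I x₀).target)

/-- The exterior derivative `(dα)_x (v, w)` of a 1-form on a manifold without boundary, computed in
the preferred chart at `x`, whose derivative at `x` is the identification of the tangent space at
`x` with the model space `E`. -/
def OneForm.d (α : OneForm I M) (x : M) (v w : TangentSpace I x) : ℝ :=
  extDeriv
    (fun u : E => ContinuousAlternatingMap.ofSubsingleton ℝ E ℝ (0 : Fin 1) (α.inChart x u))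
    (extChartAt I x x) ![v, w]

end Forms

/-- The value `(a ∧ om ∧ ⋯ ∧ om)(v₀, …, v_{2m})`, with `m` factors `om`, for a linear form `a` and an
alternating bilinear form `om` on a real vector space. -/
def wedgePower {V : Type*} (m : ℕ) (a : V → ℝ) (om : V → V → ℝ) (v : Fin (2 * m + 1) → V) : ℝ :=
  (1 / 2 : ℝ) ^ m * ∑ σ : Equiv.Perm (Fin (2 * m + 1)),
    ((Equiv.Perm.sign σ : ℤ) : ℝ) * a (v (σ 0)) *
      ∏ i : Fin m, om (v (σ ⟨2 * i + 1, by omega⟩)) (v (σ ⟨2 * i + 2, by omega⟩))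

section Orientation

/-- An orientation of a smooth `d`-manifold: an orientation of every tangent space, locally constant
when the nearby tangent spaces are identified by means of a chart. -/
structure ManifoldOrientation (d : ℕ) (M : Type*) [TopologicalSpace M]
    [ChartedSpace (EuclideanSpace ℝ (Fin d)) M] [IsManifold (𝓡 d) ∞ M] where
  /-- the orientation of the tangent space at a point -/
  at_ : ∀ x : M, Orientation ℝ (TangentSpace (𝓡 d) x) (Fin d)
  locally_constant : ∀ x₀ : M, ∀ᶠ x in 𝓝 x₀,
    ∃ (hx : x ∈ (trivializationAt (EuclideanSpace ℝ (Fin d))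
          (TangentSpace (𝓡 d) (M := M)) x₀).baseSet)
      (hx₀ : x₀ ∈ (trivializationAt (EuclideanSpace ℝ (Fin d))
          (TangentSpace (𝓡 d) (M := M)) x₀).baseSet),
      Orientation.map (Fin d)
        ((trivializationAt (EuclideanSpace ℝ (Fin d)) (TangentSpace (𝓡 d) (M := M))
          x₀).continuousLinearEquivAt ℝ x hx).toLinearEquiv (at_ x) =
      Orientation.map (Fin d)
        ((trivializationAt (EuclideanSpace ℝ (Fin d)) (TangentSpace (𝓡 d) (M := M))
          x₀).continuousLinearEquivAt ℝ x₀ hx₀).toLinearEquiv (at_ x₀)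

/-- A tuple of tangent vectors at `x` is a positively oriented basis of the tangent space. -/
def ManifoldOrientation.IsPositiveFrame {d : ℕ} {M : Type*} [TopologicalSpace M]
    [ChartedSpace (EuclideanSpace ℝ (Fin d)) M] [IsManifold (𝓡 d) ∞ M]
    (o : ManifoldOrientation d M) (x : M) (v : Fin d → TangentSpace (𝓡 d) x) : Prop :=
  ∃ b : Module.Basis (Fin d) ℝ (TangentSpace (𝓡 d) x), b.orientation = o.at_ x ∧ ⇑b = v

/-- `α` is a (positive) contact form on the oriented `(2m+1)`-manifold `M`: it is a smooth 1-form
and `α ∧ (dα)^m` is a volume form that defines the given orientation.  The contact structure is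
`ker α`, co-oriented by `α`. -/
def IsContactForm {m : ℕ} {M : Type*} [TopologicalSpace M]
    [ChartedSpace (EuclideanSpace ℝ (Fin (2 * m + 1))) M] [IsManifold (𝓡 (2 * m + 1)) ∞ M]
    (o : ManifoldOrientation (2 * m + 1) M) (α : OneForm (𝓡 (2 * m + 1)) M) : Prop :=
  α.IsSmooth ∧ ∀ (x : M) (v : Fin (2 * m + 1) → TangentSpace (𝓡 (2 * m + 1)) x),
    o.IsPositiveFrame x v → 0 < wedgePower m (α x) (α.d x) v

end Orientation

section BranchedCoverings

variable {d : ℕ} {M : Type*} [TopologicalSpace M] [ChartedSpace (EuclideanSpace ℝ (Fin d)) M]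
  {Y : Type*} [TopologicalSpace Y] [ChartedSpace (EuclideanSpace ℝ (Fin d)) Y]

/-- The set of points at which a map is not locally injective. -/
def ramificationSet {M Y : Type*} [TopologicalSpace M] (p : M → Y) : Set M :=
  {x | ¬ ∃ U ∈ 𝓝 x, Set.InjOn p U}

/-- Near `x` the map `p` between `d`-manifolds is given, in suitable smooth charts centred at `x`
and `p x`, by `(u, z) ↦ (u, z ^ k)` on an open subset of `ℝ^c × ℂ`, for some `k ≥ 2`
(in particular `d = c + 2`). -/
def HasBranchModelAt (c : ℕ) (p : M → Y) (x : M) : Prop :=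
  ∃ k : ℕ, 2 ≤ k ∧
  ∃ L : EuclideanSpace ℝ (Fin d) ≃L[ℝ] EuclideanSpace ℝ (Fin c) × ℂ,
  ∃ φ ∈ IsManifold.maximalAtlas (𝓡 d) ∞ M, ∃ ψ ∈ IsManifold.maximalAtlas (𝓡 d) ∞ Y,
    x ∈ φ.source ∧ L (φ x) = 0 ∧
    ∀ u ∈ φ.source, p u ∈ ψ.source ∧ L (ψ (p u)) = ((L (φ u)).1, (L (φ u)).2 ^ k)

/-- `p : M → Y` is a (smooth) branched covering of `d`-manifolds with branch locus `B ⊆ Y`, where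
`B` is meant to be a smooth submanifold of dimension `c = d - 2`. -/
structure IsBranchedCovering (c : ℕ) (p : M → Y) (B : Set Y) : Prop where
  smooth : ContMDiff (𝓡 d) (𝓡 d) ∞ p
  /-- the points where `p` is not locally injective are exactly its singular points -/
  singular_iff : ∀ x : M,
    x ∈ ramificationSet p ↔ ¬ Function.Bijective (mfderiv (𝓡 d) (𝓡 d) p x)
  image_eq : p '' ramificationSet p = B
  covering : IsCoveringMapOn p Bᶜ
  model : ∀ x ∈ ramificationSet p, HasBranchModelAt (d := d) c p x

/-- The branch locus `B` of `p` is not multiply ramified: for every component `C` of `B`, at most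
one component of `p ⁻¹' C` contains ramified points. -/
def NotMultiplyRamified {M Y : Type*} [TopologicalSpace M] [TopologicalSpace Y]
    (p : M → Y) (B : Set Y) : Prop :=
  ∀ b ∈ B, ∀ x ∈ ramificationSet p, ∀ x' ∈ ramificationSet p,
    p x ∈ connectedComponentIn B b → p x' ∈ connectedComponentIn B b →
      connectedComponentIn (p ⁻¹' connectedComponentIn B b) x =
        connectedComponentIn (p ⁻¹' connectedComponentIn B b) x'

/-- `e = (p, f) : M → Y × D²` is a braid about `Y` whose branched covering `p` has branch locus `B`.
Here `D²` is the closed unit disk in `ℂ`. -/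
structure IsBraid (c : ℕ) (e : M → Y × ℂ) (B : Set Y) : Prop where
  embedding : Manifold.IsSmoothEmbedding (𝓡 d) ((𝓡 d).prod 𝓘(ℝ, ℂ)) ∞ e
  mem_disk : ∀ x, (e x).2 ∈ Metric.closedBall (0 : ℂ) 1
  branched : IsBranchedCovering (d := d) c (fun x => (e x).1) B

/-- `F t`, `t ∈ [0, 1]`, is a smooth isotopy of embeddings `M → Y × D²` starting at `e`. -/
structure IsIsotopyFrom (e : M → Y × ℂ) (F : ℝ → M → Y × ℂ) : Prop where
  smooth : ContMDiff (𝓘(ℝ, ℝ).prod (𝓡 d)) ((𝓡 d).prod 𝓘(ℝ, ℂ)) ∞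
    (fun q : ℝ × M => F q.1 q.2)
  start : F 0 = e
  embedding : ∀ t ∈ Set.Icc (0 : ℝ) 1,
    Manifold.IsSmoothEmbedding (𝓡 d) ((𝓡 d).prod 𝓘(ℝ, ℂ)) ∞ (F t)
  mem_disk : ∀ t ∈ Set.Icc (0 : ℝ) 1, ∀ x, (F t x).2 ∈ Metric.closedBall (0 : ℂ) 1

/-- `Φ t`, `t ∈ [0, 1]`, is a smooth ambient isotopy of `Y`. -/
structure IsAmbientIsotopy (d : ℕ) {Y : Type*} [TopologicalSpace Y]
    [ChartedSpace (EuclideanSpace ℝ (Fin d)) Y] (Φ : ℝ → Y → Y) : Prop where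
  smooth : ContMDiff (𝓘(ℝ, ℝ).prod (𝓡 d)) (𝓡 d) ∞ (fun q : ℝ × Y => Φ q.1 q.2)
  start : Φ 0 = id
  diffeo : ∀ t ∈ Set.Icc (0 : ℝ) 1, ∃ D : Y ≃ₘ^∞⟮𝓡 d, 𝓡 d⟯ Y, ⇑D = Φ t

/-- Let `ι : B → Y` parametrize the branch locus of `p`, and let `x` be a ramified point.  The
fibre at `x` of the normal bundle of the ramification locus is `ker dp_x` (tangent to the factor `ℂ`
in the local model).  It is naturally oriented by the orientation of `M` and that of the
ramification locus lifted from `B` by `p`: `(v, w)` is positive if, together with vectors `u` that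
lift a positive basis of the tangent space of `B`, it gives a positive basis of the tangent space of
`M`. -/
def IsPositiveNormalPair {c : ℕ} {B : Type*} [TopologicalSpace B]
    [ChartedSpace (EuclideanSpace ℝ (Fin c)) B]
    [IsManifold (𝓡 c) ∞ B] [IsManifold (𝓡 d) ∞ M]
    (oM : ManifoldOrientation d M) (oB : ManifoldOrientation c B) (ι : B → Y) (p : M → Y)
    (x : M) (v w : TangentSpace (𝓡 d) x) : Prop :=
  mfderiv (𝓡 d) (𝓡 d) p x v = 0 ∧ mfderiv (𝓡 d) (𝓡 d) p x w = 0 ∧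
  ∃ (h : d = 2 + c) (b : B) (a : Fin c → TangentSpace (𝓡 c) b)
    (u : Fin c → TangentSpace (𝓡 d) x),
    ι b = p x ∧ oB.IsPositiveFrame b a ∧
    (∀ i, (mfderiv (𝓡 d) (𝓡 d) p x (u i) : EuclideanSpace ℝ (Fin d)) =
      mfderiv (𝓡 c) (𝓡 d) ι b (a i)) ∧
    oM.IsPositiveFrame x (fun i => Fin.append ![v, w] u (Fin.cast h i))

end BranchedCoverings

section Contact

variable {n m : ℕ}
  {M : Type*} [TopologicalSpace M] [ChartedSpace (EuclideanSpace ℝ (Fin (2 * n + 1))) M]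
  [IsManifold (𝓡 (2 * n + 1)) ∞ M]
  {Y : Type*} [TopologicalSpace Y] [ChartedSpace (EuclideanSpace ℝ (Fin (2 * n + 1))) Y]
  {B : Type*} [TopologicalSpace B] [ChartedSpace (EuclideanSpace ℝ (Fin (2 * m + 1))) B]
  [IsManifold (𝓡 (2 * m + 1)) ∞ B]

/-- The oriented submanifold `ι : B → Y` is a positive transverse contact submanifold of
`(Y, ker α)`: the restriction of `α` to `B` is a positive contact form. -/
def IsPositiveContactSubmanifold (oB : ManifoldOrientation (2 * m + 1) B) (ι : B → Y)
    (α : OneForm (𝓡 (2 * n + 1)) Y) : Prop :=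
  IsContactForm oB (OneForm.pullback ι α)

/-- The contact structure `ker β₁` on `M` is induced from `(Y, ker α)` by the branched covering `p`
whose branch locus is the oriented submanifold `ι : B → Y`: there is a path `β t` from `p^* α` to
`β₁`, consisting of contact forms for `t > 0`, such that `d (∂β/∂t |_{t = 0})` is positive on every
naturally oriented fibre of the normal bundle of the ramification locus. -/
def IsInducedContactForm (oM : ManifoldOrientation (2 * n + 1) M)
    (oB : ManifoldOrientation (2 * m + 1) B) (ι : B → Y) (p : M → Y)
    (α : OneForm (𝓡 (2 * n + 1)) Y) (β₁ : OneForm (𝓡 (2 * n + 1)) M) : Prop :=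
  ∃ (β : ℝ → OneForm (𝓡 (2 * n + 1)) M) (η : OneForm (𝓡 (2 * n + 1)) M),
    IsSmoothPath β ∧ β 0 = OneForm.pullback p α ∧ β 1 = β₁ ∧
    (∀ t ∈ Set.Ioc (0 : ℝ) 1, IsContactForm oM (β t)) ∧
    (∀ (x : M) (v : TangentSpace (𝓡 (2 * n + 1)) x),
      HasDerivWithinAt (fun t => β t x v) (η x v) (Set.Icc 0 1) 0) ∧
    ∀ x ∈ ramificationSet p, ∀ v w : TangentSpace (𝓡 (2 * n + 1)) x,
      IsPositiveNormalPair oM oB ι p x v w → 0 < η.d x v w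

/-- The 1-form `r² dθ = x dy - y dx` on `ℂ`. -/
def rSqDTheta : OneForm 𝓘(ℝ, ℂ) ℂ :=
  fun z => Complex.imCLM.comp (ContinuousLinearMap.mul ℝ ℂ (starRingEnd ℂ z))

/-- The 1-form `α + r² dθ` on `Y × ℂ`. -/
def addRSqDTheta (α : OneForm (𝓡 (2 * n + 1)) Y) :
    OneForm ((𝓡 (2 * n + 1)).prod 𝓘(ℝ, ℂ)) (Y × ℂ) :=
  fun q => OneForm.pullback Prod.fst α q + OneForm.pullback Prod.snd rSqDTheta q

/-- `F : M → Y × ℂ` is a contact embedding of `(M, ker β)` into `(Y × ℂ, ker lam)`, where `β` is a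
contact form: it is a smooth embedding, and `F^* lam` is a positive multiple of `β`, so that `F` is
transverse to `ker lam` and pulls it back, with its co-orientation, to `ker β`. -/
def IsContactEmbedding (F : M → Y × ℂ) (β : OneForm (𝓡 (2 * n + 1)) M)
    (lam : OneForm ((𝓡 (2 * n + 1)).prod 𝓘(ℝ, ℂ)) (Y × ℂ)) : Prop :=
  Manifold.IsSmoothEmbedding (𝓡 (2 * n + 1)) ((𝓡 (2 * n + 1)).prod 𝓘(ℝ, ℂ)) ∞ F ∧
  ∀ x : M, ∃ c : ℝ, 0 < c ∧ OneForm.pullback F lam x = c • β x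

end Contact

end ContactBraid

end

open scoped Manifold ContDiff Topology

noncomputable section

namespace ContactBraid

/-! ### Multilinear algebra of `a ∧ om ^ m`. -/

section WedgePower

/-! Write e = (p, f) and q = φ₁ ∘ p. Since r² dθ is homogeneous of degree two, the pull-back of α +
r² dθ by (q, ε f) is q^*α + ε² f^*(r² dθ). Shrinking the disk coordinate thus moves along the linear
path γ_t = q^*α + t f^*(r² dθ), with t = ε². It suffices to join the given contact form to γ_{ε²},
for some small ε, through contact forms. Gray's theorem then gives a diffeotopy Ψ of M for which
Ψ₁^*γ_{ε²} is a positive multiple of the given form, and x ↦ (φ_t(p(Ψ_t x)), (1 - t(1 - ε)) f(Ψ_t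
x)) is the required isotopy (`braidIsotopy`).

Orientation of B. As e is an immersion, df maps ker dp isomorphically onto ℂ at each ramified point.
B is oriented so that this isomorphism always preserves orientation. Its sign is locally constant
along the ramification locus (`IsBranchCoordinate.exists_normal_sign`). As B is not multiply
ramified, the ramified points over one component of B lie in one component of its preimage, so they
share one sign (`NotMultiplyRamified.iff_of_eventually_iff`), and the orientation of B is reversed
on the components where the sign is wrong (`exists_branch_orientation`). Then d(f^*(r² dθ)) = 2
f^*(dx ∧ dy) is positive on the normal fibres, so γ satisfies the same first-order condition as the
path β that defines the induced contact structure.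

Comparison of the two paths. Both start at q^*α. At an unramified point q^*α ∧ (d q^*α)^n does not
vanish, and it is positive as a limit of the positive volumes of β_t. At a ramified point it
vanishes, but the t-derivative of the volume at t = 0 is a positive multiple of dη(v, w) times the
volume of α on B, where η is the initial velocity and v, w span ker dp
(`hasDerivWithinAt_wedgePower`). This is linear in η, so it is positive for every convex combination
of β and γ. By compactness of M these combinations are nondegenerate for all 0 < t ≤ t₁
(`exists_nondegenerate_range`). Running along β from t = 1 down to t = ε² and then straight to
γ_{ε²} gives the family of contact forms (`concatFamily`).

Gray's theorem (`exists_gray_isotopy`) is proved from the equation ι_X da + ∂a/∂s = μ a, a(X) = 0,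
whose solution X is integrated as an autonomous field on ℝ × M. Smoothness of flows comes from the
implicit function theorem in a space of continuous curves (`contDiffAt_localFlow`). -/

/-- Slots of the multilinear form `a ⊗ om ⊗ ⋯ ⊗ om`: one for `a`, and a pair for each `om`. -/
abbrev WedgeSlot (m : ℕ) : Type := Option (Fin m × Bool)

/-- The slots, enumerated in the order used in `wedgePower`. -/
def slotFun (m : ℕ) : WedgeSlot m → Fin (2 * m + 1)
  | none => 0
  | some (i, false) => ⟨2 * i + 1, by omega⟩
  | some (i, true) => ⟨2 * i + 2, by omega⟩

lemma slotFun_bijective (m : ℕ) : Function.Bijective (slotFun m) := by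
  rw [Fintype.bijective_iff_injective_and_card]
  refine ⟨?_, by simp; ring⟩
  rintro (_ | ⟨i, _ | _⟩) (_ | ⟨j, _ | _⟩) h <;>
    simp only [slotFun, Fin.ext_iff, Fin.val_zero] at h <;>
    first | rfl | omega | (have hij : i = j := by ext; omega
                           rw [hij])

def slotEquiv (m : ℕ) : WedgeSlot m ≃ Fin (2 * m + 1) :=
  Equiv.ofBijective _ (slotFun_bijective m)

@[simp] lemma slotEquiv_none (m : ℕ) : slotEquiv m none = 0 := rfl
@[simp] lemma slotEquiv_false (m : ℕ) (i : Fin m) :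
    slotEquiv m (some (i, false)) = ⟨2 * i + 1, by omega⟩ := rfl
@[simp] lemma slotEquiv_true (m : ℕ) (i : Fin m) :
    slotEquiv m (some (i, true)) = ⟨2 * i + 2, by omega⟩ := rfl

/-- `wedgePower` without normalization, on vectors labelled by slots. -/
def slotWedge {V : Type*} (m : ℕ) (a : V → ℝ) (om : V → V → ℝ) (v : WedgeSlot m → V) : ℝ :=
  ∑ σ : Equiv.Perm (WedgeSlot m), ((Equiv.Perm.sign σ : ℤ) : ℝ) * (a (v (σ none)) *
    ∏ i : Fin m, om (v (σ (some (i, false)))) (v (σ (some (i, true)))))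

/-- Relabelling the arguments conjugates the permutations, which does not change their signs. -/
lemma wedgePower_eq_slotWedge {V : Type*} (m : ℕ) (a : V → ℝ) (om : V → V → ℝ)
    (v : Fin (2 * m + 1) → V) :
    wedgePower m a om v = (1 / 2 : ℝ) ^ m * slotWedge m a om (v ∘ slotEquiv m) := by
  unfold wedgePower slotWedge
  congr 1
  symm
  refine Fintype.sum_equiv (slotEquiv m).permCongr _ _ fun σ => ?_
  have h0 : (slotEquiv m).symm 0 = none := by rw [Equiv.symm_apply_eq]; rfl
  have h1 : ∀ i : Fin m, (slotEquiv m).symm ⟨2 * i + 1, by omega⟩ = some (i, false) := by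
    intro i; rw [Equiv.symm_apply_eq]; rfl
  have h2 : ∀ i : Fin m, (slotEquiv m).symm ⟨2 * i + 2, by omega⟩ = some (i, true) := by
    intro i; rw [Equiv.symm_apply_eq]; rfl
  simp only [Equiv.Perm.sign_permCongr, Equiv.permCongr_apply, h0, h1, h2, Function.comp,
    mul_assoc]

variable {V : Type*} [AddCommGroup V] [Module ℝ V]

/-- Every slot occurs exactly once in the product, so with the other vectors frozen what remains is
a constant times a linear form. Additivity and homogeneity of `slotMultilinear` both follow from
this. -/
lemma update_slot_cases {m : ℕ} [DecidableEq (WedgeSlot m)] (a : V →ₗ[ℝ] ℝ) (om : V →ₗ[ℝ] V →ₗ[ℝ] ℝ)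
    (v : WedgeSlot m → V) (k : WedgeSlot m) :
    ∃ l : V →ₗ[ℝ] ℝ, ∀ x, a (Function.update v k x none) *
      ∏ i : Fin m, om (Function.update v k x (some (i, false)))
        (Function.update v k x (some (i, true))) = l x := by
  rcases k with _ | ⟨j, b⟩
  · refine ⟨(∏ i : Fin m, om (v (some (i, false))) (v (some (i, true)))) • a, fun x => ?_⟩
    simp [mul_comm]
  · have key : ∀ x, ∏ i ∈ Finset.univ.erase j, om (Function.update v (some (j, b)) x (some (i, false)))
        (Function.update v (some (j, b)) x (some (i, true))) =
        ∏ i ∈ Finset.univ.erase j, om (v (some (i, false))) (v (some (i, true))) := by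
      intro x
      refine Finset.prod_congr rfl fun i hi => ?_
      have hij : i ≠ j := Finset.ne_of_mem_erase hi
      rw [Function.update_of_ne (by simp [hij]), Function.update_of_ne (by simp [hij])]
    set c := ∏ i ∈ Finset.univ.erase j, om (v (some (i, false))) (v (some (i, true)))
    cases b
    · refine ⟨(a (v none) * c) • (om.flip (v (some (j, true)))), fun x => ?_⟩
      rw [← Finset.mul_prod_erase _ _ (Finset.mem_univ j), key]
      simp; ring
    · refine ⟨(a (v none) * c) • (om (v (some (j, false)))), fun x => ?_⟩
      rw [← Finset.mul_prod_erase _ _ (Finset.mem_univ j), key]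
      simp; ring

/-- `a ⊗ om ⊗ ⋯ ⊗ om` as a multilinear map. -/
def slotMultilinear (m : ℕ) (a : V →ₗ[ℝ] ℝ) (om : V →ₗ[ℝ] V →ₗ[ℝ] ℝ) :
    MultilinearMap ℝ (fun _ : WedgeSlot m => V) ℝ where
  toFun v := a (v none) * ∏ i : Fin m, om (v (some (i, false))) (v (some (i, true)))
  map_update_add' := by
    intro inst v k x y
    obtain ⟨l, hl⟩ := update_slot_cases a om v k
    exact (hl _).trans ((map_add l x y).trans (congrArg₂ _ (hl x).symm (hl y).symm))
  map_update_smul' := by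
    intro inst v k c x
    obtain ⟨l, hl⟩ := update_slot_cases a om v k
    exact (hl _).trans ((map_smul l c x).trans (congrArg _ (hl x).symm))

/-- `wedgePower` as an alternating map. -/
def wedgeAlternating (m : ℕ) (a : V →ₗ[ℝ] ℝ) (om : V →ₗ[ℝ] V →ₗ[ℝ] ℝ) :
    V [⋀^Fin (2 * m + 1)]→ₗ[ℝ] ℝ :=
  (1 / 2 : ℝ) ^ m • (MultilinearMap.alternatization (slotMultilinear m a om)).domDomCongr
    (slotEquiv m)

lemma wedgeAlternating_apply (m : ℕ) (a : V →ₗ[ℝ] ℝ) (om : V →ₗ[ℝ] V →ₗ[ℝ] ℝ)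
    (v : Fin (2 * m + 1) → V) :
    wedgeAlternating m a om v = wedgePower m a (fun x y => om x y) v := by
  rw [wedgePower_eq_slotWedge]
  simp [wedgeAlternating, slotWedge, MultilinearMap.alternatization_apply, slotMultilinear,
    Units.smul_def]

/-- The number of arguments is the dimension, so an alternating form vanishes on one basis only if
it is zero. -/
lemma wedgePower_ne_zero_of_basis {m : ℕ} (a : V →ₗ[ℝ] ℝ) (om : V →ₗ[ℝ] V →ₗ[ℝ] ℝ)
    (e e' : Module.Basis (Fin (2 * m + 1)) ℝ V) (h : wedgePower m a (fun x y => om x y) e ≠ 0) :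
    wedgePower m a (fun x y => om x y) e' ≠ 0 := by
  rw [← wedgeAlternating_apply] at h ⊢
  rw [AlternatingMap.map_basis_ne_zero_iff] at h ⊢
  exact h

/-- If `a ∧ om ^ m` is a volume form, then `om` is nondegenerate on the kernel of `a`. -/
lemma nondegenerate_of_wedgePower_ne_zero {m : ℕ} (a : V →ₗ[ℝ] ℝ) (om : V →ₗ[ℝ] V →ₗ[ℝ] ℝ)
    (hom : ∀ x y, om x y = - om y x)
    (e : Module.Basis (Fin (2 * m + 1)) ℝ V) (h : wedgePower m a (fun x y => om x y) e ≠ 0) :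
    (∃ w, a w ≠ 0) ∧ ∀ v, a v = 0 → (∀ w, a w = 0 → om v w = 0) → v = 0 := by
  have hfd : FiniteDimensional ℝ V := Module.Finite.of_basis e
  have ha : ∃ w, a w ≠ 0 := by
    by_contra hcon
    push Not at hcon
    exact h (by simp [wedgePower, hcon])
  refine ⟨ha, fun v hv hvw => ?_⟩
  -- A nonzero v in the kernel of `a`, orthogonal to that kernel, is completed to a basis of the
  -- kernel, and w0 is added. On the resulting basis every term of the alternating sum vanishes.
  by_contra hv0
  obtain ⟨w0, hw0⟩ := ha
  have hrank : Module.finrank ℝ (LinearMap.ker a) = 2 * m := by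
    have h1 := LinearMap.finrank_range_add_finrank_ker a
    have h2 : LinearMap.range a = ⊤ := by
      rw [LinearMap.range_eq_top]
      exact LinearMap.surjective (by rintro rfl; simp at hw0)
    rw [h2, finrank_top, Module.finrank_self, Module.finrank_eq_card_basis e, Fintype.card_fin] at h1
    omega
  let v' : LinearMap.ker a := ⟨v, hv⟩
  have hv' : v' ≠ 0 := fun h => hv0 (congrArg Subtype.val h)
  have hs : LinearIndepOn ℝ id ({v'} : Set (LinearMap.ker a)) := by
    simpa using LinearIndepOn.singleton (R := ℝ) (v := id) (i := v') hv'
  let b0 := Module.Basis.extend hs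
  have hfin : Fintype (hs.extend (Set.subset_univ _)) := FiniteDimensional.fintypeBasisIndex b0
  have hcard : Fintype.card (hs.extend (Set.subset_univ _)) = 2 * m := by
    rw [← hrank, Module.finrank_eq_card_basis b0]
  let eq := Fintype.equivFinOfCardEq hcard
  let b1 := b0.reindex eq
  obtain ⟨j, hj⟩ : ∃ j, b1 j = v' := by
    have hm : v' ∈ hs.extend (Set.subset_univ _) :=
      hs.subset_extend (Set.subset_univ _) rfl
    refine ⟨eq ⟨v', hm⟩, ?_⟩
    simp [b1, b0]
  let b : Fin (2 * m + 1) → V := Fin.cons w0 fun i => (b1 i : V)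
  have hb1 : ∀ i, a (b1 i : V) = 0 := fun i => (b1 i).2
  have hli : LinearIndependent ℝ b := by
    rw [linearIndependent_finCons]
    refine ⟨b1.linearIndependent.map' (LinearMap.ker a).subtype (Submodule.ker_subtype _), ?_⟩
    intro hmem
    have : Submodule.span ℝ (Set.range fun i => (b1 i : V)) ≤ LinearMap.ker a := by
      rw [Submodule.span_le]
      rintro _ ⟨i, rfl⟩
      exact hb1 i
    exact hw0 (this hmem)
  let B := basisOfLinearIndependentOfCardEqFinrank hli
    (by rw [Module.finrank_eq_card_basis e])
  refine wedgePower_ne_zero_of_basis a om e B h ?_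
  rw [coe_basisOfLinearIndependentOfCardEqFinrank, wedgePower_eq_slotWedge, slotWedge,
    Finset.sum_eq_zero, mul_zero]
  intro σ _
  set f := b ∘ slotEquiv m
  have hfn : ∀ k : WedgeSlot m, k ≠ none → a (f k) = 0 := by
    intro k hk
    have : slotEquiv m k ≠ 0 := fun h => hk ((slotEquiv m).injective (by simpa using h))
    obtain ⟨i, hi⟩ := Fin.exists_succ_eq.2 this
    simp [f, ← hi, b, hb1]
  -- If `a` receives w0, all factors `om` pair kernel vectors, and the one that contains v is zero.
  -- Otherwise `a` itself receives a kernel vector.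
  by_cases hσ : σ none = none
  · have hj0 : (slotEquiv m).symm j.succ ≠ none := by
      intro h
      rw [Equiv.symm_apply_eq, slotEquiv_none] at h
      exact Fin.succ_ne_zero _ h
    set k := σ.symm ((slotEquiv m).symm j.succ) with hk
    have hσk : f (σ k) = v := by
      simp [hk, f, b, hj, v']
    have hk0 : k ≠ none := by
      intro h
      rw [h] at hk
      apply hj0
      rw [← hσ, hk]; simp
    have hoth : ∀ l, l ≠ none → a (f (σ l)) = 0 := fun l hl =>
      hfn _ fun h => hl (σ.injective (by rw [h, hσ]))
    rcases hkk : k with _ | ⟨i, _ | _⟩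
    · exact absurd hkk hk0
    · rw [Finset.prod_eq_zero (Finset.mem_univ i), mul_zero, mul_zero]
      rw [← hkk, hσk]
      exact hvw _ (hoth _ (by simp))
    · rw [Finset.prod_eq_zero (Finset.mem_univ i), mul_zero, mul_zero]
      rw [← hkk, hσk, hom, hvw _ (hoth _ (by simp)), neg_zero]
  · rw [hfn _ hσ, zero_mul, mul_zero]

end WedgePower

/-! ### First variation of the volume form at a degenerate point. -/

section WedgeDerivative

/-- Shift of the slots by one pair. -/
def slotShift (m : ℕ) : WedgeSlot m → WedgeSlot (m + 1)
  | none => none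
  | some (i, b) => some (i.succ, b)

/-- Through this identification, permutations of the slots for m extend to the permutations for m +
1 that fix both members of pair 0. -/
def slotShiftEquiv (m : ℕ) : WedgeSlot m ≃
    {k : WedgeSlot (m + 1) // k ≠ some (0, false) ∧ k ≠ some (0, true)} :=
  Equiv.ofBijective (fun k => ⟨slotShift m k, by
      rcases k with _ | ⟨i, b⟩ <;> simp [slotShift, Fin.succ_ne_zero]⟩) (by
    constructor
    · rintro (_ | ⟨i, b⟩) (_ | ⟨j, c⟩) h <;> simp [slotShift] at h ⊢
      exact h
    · rintro ⟨_ | ⟨i, b⟩, hk⟩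
      · exact ⟨none, rfl⟩
      · have hi : i ≠ 0 := by
          rintro rfl
          cases b <;> simp at hk
        obtain ⟨j, rfl⟩ := Fin.exists_succ_eq.2 hi
        exact ⟨some (j, b), rfl⟩)

variable {V : Type*}

lemma sum_perm_fixing_pair (m : ℕ) (T : Equiv.Perm (WedgeSlot (m + 1)) → ℝ) :
    (∑ σ, if σ (some (0, false)) = some (0, false) ∧ σ (some (0, true)) = some (0, true)
      then T σ else 0) = ∑ τ : Equiv.Perm (WedgeSlot m), T (τ.extendDomain (slotShiftEquiv m)) := by
  rw [← Finset.sum_filter]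
  symm
  refine Finset.sum_bij (fun τ _ => τ.extendDomain (slotShiftEquiv m)) ?_ ?_ ?_ ?_
  · intro τ _
    simp only [Finset.mem_filter, Finset.mem_univ, true_and]
    constructor <;> exact Equiv.Perm.extendDomain_apply_not_subtype _ _ (by simp)
  · intro τ _ τ' _ h
    exact Equiv.Perm.extendDomainHom_injective (slotShiftEquiv m) h
  · intro σ hσ
    simp only [Finset.mem_filter, Finset.mem_univ, true_and] at hσ
    have hP : ∀ k : WedgeSlot (m + 1), (σ k ≠ some (0, false) ∧ σ k ≠ some (0, true)) ↔
        (k ≠ some (0, false) ∧ k ≠ some (0, true)) := by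
      intro k
      have h1 : σ k = some (0, false) ↔ k = some (0, false) := by
        conv_lhs => rw [← hσ.1]
        exact σ.injective.eq_iff
      have h2 : σ k = some (0, true) ↔ k = some (0, true) := by
        conv_lhs => rw [← hσ.2]
        exact σ.injective.eq_iff
      rw [Ne, Ne, h1, h2]
    refine ⟨(slotShiftEquiv m).symm.permCongr (σ.subtypePerm hP), Finset.mem_univ _, ?_⟩
    ext1 k
    by_cases hk : k ≠ some (0, false) ∧ k ≠ some (0, true)
    · rw [Equiv.Perm.extendDomain_apply_subtype (p := fun k : WedgeSlot (m + 1) =>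
        k ≠ some (0, false) ∧ k ≠ some (0, true)) _ _ hk]
      simp [Equiv.permCongr_apply]
    · rw [Equiv.Perm.extendDomain_apply_not_subtype (p := fun k : WedgeSlot (m + 1) =>
        k ≠ some (0, false) ∧ k ≠ some (0, true)) _ _ hk]
      rw [not_and_or, not_not, not_not] at hk
      rcases hk with rfl | rfl
      · exact hσ.1.symm
      · exact hσ.2.symm
  · intro τ _; rfl

/-- The summand of the derivative of `slotWedge` in which the `i`-th factor is differentiated. -/
def slotTerm (m : ℕ) (a : V → ℝ) (om ze : V → V → ℝ) (v : WedgeSlot (m + 1) → V)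
    (i : Fin (m + 1)) (σ : Equiv.Perm (WedgeSlot (m + 1))) : ℝ :=
  ((Equiv.Perm.sign σ : ℤ) : ℝ) * (a (v (σ none)) *
    ((∏ j ∈ Finset.univ.erase i, om (v (σ (some (j, false)))) (v (σ (some (j, true))))) *
      ze (v (σ (some (i, false)))) (v (σ (some (i, true))))))

/-- Exchanging pair i with pair 0 is the same transposition performed on both members of the pairs,
hence an even permutation. All factors `om` therefore contribute equally to the derivative. -/
lemma sum_slotTerm_eq_zero_index (m : ℕ) (a : V → ℝ) (om ze : V → V → ℝ)
    (v : WedgeSlot (m + 1) → V) (i : Fin (m + 1)) :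
    ∑ σ, slotTerm m a om ze v i σ = ∑ σ, slotTerm m a om ze v 0 σ := by
  set ρ : Equiv.Perm (Fin (m + 1)) := Equiv.swap 0 i
  set R : Equiv.Perm (WedgeSlot (m + 1)) :=
    Equiv.optionCongr (Equiv.prodCongrLeft fun _ : Bool => ρ) with hR
  have hs : Equiv.Perm.sign R = 1 := by
    rw [hR, Equiv.optionCongr_sign, Equiv.Perm.sign_prodCongrLeft]
    rw [Fintype.prod_bool, Int.units_mul_self]
  refine Fintype.sum_equiv (Equiv.mulRight R) _ _ fun σ => ?_
  have h0 : ρ 0 = i := Equiv.swap_apply_left _ _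
  have hρ : ∏ j ∈ Finset.univ.erase i, om (v (σ (some (j, false)))) (v (σ (some (j, true)))) =
      ∏ j ∈ Finset.univ.erase 0, om (v (σ (some (ρ j, false)))) (v (σ (some (ρ j, true)))) := by
    symm
    refine Finset.prod_equiv ρ ?_ fun j _ => rfl
    intro j
    simp only [Finset.mem_erase, Finset.mem_univ, and_true, ← h0, Ne, ρ.injective.eq_iff]
  simp only [slotTerm, Equiv.coe_mulRight, Equiv.Perm.sign_mul, hs, mul_one, Equiv.Perm.mul_apply,
    hρ]
  simp [hR, h0]

/-- The two special vectors are annihilated by `a` and `om`, so a permutation contributes only if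
both land in the differentiated factor `ze`. There are two ways to place them. These contribute
equally because both `ze` and the sign change under the swap, which accounts for the factor 2. The
other slots are permuted freely. -/
lemma sum_slotTerm_zero (m : ℕ) (a : V → ℝ) (om ze : V → V → ℝ) (v : WedgeSlot (m + 1) → V)
    (ha0 : a (v (some (0, false))) = 0) (ha1 : a (v (some (0, true))) = 0)
    (h0 : ∀ x, om (v (some (0, false))) x = 0) (h0' : ∀ x, om x (v (some (0, false))) = 0)
    (h1 : ∀ x, om (v (some (0, true))) x = 0) (h1' : ∀ x, om x (v (some (0, true))) = 0)
    (hze : ∀ x y, ze x y = - ze y x) :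
    ∑ σ, slotTerm m a om ze v 0 σ = 2 * ze (v (some (0, false))) (v (some (0, true))) *
      slotWedge m a om (v ∘ slotShift m) := by
  classical
  set p : WedgeSlot (m + 1) := some (0, false) with hp
  set q : WedgeSlot (m + 1) := some (0, true) with hq
  have hpq : p ≠ q := by simp [hp, hq]
  set T := slotTerm m a om ze v 0
  have hloc : ∀ σ : Equiv.Perm (WedgeSlot (m + 1)), T σ ≠ 0 → ∀ k, (σ k = p ∨ σ k = q) →
      (k = p ∨ k = q) := by
    intro σ hσ k hk
    by_contra hcon
    apply hσ
    rcases k with _ | ⟨j, b⟩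
    · simp only [T, slotTerm]
      rcases hk with hk | hk <;> rw [hk] <;> simp [ha0, ha1]
    · have hj : j ≠ 0 := by
        rintro rfl
        cases b <;> simp [hp, hq] at hcon
      simp only [T, slotTerm]
      rw [Finset.prod_eq_zero (Finset.mem_erase.2 ⟨hj, Finset.mem_univ j⟩)]
      · ring
      · cases b <;> rcases hk with hk | hk <;> rw [hk] <;> simp [h0, h0', h1, h1']
  have hsplit : ∀ σ, T σ = (if σ p = p ∧ σ q = q then T σ else 0) +
      (if σ p = q ∧ σ q = p then T σ else 0) := by
    intro σ
    by_cases hT : T σ = 0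
    · simp [hT]
    · have hp' := hloc σ hT (σ.symm p) (by simp)
      have hq' := hloc σ hT (σ.symm q) (by simp)
      simp only [Equiv.symm_apply_eq] at hp' hq'
      rcases hp' with hp' | hp'
      · rcases hq' with hq' | hq'
        · exact absurd (hp'.trans hq'.symm) hpq
        · simp [← hp', ← hq', hpq]
      · rcases hq' with hq' | hq'
        · simp [← hp', ← hq', hpq.symm]
        · exact absurd (hp'.trans hq'.symm) hpq
  have hB : ∑ σ, (if σ p = q ∧ σ q = p then T σ else 0) =
      ∑ σ, (if σ p = p ∧ σ q = q then T σ else 0) := by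
    refine Fintype.sum_equiv (Equiv.mulRight (Equiv.swap p q)) _ _ fun σ => ?_
    have hT : T (σ * Equiv.swap p q) = T σ := by
      simp only [T, slotTerm, Equiv.Perm.sign_mul, Equiv.Perm.sign_swap hpq, Equiv.Perm.mul_apply]
      have e0 : Equiv.swap p q none = none :=
        Equiv.swap_apply_of_ne_of_ne (by simp [hp]) (by simp [hq])
      have e1 : ∀ j : Fin (m + 1), ∀ b, j ≠ 0 → Equiv.swap p q (some (j, b)) = some (j, b) := by
        intro j b hj
        exact Equiv.swap_apply_of_ne_of_ne (by simp [hp, hj]) (by simp [hq, hj])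
      have e2 : ∏ j ∈ Finset.univ.erase 0, om (v (σ (Equiv.swap p q (some (j, false)))))
          (v (σ (Equiv.swap p q (some (j, true))))) =
          ∏ j ∈ Finset.univ.erase 0, om (v (σ (some (j, false)))) (v (σ (some (j, true)))) := by
        refine Finset.prod_congr rfl fun j hj => ?_
        rw [e1 j _ (Finset.ne_of_mem_erase hj), e1 j _ (Finset.ne_of_mem_erase hj)]
      rw [e0, e2, ← hp, ← hq, Equiv.swap_apply_left, Equiv.swap_apply_right, hze (v (σ q))]
      push_cast
      ring
    simp only [Equiv.coe_mulRight, hT, Equiv.Perm.mul_apply, Equiv.swap_apply_left,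
      Equiv.swap_apply_right]
    simp only [and_comm]
  have hA : ∑ σ, (if σ p = p ∧ σ q = q then T σ else 0) = ze (v p) (v q) *
      slotWedge m a om (v ∘ slotShift m) := by
    rw [sum_perm_fixing_pair m T, slotWedge, Finset.mul_sum]
    refine Finset.sum_congr rfl fun τ _ => ?_
    have hsh : ∀ k, τ.extendDomain (slotShiftEquiv m) (slotShift m k) = slotShift m (τ k) :=
      fun k => Equiv.Perm.extendDomain_apply_image τ (slotShiftEquiv m) k
    have hp1 : τ.extendDomain (slotShiftEquiv m) p = p :=
      Equiv.Perm.extendDomain_apply_not_subtype _ _ (by simp [hp])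
    have hq1 : τ.extendDomain (slotShiftEquiv m) q = q :=
      Equiv.Perm.extendDomain_apply_not_subtype _ _ (by simp [hq])
    have hn : τ.extendDomain (slotShiftEquiv m) none = slotShift m (τ none) := hsh none
    simp only [T, slotTerm]
    have hp1' : τ.extendDomain (slotShiftEquiv m) (some (0, false)) = some (0, false) := hp1
    have hq1' : τ.extendDomain (slotShiftEquiv m) (some (0, true)) = some (0, true) := hq1
    rw [hp1', hq1', hn, Equiv.Perm.sign_extendDomain]
    have hprod : ∏ j ∈ Finset.univ.erase 0,
        om (v (τ.extendDomain (slotShiftEquiv m) (some (j, false))))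
          (v (τ.extendDomain (slotShiftEquiv m) (some (j, true)))) =
        ∏ i : Fin m, om (v (slotShift m (τ (some (i, false)))))
          (v (slotShift m (τ (some (i, true))))) := by
      have : (Finset.univ.erase (0 : Fin (m + 1))) = Finset.univ.map (Fin.succEmb m) := by
        ext j
        simp [Fin.exists_succ_eq]
      rw [this, Finset.prod_map]
      refine Finset.prod_congr rfl fun i _ => ?_
      rw [← hsh, ← hsh]; rfl
    rw [hprod]
    simp only [Function.comp]
    ring
  calc ∑ σ, T σ = ∑ σ, ((if σ p = p ∧ σ q = q then T σ else 0) +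
        (if σ p = q ∧ σ q = p then T σ else 0)) := Finset.sum_congr rfl fun σ _ => hsplit σ
    _ = _ := by rw [Finset.sum_add_distrib, hB, hA]; ring

lemma hasDerivWithinAt_slotWedge {m : ℕ} {a : ℝ → V → ℝ} {om : ℝ → V → V → ℝ} {a' : V → ℝ}
    {ze : V → V → ℝ} {s : Set ℝ} {t : ℝ} (v : WedgeSlot (m + 1) → V)
    (ha : ∀ x, HasDerivWithinAt (fun r => a r x) (a' x) s t)
    (hom : ∀ x y, HasDerivWithinAt (fun r => om r x y) (ze x y) s t)
    (ha0 : a t (v (some (0, false))) = 0) (ha1 : a t (v (some (0, true))) = 0)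
    (h0 : ∀ x, om t (v (some (0, false))) x = 0) (h0' : ∀ x, om t x (v (some (0, false))) = 0)
    (h1 : ∀ x, om t (v (some (0, true))) x = 0) (h1' : ∀ x, om t x (v (some (0, true))) = 0)
    (hze : ∀ x y, ze x y = - ze y x) :
    HasDerivWithinAt (fun r => slotWedge (m + 1) (a r) (om r) v)
      ((m + 1) * (2 * ze (v (some (0, false))) (v (some (0, true))) *
      slotWedge m (a t) (om t) (v ∘ slotShift m))) s t := by
  have key : HasDerivWithinAt (fun r => slotWedge (m + 1) (a r) (om r) v)
      (∑ σ, ∑ i, slotTerm m (a t) (om t) ze v i σ) s t := by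
    unfold slotWedge
    refine HasDerivWithinAt.fun_sum fun σ _ => ?_
    have h := ((ha (v (σ none))).fun_mul (HasDerivWithinAt.fun_finsetProd (u := Finset.univ)
      (fun i _ => hom (v (σ (some (i, false)))) (v (σ (some (i, true))))))).const_mul
        ((Equiv.Perm.sign σ : ℤ) : ℝ)
    refine h.congr_deriv ?_
    -- This removes the term in which `a` is differentiated: only one of the two annihilated vectors
    -- fits into the slot of `a`, so the other one kills a factor `om`.
    have hz : ∏ i, om t (v (σ (some (i, false)))) (v (σ (some (i, true)))) = 0 := by
      obtain ⟨k, hk, hkk⟩ : ∃ k, k ≠ none ∧ (σ k = some (0, false) ∨ σ k = some (0, true)) := by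
        by_cases hn : σ.symm (some (0, false)) = none
        · refine ⟨σ.symm (some (0, true)), fun h => ?_, Or.inr (by simp)⟩
          rw [← h] at hn
          simpa using σ.symm.injective hn
        · exact ⟨_, hn, Or.inl (by simp)⟩
      rcases k with _ | ⟨i, b⟩
      · exact absurd rfl hk
      · refine Finset.prod_eq_zero (Finset.mem_univ i) ?_
        cases b <;> rcases hkk with hk | hk <;> rw [hk] <;> simp [h0, h0', h1, h1']
    rw [hz, mul_zero, zero_add, Finset.mul_sum, Finset.mul_sum]
    simp only [slotTerm, smul_eq_mul]
  refine key.congr_deriv ?_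
  rw [Finset.sum_comm]
  simp only [sum_slotTerm_eq_zero_index]
  rw [sum_slotTerm_zero m _ _ _ v ha0 ha1 h0 h0' h1 h1' hze]
  simp

/-- The first-order variation of `a ∧ om ^ (m + 1)` in directions `v 0`, `v 1` annihilated by `a`
and `om`. -/
lemma hasDerivWithinAt_wedgePower [AddCommGroup V] [Module ℝ V] {m : ℕ} {a : ℝ → V →ₗ[ℝ] ℝ}
    {om : ℝ → V →ₗ[ℝ] V →ₗ[ℝ] ℝ} {a' : V → ℝ}
    {ze : V → V → ℝ} {s : Set ℝ} {t : ℝ} (v : Fin (2 * (m + 1) + 1) → V)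
    (ha : ∀ x, HasDerivWithinAt (fun r => a r x) (a' x) s t)
    (hom : ∀ x y, HasDerivWithinAt (fun r => om r x y) (ze x y) s t)
    (ha0 : a t (v 0) = 0) (ha1 : a t (v 1) = 0)
    (h0 : ∀ x, om t (v 0) x = 0) (h0' : ∀ x, om t x (v 0) = 0)
    (h1 : ∀ x, om t (v 1) x = 0) (h1' : ∀ x, om t x (v 1) = 0)
    (hze : ∀ x y, ze x y = - ze y x) :
    HasDerivWithinAt (fun r => wedgePower (m + 1) (a r) (fun x y => om r x y) v)
      ((m + 1) * ze (v 0) (v 1) * wedgePower m (a t) (fun x y => om t x y)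
        (fun k => v ⟨k + 2, by omega⟩)) s t := by
  -- The slot of `a` comes first, so pair 0 occupies positions 1 and 2, while the degenerate
  -- directions are `v 0` and `v 1`. The 3-cycle c moves them there and `v 2` to the front. It is
  -- even, so no sign appears.
  set c : Equiv.Perm (Fin (2 * (m + 1) + 1)) := Equiv.swap 0 1 * Equiv.swap 0 2 with hc
  have hv1 : (1 : Fin (2 * (m + 1) + 1)).val = 1 :=
    Nat.mod_eq_of_lt (show 1 < 2 * (m + 1) + 1 by omega)
  have hv2 : (2 : Fin (2 * (m + 1) + 1)).val = 2 :=
    Nat.mod_eq_of_lt (show 2 < 2 * (m + 1) + 1 by omega)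
  have h01 : (0 : Fin (2 * (m + 1) + 1)) ≠ 1 := by rw [Ne, Fin.ext_iff, hv1]; simp
  have h02 : (0 : Fin (2 * (m + 1) + 1)) ≠ 2 := by rw [Ne, Fin.ext_iff, hv2]; simp
  have h12 : (1 : Fin (2 * (m + 1) + 1)) ≠ 2 := by rw [Ne, Fin.ext_iff, hv1, hv2]; simp
  have c0 : c 0 = 2 := by
    rw [hc, Equiv.Perm.mul_apply, Equiv.swap_apply_left,
      Equiv.swap_apply_of_ne_of_ne h02.symm h12.symm]
  have c1 : c 1 = 0 := by
    rw [hc, Equiv.Perm.mul_apply, Equiv.swap_apply_of_ne_of_ne h01.symm h12, Equiv.swap_apply_right]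
  have c2 : c 2 = 1 := by
    rw [hc, Equiv.Perm.mul_apply, Equiv.swap_apply_right, Equiv.swap_apply_left]
  have c3 : ∀ k, k ≠ 0 → k ≠ 1 → k ≠ 2 → c k = k := by
    intro k hk0 hk1 hk2
    rw [hc, Equiv.Perm.mul_apply, Equiv.swap_apply_of_ne_of_ne hk0 hk2,
      Equiv.swap_apply_of_ne_of_ne hk0 hk1]
  have hcs : Equiv.Perm.sign c = 1 := by
    rw [hc, Equiv.Perm.sign_mul, Equiv.Perm.sign_swap h01, Equiv.Perm.sign_swap h02]
    rfl
  have hperm : ∀ r, wedgePower (m + 1) (a r) (fun x y => om r x y) v =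
      (1 / 2 : ℝ) ^ (m + 1) * slotWedge (m + 1) (a r) (fun x y => om r x y)
        ((v ∘ c) ∘ slotEquiv (m + 1)) := by
    intro r
    rw [← wedgePower_eq_slotWedge, ← wedgeAlternating_apply, ← wedgeAlternating_apply,
      AlternatingMap.map_perm, hcs, one_smul]
  have e1 : slotEquiv (m + 1) (some (0, false)) = 1 := by rw [Fin.ext_iff, hv1]; simp
  have e2 : slotEquiv (m + 1) (some (0, true)) = 2 := by rw [Fin.ext_iff, hv2]; simp
  have v1 : ((v ∘ c) ∘ slotEquiv (m + 1)) (some (0, false)) = v 0 := by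
    rw [Function.comp, Function.comp, e1, c1]
  have v2 : ((v ∘ c) ∘ slotEquiv (m + 1)) (some (0, true)) = v 1 := by
    rw [Function.comp, Function.comp, e2, c2]
  simp only [hperm]
  have hmain := (hasDerivWithinAt_slotWedge (a := fun r x => a r x) (om := fun r x y => om r x y)
    (a' := a') (ze := ze) (s := s) (t := t)
    ((v ∘ c) ∘ slotEquiv (m + 1)) ha hom (by rw [v1, ha0]) (by rw [v2, ha1])
    (by rw [v1]; exact h0) (by rw [v1]; exact h0') (by rw [v2]; exact h1) (by rw [v2]; exact h1')
    hze).const_mul ((1 / 2 : ℝ) ^ (m + 1))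
  refine hmain.congr_deriv ?_
  rw [v1, v2, wedgePower_eq_slotWedge]
  have hv : ((v ∘ c) ∘ slotEquiv (m + 1)) ∘ slotShift m =
      (fun k : Fin (2 * m + 1) => v ⟨k + 2, by omega⟩) ∘ slotEquiv m := by
    funext k
    rcases k with _ | ⟨i, _ | _⟩
    · simp only [Function.comp, slotShift, slotEquiv_none, c0]
      exact congrArg v (Fin.ext (by rw [hv2]; simp))
    · simp only [Function.comp, slotShift, slotEquiv_false]
      rw [c3]
      · exact congrArg v (Fin.ext (by simp; ring))
      all_goals rw [Ne, Fin.ext_iff]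
      · simp
      · rw [hv1]; simp
      · rw [hv2]; simp; try omega
    · simp only [Function.comp, slotShift, slotEquiv_true]
      rw [c3]
      · exact congrArg v (Fin.ext (by simp; ring))
      all_goals rw [Ne, Fin.ext_iff]
      · simp
      · rw [hv1]; simp
      · rw [hv2]; simp; try omega
  rw [hv]
  -- The factor 2 from the two placements cancels the extra 1/2 in the normalization.
  rw [pow_succ]
  ring

end WedgeDerivative

/-! ### The exterior derivative of 1-forms on normed spaces. -/

section ExteriorDerivative

lemma two_le_infty : (2 : WithTop ℕ∞) ≤ ∞ :=
  (WithTop.coe_le_coe (a := ⊤) (b := (2 : ℕ∞))).2 le_top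

variable {E : Type*} [NormedAddCommGroup E] [NormedSpace ℝ E]
  {E' : Type*} [NormedAddCommGroup E'] [NormedSpace ℝ E']

/-- The exterior derivative of a 1-form on a normed space. -/
def d1 (A : E → E →L[ℝ] ℝ) (x v w : E) : ℝ := fderiv ℝ A x v w - fderiv ℝ A x w v

lemma d1_antisymm (A : E → E →L[ℝ] ℝ) (x v w : E) : d1 A x v w = - d1 A x w v := by
  simp [d1]

lemma extDeriv_ofSubsingleton {A : E → E →L[ℝ] ℝ} {x : E} (hA : DifferentiableAt ℝ A x) (v w : E) :
    extDeriv (fun u : E => ContinuousAlternatingMap.ofSubsingleton ℝ E ℝ (0 : Fin 1) (A u)) x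
      ![v, w] = d1 A x v w := by
  have h : DifferentiableAt ℝ (fun u : E => ContinuousAlternatingMap.ofSubsingleton ℝ E ℝ (0 : Fin 1)
      (A u)) x :=
    (ContinuousAlternatingMap.ofSubsingletonLIE (𝕜 := ℝ) (E := E) (F := ℝ) (0 : Fin 1)).differentiableAt.comp x hA
  rw [extDeriv_apply h, d1]
  simp only [ContinuousAlternatingMap.ofSubsingleton_apply_apply]
  rw [Fin.sum_univ_two]
  have e0 : ((0 : Fin 2).removeNth ![v, w]) (0 : Fin 1) = w := rfl
  have e1 : ((1 : Fin 2).removeNth ![v, w]) (0 : Fin 1) = v := rfl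
  rw [e0, e1, fderiv_clm_apply hA (by fun_prop), fderiv_clm_apply hA (by fun_prop)]
  simp
  ring

lemma Filter.EventuallyEq.d1_eq {A B : E → E →L[ℝ] ℝ} {x : E} (h : A =ᶠ[𝓝 x] B) (v w : E) :
    d1 A x v w = d1 B x v w := by
  rw [d1, d1, h.fderiv_eq]

/-- The terms with the second derivative of g cancel by symmetry. -/
lemma d1_pullback {A : E' → E' →L[ℝ] ℝ} {g : E → E'} {x : E} (hA : DifferentiableAt ℝ A (g x))
    (hg : ContDiffAt ℝ 2 g x) (v w : E) :
    d1 (fun u => (A (g u)).comp (fderiv ℝ g u)) x v w =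
      d1 A (g x) (fderiv ℝ g x v) (fderiv ℝ g x w) := by
  have hg1 : DifferentiableAt ℝ g x := hg.differentiableAt (by norm_num)
  have hg2 : DifferentiableAt ℝ (fderiv ℝ g) x :=
    (hg.fderiv_right (m := 1) (by norm_num)).differentiableAt (by norm_num)
  have h := (hA.hasFDerivAt.comp x hg1.hasFDerivAt).clm_comp hg2.hasFDerivAt
  have hs := (hg.isSymmSndFDerivAt (by simp)).eq v w
  have hf : fderiv ℝ (fun u => (A (g u)).comp (fderiv ℝ g u)) x = _ := h.fderiv
  rw [d1, d1, hf]
  simp [hs]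

end ExteriorDerivative

/-! ### 1-forms on manifolds in charts: smoothness, pull-back and exterior derivative. -/

section OneForms

variable {E : Type*} [NormedAddCommGroup E] [NormedSpace ℝ E]
  {E' : Type*} [NormedAddCommGroup E'] [NormedSpace ℝ E']
  {E'' : Type*} [NormedAddCommGroup E''] [NormedSpace ℝ E'']
  {M : Type*} [TopologicalSpace M] [ChartedSpace E M]
  {N : Type*} [TopologicalSpace N] [ChartedSpace E' N]
  {K : Type*} [TopologicalSpace K] [ChartedSpace E'' K]

/-- Covectors at equal points have different types. After composition with a map into the model
space they can be compared. -/
lemma OneForm.comp_congr {α : OneForm 𝓘(ℝ, E') N} {y y' : N} (h : y = y') (L : E →L[ℝ] E') :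
    ContinuousLinearMap.comp (α y : E' →L[ℝ] ℝ) L = ContinuousLinearMap.comp (α y' : E' →L[ℝ] ℝ) L := by
  subst h; rfl

lemma OneForm.pullback_congr {α : OneForm 𝓘(ℝ, E') N} {F G : M → N} {x : M}
    (h : F =ᶠ[𝓝 x] G) :
    OneForm.pullback (I := 𝓘(ℝ, E)) F α x = OneForm.pullback (I := 𝓘(ℝ, E)) G α x := by
  unfold OneForm.pullback
  rw [h.mfderiv_eq]
  exact OneForm.comp_congr (E := E) h.self_of_nhds _

lemma OneForm.pullback_comp {α : OneForm 𝓘(ℝ, E'') K} {F : M → N} {G : N → K} {x : M}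
    (hF : MDifferentiableAt 𝓘(ℝ, E) 𝓘(ℝ, E') F x) (hG : MDifferentiableAt 𝓘(ℝ, E') 𝓘(ℝ, E'') G (F x)) :
    OneForm.pullback (I := 𝓘(ℝ, E)) (G ∘ F) α x =
      OneForm.pullback (I := 𝓘(ℝ, E)) F (OneForm.pullback (I := 𝓘(ℝ, E')) G α) x := by
  unfold OneForm.pullback
  rw [mfderiv_comp x hG hF]
  rfl

lemma OneForm.pullback_id (α : OneForm 𝓘(ℝ, E) M) :
    OneForm.pullback (I := 𝓘(ℝ, E)) id α = α := by
  funext x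
  unfold OneForm.pullback
  rw [mfderiv_id]
  rfl

/-- The derivative of a map between manifolds modelled on `E` and `E'`, as a map from `E` to `E'`. -/
def dmap (F : M → N) (x : M) : E →L[ℝ] E' := mfderiv 𝓘(ℝ, E) 𝓘(ℝ, E') F x

variable [IsManifold 𝓘(ℝ, E) ∞ M] [IsManifold 𝓘(ℝ, E') ∞ N]

lemma mdifferentiableAt_extChartAt_symm' {x₀ : M} {u : E}
    (hu : u ∈ (extChartAt 𝓘(ℝ, E) x₀).target) :
    MDifferentiableAt 𝓘(ℝ, E) 𝓘(ℝ, E) (extChartAt 𝓘(ℝ, E) x₀).symm u :=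
  ((contMDiffOn_extChartAt_symm (n := ∞) x₀).contMDiffAt
    (extChartAt_target_mem_nhds' hu)).mdifferentiableAt (by simp)

lemma mdifferentiableAt_extChartAt' {x₀ x : M} (hx : x ∈ (extChartAt 𝓘(ℝ, E) x₀).source) :
    MDifferentiableAt 𝓘(ℝ, E) 𝓘(ℝ, E) (extChartAt 𝓘(ℝ, E) x₀) x :=
  mdifferentiableAt_extChartAt (by simpa using hx)

/-- The expression of a map between manifolds in the charts at given points. -/
def chartMap (F : M → N) (x₀ : M) (y₀ : N) : E → E' :=
  extChartAt 𝓘(ℝ, E') y₀ ∘ F ∘ (extChartAt 𝓘(ℝ, E) x₀).symm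

lemma contDiffAt_chartMap {F : M → N} {x₀ : M} {y₀ : N} {u : E} {n : ℕ∞}
    (hu : u ∈ (extChartAt 𝓘(ℝ, E) x₀).target)
    (hF : ContMDiffAt 𝓘(ℝ, E) 𝓘(ℝ, E') n F ((extChartAt 𝓘(ℝ, E) x₀).symm u))
    (hy : F ((extChartAt 𝓘(ℝ, E) x₀).symm u) ∈ (extChartAt 𝓘(ℝ, E') y₀).source) :
    ContDiffAt ℝ n (chartMap (E := E) (E' := E') F x₀ y₀) u := by
  rw [← contMDiffAt_iff_contDiffAt]
  have h1 : ContMDiffAt 𝓘(ℝ, E) 𝓘(ℝ, E) n (extChartAt 𝓘(ℝ, E) x₀).symm u :=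
    ((contMDiffOn_extChartAt_symm (n := ∞) x₀).contMDiffAt
      (extChartAt_target_mem_nhds' hu)).of_le (by exact_mod_cast le_top)
  have h2 : ContMDiffAt 𝓘(ℝ, E') 𝓘(ℝ, E') n (extChartAt 𝓘(ℝ, E') y₀)
      (F ((extChartAt 𝓘(ℝ, E) x₀).symm u)) :=
    (contMDiffAt_extChartAt' (n := ∞) (by simpa using hy)).of_le (by exact_mod_cast le_top)
  exact h2.comp u (hF.comp u h1)

/-- Both sides are pull-backs of α, along F ∘ chart⁻¹ and along chart⁻¹ ∘ `chartMap`, and these maps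
agree near u. -/
lemma inChart_pullback {F : M → N} {α : OneForm 𝓘(ℝ, E') N} {x₀ : M} {y₀ : N} {u : E}
    (hu : u ∈ (extChartAt 𝓘(ℝ, E) x₀).target)
    (hF : ContMDiffAt 𝓘(ℝ, E) 𝓘(ℝ, E') 1 F ((extChartAt 𝓘(ℝ, E) x₀).symm u))
    (hy : F ((extChartAt 𝓘(ℝ, E) x₀).symm u) ∈ (extChartAt 𝓘(ℝ, E') y₀).source) :
    (OneForm.pullback (I := 𝓘(ℝ, E)) F α).inChart x₀ u =
      (α.inChart y₀ (chartMap F x₀ y₀ u)).comp (fderiv ℝ (chartMap F x₀ y₀) u) := by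
  have hg : ContDiffAt ℝ 1 (chartMap F x₀ y₀) u := contDiffAt_chartMap (n := 1) hu hF hy
  have hc := mdifferentiableAt_extChartAt_symm' hu
  have hF' := hF.mdifferentiableAt one_ne_zero
  have hgu : chartMap F x₀ y₀ u ∈ (extChartAt 𝓘(ℝ, E') y₀).target :=
    (extChartAt 𝓘(ℝ, E') y₀).map_source hy
  have hgm : MDifferentiableAt 𝓘(ℝ, E) 𝓘(ℝ, E') (chartMap F x₀ y₀) u :=
    (hg.differentiableAt one_ne_zero).mdifferentiableAt
  have h1 : (OneForm.pullback (I := 𝓘(ℝ, E)) F α).inChart x₀ u =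
      OneForm.pullback (I := 𝓘(ℝ, E)) (F ∘ (extChartAt 𝓘(ℝ, E) x₀).symm) α u :=
    (OneForm.pullback_comp hc hF').symm
  have h2 : (α.inChart y₀ (chartMap F x₀ y₀ u)).comp (fderiv ℝ (chartMap F x₀ y₀) u) =
      OneForm.pullback (I := 𝓘(ℝ, E)) ((extChartAt 𝓘(ℝ, E') y₀).symm ∘ chartMap F x₀ y₀) α u := by
    rw [OneForm.pullback_comp hgm (mdifferentiableAt_extChartAt_symm' hgu)]
    unfold OneForm.inChart
    conv_rhs => unfold OneForm.pullback
    rw [mfderiv_eq_fderiv]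
    rfl
  rw [h1, h2]
  refine OneForm.pullback_congr ?_
  have hcont : ContinuousAt (F ∘ (extChartAt 𝓘(ℝ, E) x₀).symm) u :=
    ContinuousAt.comp hF.continuousAt hc.continuousAt
  filter_upwards [hcont (extChartAt_source_mem_nhds' hy)] with u' hu'
  exact ((extChartAt 𝓘(ℝ, E') y₀).left_inv hu').symm

omit [IsManifold 𝓘(ℝ, E) ∞ M] in
lemma OneForm.IsSmooth.contDiffAt {α : OneForm 𝓘(ℝ, E) M} (hα : α.IsSmooth) {x₀ : M} {u : E}
    (hu : u ∈ (extChartAt 𝓘(ℝ, E) x₀).target) : ContDiffAt ℝ ∞ (α.inChart x₀) u :=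
  (hα x₀).contDiffAt (extChartAt_target_mem_nhds' hu)

omit [IsManifold 𝓘(ℝ, E) ∞ M] in
lemma OneForm.IsSmooth.differentiableAt {α : OneForm 𝓘(ℝ, E) M} (hα : α.IsSmooth) {x₀ : M} {u : E}
    (hu : u ∈ (extChartAt 𝓘(ℝ, E) x₀).target) : DifferentiableAt ℝ (α.inChart x₀) u :=
  (hα.contDiffAt hu).differentiableAt (by simp)

omit [IsManifold 𝓘(ℝ, E) ∞ M] in
lemma OneForm.d_eq_d1 {α : OneForm 𝓘(ℝ, E) M} (hα : α.IsSmooth) (x : M)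
    (v w : E) : α.d x v w = d1 (α.inChart x) (extChartAt 𝓘(ℝ, E) x x) v w :=
  extDeriv_ofSubsingleton (hα.differentiableAt (mem_extChartAt_target x)) v w

lemma OneForm.IsSmooth.pullback {F : M → N} (hF : ContMDiff 𝓘(ℝ, E) 𝓘(ℝ, E') ∞ F)
    {α : OneForm 𝓘(ℝ, E') N} (hα : α.IsSmooth) :
    (OneForm.pullback (I := 𝓘(ℝ, E)) F α).IsSmooth := by
  intro x₀ u hu
  refine ContDiffAt.contDiffWithinAt ?_
  set y₀ := F ((extChartAt 𝓘(ℝ, E) x₀).symm u)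
  have hy : y₀ ∈ (extChartAt 𝓘(ℝ, E') y₀).source := mem_extChartAt_source _
  have hg : ContDiffAt ℝ ∞ (chartMap F x₀ y₀) u := contDiffAt_chartMap hu hF.contMDiffAt hy
  have hgu : chartMap F x₀ y₀ u ∈ (extChartAt 𝓘(ℝ, E') y₀).target :=
    (extChartAt 𝓘(ℝ, E') y₀).map_source hy
  have h1 : ContDiffAt ℝ ∞ (fun u => (α.inChart y₀ (chartMap F x₀ y₀ u)).comp
      (fderiv ℝ (chartMap F x₀ y₀) u)) u :=
    ((hα.contDiffAt hgu).comp u hg).clm_comp (hg.fderiv_right (m := ∞) (by simp))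
  refine h1.congr_of_eventuallyEq ?_
  have hcont : ContinuousAt (F ∘ (extChartAt 𝓘(ℝ, E) x₀).symm) u :=
    ContinuousAt.comp hF.continuous.continuousAt
      (mdifferentiableAt_extChartAt_symm' hu).continuousAt
  filter_upwards [hcont (extChartAt_source_mem_nhds' hy), extChartAt_target_mem_nhds' hu]
    with u' hu' hu''
  exact inChart_pullback hu'' (hF.contMDiffAt.of_le (by exact_mod_cast le_top)) hu'

omit [IsManifold 𝓘(ℝ, E) ∞ M] [IsManifold 𝓘(ℝ, E') ∞ N] in
lemma dmap_eq_fderiv_chartMap {F : M → N} {x : M}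
    (hF : MDifferentiableAt 𝓘(ℝ, E) 𝓘(ℝ, E') F x) :
    dmap F x = fderiv ℝ (chartMap (E := E) (E' := E') F x (F x)) (extChartAt 𝓘(ℝ, E) x x) := by
  rw [dmap, hF.mfderiv]
  simp only [modelWithCornersSelf_coe, Set.range_id, fderivWithin_univ]
  rfl

/-- Pull-back commutes with the exterior derivative. -/
lemma OneForm.d_pullback {F : M → N} (hF : ContMDiff 𝓘(ℝ, E) 𝓘(ℝ, E') ∞ F)
    {α : OneForm 𝓘(ℝ, E') N} (hα : α.IsSmooth) (x : M) (v w : E) :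
    (OneForm.pullback (I := 𝓘(ℝ, E)) F α).d x v w = α.d (F x) (dmap (E := E) (E' := E') F x v) (dmap (E := E) (E' := E') F x w) := by
  have hu := mem_extChartAt_target (I := 𝓘(ℝ, E)) x
  have hxx : (extChartAt 𝓘(ℝ, E) x).symm (extChartAt 𝓘(ℝ, E) x x) = x := extChartAt_to_inv x
  have hg : ContDiffAt ℝ ∞ (chartMap F x (F x)) (extChartAt 𝓘(ℝ, E) x x) :=
    contDiffAt_chartMap hu hF.contMDiffAt (by rw [hxx]; exact mem_extChartAt_source _)
  have hgx : chartMap F x (F x) (extChartAt 𝓘(ℝ, E) x x) = extChartAt 𝓘(ℝ, E') (F x) (F x) := by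
    simp only [chartMap, Function.comp, hxx]
  rw [OneForm.d_eq_d1 (hα.pullback hF), OneForm.d_eq_d1 hα]
  have hFd := dmap_eq_fderiv_chartMap ((hF.contMDiffAt (x := x)).mdifferentiableAt (by simp))
  have hcont : ContinuousAt (F ∘ (extChartAt 𝓘(ℝ, E) x).symm) (extChartAt 𝓘(ℝ, E) x x) :=
    ContinuousAt.comp hF.continuous.continuousAt
      (mdifferentiableAt_extChartAt_symm' hu).continuousAt
  have heq : (OneForm.pullback (I := 𝓘(ℝ, E)) F α).inChart x =ᶠ[𝓝 (extChartAt 𝓘(ℝ, E) x x)]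
      fun u => (α.inChart (F x) (chartMap F x (F x) u)).comp (fderiv ℝ (chartMap F x (F x)) u) := by
    filter_upwards [hcont (extChartAt_source_mem_nhds' (I := 𝓘(ℝ, E')) (x := F x) (by
      simp only [Function.comp, hxx]; exact mem_extChartAt_source _)),
      extChartAt_target_mem_nhds' hu] with u' hu' hu''
    exact inChart_pullback hu'' (hF.contMDiffAt.of_le (by exact_mod_cast le_top)) hu'
  rw [Filter.EventuallyEq.d1_eq heq, d1_pullback
    (by rw [hgx]; exact hα.differentiableAt (mem_extChartAt_target _))
    (hg.of_le two_le_infty), hgx, ← hFd]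

lemma OneForm.apply_eq_inChart {α : OneForm 𝓘(ℝ, E) M} {x₀ x : M}
    (hx : x ∈ (extChartAt 𝓘(ℝ, E) x₀).source) (v : E) :
    α x v = α.inChart x₀ (extChartAt 𝓘(ℝ, E) x₀ x) (dmap (extChartAt 𝓘(ℝ, E) x₀) x v) := by
  have h1 : α x = OneForm.pullback (I := 𝓘(ℝ, E))
      ((extChartAt 𝓘(ℝ, E) x₀).symm ∘ extChartAt 𝓘(ℝ, E) x₀) α x := by
    conv_lhs => rw [← OneForm.pullback_id α]
    refine OneForm.pullback_congr ?_
    filter_upwards [extChartAt_source_mem_nhds' hx] with y hy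
    exact ((extChartAt 𝓘(ℝ, E) x₀).left_inv hy).symm
  rw [h1, OneForm.pullback_comp (mdifferentiableAt_extChartAt' hx)
    (mdifferentiableAt_extChartAt_symm' ((extChartAt 𝓘(ℝ, E) x₀).map_source hx))]
  rfl

/-- By definition the derivative at x is computed in the preferred chart at x, which changes with x.
Continuity and differentiability arguments need one fixed chart; `d1_pullback` for the change of
charts provides it. -/
lemma OneForm.d_eq_inChart {α : OneForm 𝓘(ℝ, E) M} (hα : α.IsSmooth) {x₀ x : M}
    (hx : x ∈ (extChartAt 𝓘(ℝ, E) x₀).source) (v w : E) :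
    α.d x v w = d1 (α.inChart x₀) (extChartAt 𝓘(ℝ, E) x₀ x)
      (dmap (extChartAt 𝓘(ℝ, E) x₀) x v) (dmap (extChartAt 𝓘(ℝ, E) x₀) x w) := by
  have hu := mem_extChartAt_target (I := 𝓘(ℝ, E)) x
  have hxx : (extChartAt 𝓘(ℝ, E) x).symm (extChartAt 𝓘(ℝ, E) x x) = x := extChartAt_to_inv x
  set g := chartMap (E := E) (E' := E) (id : M → M) x x₀ with hgdef
  have hg : ContDiffAt ℝ ∞ g (extChartAt 𝓘(ℝ, E) x x) :=
    contDiffAt_chartMap hu contMDiff_id.contMDiffAt (by rw [hxx]; exact hx)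
  have hgx : g (extChartAt 𝓘(ℝ, E) x x) = extChartAt 𝓘(ℝ, E) x₀ x := by
    simp only [hgdef, chartMap, Function.comp, hxx, id]
  have hgd : dmap (extChartAt 𝓘(ℝ, E) x₀) x =
      fderiv ℝ g (extChartAt 𝓘(ℝ, E) x x) := by
    rw [dmap_eq_fderiv_chartMap (mdifferentiableAt_extChartAt' hx)]
    rfl
  have heq : α.inChart x =ᶠ[𝓝 (extChartAt 𝓘(ℝ, E) x x)]
      fun u => (α.inChart x₀ (g u)).comp (fderiv ℝ g u) := by
    have hcont : ContinuousAt ((extChartAt 𝓘(ℝ, E) x).symm) (extChartAt 𝓘(ℝ, E) x x) :=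
      (mdifferentiableAt_extChartAt_symm' hu).continuousAt
    filter_upwards [hcont (extChartAt_source_mem_nhds' (x := x₀) (by rw [hxx]; exact hx)),
      extChartAt_target_mem_nhds' hu] with u' hu' hu''
    have := inChart_pullback (α := α) (F := (id : M → M)) hu'' contMDiff_id.contMDiffAt hu'
    rwa [OneForm.pullback_id] at this
  rw [OneForm.d_eq_d1 hα, Filter.EventuallyEq.d1_eq heq, d1_pullback
    (by rw [hgx]; exact hα.differentiableAt ((extChartAt 𝓘(ℝ, E) x₀).map_source hx))
    (hg.of_le two_le_infty), hgx, ← hgd]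

end OneForms

universe u

/-! ### Smoothness of superposition operators on spaces of continuous maps. -/

section Superposition

variable {K : Type*} [TopologicalSpace K] [CompactSpace K]

/-- Pointwise application of a continuous family of linear maps to a continuous family of
vectors. -/
def pointwiseApply (K : Type*) [TopologicalSpace K] [CompactSpace K] (E F : Type*)
    [NormedAddCommGroup E] [NormedSpace ℝ E] [NormedAddCommGroup F] [NormedSpace ℝ F] :
    C(K, E →L[ℝ] F) →L[ℝ] C(K, E) →L[ℝ] C(K, F) :=
  LinearMap.mkContinuous₂
    (LinearMap.mk₂ ℝ (fun (A : C(K, E →L[ℝ] F)) (h : C(K, E)) =>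
        (⟨fun t => A t (h t), by fun_prop⟩ : C(K, F)))
      (fun A B h => by ext; simp) (fun c A h => by ext; simp) (fun A h k => by ext; simp)
      (fun c A h => by ext; simp)) 1 (fun A h => by
        rw [one_mul, ContinuousMap.norm_le _ (by positivity)]
        intro t
        refine ((A t).le_opNorm _).trans ?_
        have h1 := A.norm_coe_le_norm t
        have h2 := h.norm_coe_le_norm t
        gcongr)

/-- The superposition operator `γ ↦ X ∘ γ`. -/
def superposition {E F : Type*} [TopologicalSpace E] [TopologicalSpace F] (X : C(E, F))
    (γ : C(K, E)) : C(K, F) := X.comp γ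

/-- The image of γ is compact, so X' is uniformly continuous along it, and the mean value inequality
bounds the remainder uniformly in t. -/
lemma hasFDerivAt_superposition {E F : Type*}
    [NormedAddCommGroup E] [NormedSpace ℝ E] [NormedAddCommGroup F] [NormedSpace ℝ F]
    {X : C(E, F)} {X' : C(E, E →L[ℝ] F)} (hX : ∀ x, HasFDerivAt X (X' x) x) (γ : C(K, E)) :
    HasFDerivAt (superposition X) (pointwiseApply K E F (superposition X' γ)) γ := by
  rw [hasFDerivAt_iff_isLittleO, Asymptotics.isLittleO_iff]
  intro c hc
  have hcomp : IsCompact (Set.range γ) := isCompact_range γ.continuous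
  have hunif := hcomp.uniformContinuousAt_of_continuousAt X'
    (fun a _ => X'.continuous.continuousAt) (Metric.dist_mem_uniformity hc)
  obtain ⟨δ, hδ, hδ'⟩ := Metric.mem_uniformity_dist.1 hunif
  filter_upwards [Metric.ball_mem_nhds γ hδ] with η hη
  rw [ContinuousMap.norm_le _ (by positivity)]
  intro t
  have hball : η t ∈ Metric.ball (γ t) δ :=
    lt_of_le_of_lt (ContinuousMap.dist_apply_le_dist t) hη
  have hmv := (convex_ball (γ t) δ).norm_image_sub_le_of_norm_hasFDerivWithin_le' (f := X)
    (f' := X') (φ := X' (γ t)) (C := c) (fun x _ => (hX x).hasFDerivWithinAt) (fun x hx => by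
      have := @hδ' (γ t) x (by rw [dist_comm]; exact hx) ⟨t, rfl⟩
      change dist (X' (γ t)) (X' x) < c at this
      rw [dist_comm, dist_eq_norm] at this
      exact this.le) (Metric.mem_ball_self hδ) hball
  refine le_trans ?_ (mul_le_mul_of_nonneg_left ((η - γ).norm_coe_le_norm t) hc.le)
  simpa using! hmv

/-- The derivative is pointwise application of the superposition operator of X', so induction on n
works if the target varies. A single universe lets the space of linear maps from E to F be the next
target. -/
lemma contDiff_superposition (n : ℕ) {E F : Type u}
    [NormedAddCommGroup E] [NormedSpace ℝ E] [NormedAddCommGroup F] [NormedSpace ℝ F]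
    {X : C(E, F)} (hX : ContDiff ℝ n X) :
    ContDiff ℝ n (superposition (K := K) X) := by
  induction n generalizing F with
  | zero => exact contDiff_zero.2 (ContinuousMap.continuous_postcomp X)
  | succ n ih =>
    obtain ⟨X', hX', hd⟩ := contDiff_succ_iff_hasFDerivAt.1 hX
    refine contDiff_succ_iff_hasFDerivAt.2
      ⟨_, ?_, fun γ => hasFDerivAt_superposition (X' := ⟨X', hX'.continuous⟩) hd γ⟩
    exact (pointwiseApply K E F).contDiff.comp (ih (X := ⟨X', hX'.continuous⟩) hX')

end Superposition

/-! ### Smooth dependence of local flows via the implicit function theorem. -/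

section LocalFlow

abbrev UnitI : Type := Set.Icc (0 : ℝ) 1

variable {E : Type*} [NormedAddCommGroup E] [NormedSpace ℝ E] [CompleteSpace E]

/-- The primitive vanishing at `0`, on `C([0, 1], E)`. -/
def primitiveCLM (E : Type*) [NormedAddCommGroup E] [NormedSpace ℝ E] [CompleteSpace E] :
    C(UnitI, E) →L[ℝ] C(UnitI, E) :=
  LinearMap.mkContinuous
    { toFun := fun γ => ⟨fun t => ∫ s in (0 : ℝ)..t, γ (Set.projIcc 0 1 zero_le_one s), by
        have h : Continuous fun s : ℝ => γ (Set.projIcc 0 1 zero_le_one s) :=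
          γ.continuous.comp continuous_projIcc
        exact (intervalIntegral.continuous_primitive (fun a b => h.intervalIntegrable a b) 0).comp
          continuous_subtype_val⟩
      map_add' := fun γ η => by
        ext t
        have h : ∀ γ : C(UnitI, E), Continuous fun s : ℝ => γ (Set.projIcc 0 1 zero_le_one s) :=
          fun γ => γ.continuous.comp continuous_projIcc
        simp [intervalIntegral.integral_add ((h γ).intervalIntegrable _ _)
          ((h η).intervalIntegrable _ _)]
      map_smul' := fun c γ => by ext t; simp } 1 (fun γ => by
    rw [one_mul, ContinuousMap.norm_le _ (norm_nonneg _)]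
    intro t
    refine (intervalIntegral.norm_integral_le_of_norm_le_const (C := ‖γ‖)
      (fun s _ => γ.norm_coe_le_norm _)).trans ?_
    have ht := t.2
    rw [sub_zero, abs_of_nonneg ht.1]
    exact mul_le_of_le_one_right (norm_nonneg _) ht.2)

lemma primitiveCLM_apply (γ : C(UnitI, E)) (t : UnitI) :
    primitiveCLM E γ t = ∫ s in (0 : ℝ)..t, γ (Set.projIcc 0 1 zero_le_one s) := rfl

/-- Smooth dependence on time and initial value of a local flow. -/
lemma contDiffAt_localFlow {n : ℕ} (hn : n ≠ 0) {X : E → E} (hX : ContDiff ℝ n X) {x₀ : E}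
    {α : E × ℝ → E} {r ε : ℝ} (hr : 0 < r) (hε : 0 < ε)
    (h0 : ∀ x ∈ Metric.closedBall x₀ r, α (x, 0) = x)
    (hα : ∀ x ∈ Metric.closedBall x₀ r, ∀ t ∈ Set.Icc (-ε) ε,
      HasDerivWithinAt (fun t => α (x, t)) (X (α (x, t))) (Set.Icc (-ε) ε) t)
    (hc : ContinuousOn α (Metric.closedBall x₀ r ×ˢ Set.Icc (-ε) ε)) :
    ContDiffAt ℝ n α (x₀, 0) := by
  set Xc : C(E, E) := ⟨X, hX.continuous⟩ with hXc
  -- With time rescaled to [0, 1], the curve γ(s) = α(x, sτ) solves the integral equation γ = x + τ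
  -- ∫ X(γ). Solutions are therefore zeros of G, with initial value x and total time τ as
  -- parameters.
  set G : (E × ℝ) × C(UnitI, E) → C(UnitI, E) := fun p =>
    p.2 - ContinuousLinearMap.const ℝ UnitI p.1.1 - p.1.2 • primitiveCLM E (superposition Xc p.2)
    with hG
  have hGd : ContDiff ℝ n G := by
    have h1 : ContDiff ℝ n fun p : (E × ℝ) × C(UnitI, E) =>
        ContinuousLinearMap.const ℝ UnitI p.1.1 :=
      (ContinuousLinearMap.const (M := E) ℝ UnitI).contDiff.comp contDiff_fst.fst
    have h2 : ContDiff ℝ n fun p : (E × ℝ) × C(UnitI, E) =>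
        primitiveCLM E (superposition Xc p.2) :=
      (primitiveCLM E).contDiff.comp ((contDiff_superposition n (X := Xc) hX).comp contDiff_snd)
    exact (contDiff_snd.sub h1).sub (contDiff_fst.snd.smul h2)
  set u : (E × ℝ) × C(UnitI, E) := ((x₀, 0), ContinuousLinearMap.const ℝ UnitI x₀) with hu
  have hn' : (n : WithTop ℕ∞) ≠ 0 := by exact_mod_cast hn
  have hGu : G u = 0 := by simp [hG, hu]
  have hcd : ContDiffAt ℝ n G u := hGd.contDiffAt
  -- At τ = 0 the integral term disappears, so the partial derivative in γ is the identity.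
  have hinr : fderiv ℝ G u ∘L .inr ℝ (E × ℝ) C(UnitI, E) = ContinuousLinearMap.id ℝ _ := by
    have h1 : HasFDerivAt (fun y => G (u.1, y)) (fderiv ℝ G u ∘L .inr ℝ (E × ℝ) C(UnitI, E)) u.2 :=
      HasFDerivAt.comp u.2 (f := fun y => (u.1, y)) (hcd.differentiableAt hn').hasFDerivAt
        (hasFDerivAt_prodMk_right u.1 u.2)
    have h2 : HasFDerivAt (fun y => G (u.1, y)) (ContinuousLinearMap.id ℝ _) u.2 := by
      simp only [hG, hu, zero_smul, sub_zero]
      exact (hasFDerivAt_id _).sub_const _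
    exact h1.unique h2
  have hinv : (fderiv ℝ G u ∘L .inr ℝ (E × ℝ) C(UnitI, E)).IsInvertible := by
    rw [hinr]; exact ⟨ContinuousLinearEquiv.refl ℝ _, rfl⟩
  set ψ := hcd.implicitFunction hn' hinv with hψ
  have hψd : ContDiffAt ℝ n ψ (x₀, 0) := hcd.contDiffAt_implicitFunction hn' hinv
  have hψe := hcd.eventually_apply_eq_iff_implicitFunction hn' hinv
  have hS : ∀ x ∈ Metric.closedBall x₀ r, ∀ τ ∈ Set.Icc (-ε) ε,
      Continuous fun t : UnitI => α (x, t * τ) := by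
    intro x hx τ hτ
    refine hc.comp_continuous (by fun_prop) fun t => ⟨hx, ?_⟩
    have h1 := t.2.1
    have h2 := t.2.2
    constructor <;> nlinarith [hτ.1, hτ.2]
  classical
  set Γ : E × ℝ → C(UnitI, E) := fun p =>
    if h : p.1 ∈ Metric.closedBall x₀ r ∧ p.2 ∈ Set.Icc (-ε) ε then
      ⟨fun t => α (p.1, t * p.2), hS _ h.1 _ h.2⟩ else 0 with hΓ
  have hdom : ∀ᶠ p : E × ℝ in 𝓝 (x₀, 0), p.1 ∈ Metric.closedBall x₀ r ∧ p.2 ∈ Set.Ioo (-ε) ε :=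
    prod_mem_nhds (Metric.closedBall_mem_nhds x₀ hr) (Ioo_mem_nhds (by linarith) hε)
  have hΓapp : ∀ p : E × ℝ, p.1 ∈ Metric.closedBall x₀ r → p.2 ∈ Set.Ioo (-ε) ε →
      ∀ t : UnitI, Γ p t = α (p.1, t * p.2) := by
    intro p h1 h2 t
    simp only [hΓ]
    rw [dif_pos ⟨h1, Set.Ioo_subset_Icc_self h2⟩]
    rfl
  -- The implicit function theorem determines zeros of G only near the base point, so the rescaled
  -- solutions must be close to the constant curve in the supremum norm.
  have hΓt : Filter.Tendsto Γ (𝓝 (x₀, 0)) (𝓝 (ContinuousLinearMap.const ℝ UnitI x₀)) := by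
    have hcα : ContinuousAt α (x₀, 0) :=
      hc.continuousAt (prod_mem_nhds (Metric.closedBall_mem_nhds x₀ hr)
        (Icc_mem_nhds (by linarith) hε))
    rw [Metric.tendsto_nhds]
    intro δ hδ
    have h0x : α (x₀, 0) = x₀ := h0 x₀ (Metric.mem_closedBall_self hr.le)
    have hev := Metric.tendsto_nhds.1 hcα (δ / 2) (by positivity)
    rw [h0x] at hev
    obtain ⟨ρ, hρ, hρ'⟩ := Metric.eventually_nhds_iff.1 hev
    filter_upwards [hdom, Metric.ball_mem_nhds _ hρ] with p hp hpρ
    refine lt_of_le_of_lt ((ContinuousMap.dist_le (by positivity)).2 fun t => ?_)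
      (half_lt_self hδ)
    rw [hΓapp p hp.1 hp.2]
    refine (hρ' (y := (p.1, t * p.2)) ?_).le
    rw [Metric.mem_ball] at hpρ
    refine lt_of_le_of_lt ?_ hpρ
    rw [Prod.dist_eq, Prod.dist_eq]
    refine max_le_max le_rfl ?_
    simp only [dist_zero_right, norm_mul, Real.norm_eq_abs]
    rw [abs_of_nonneg t.2.1]
    exact mul_le_of_le_one_left (abs_nonneg _) t.2.2
  have hΓG : ∀ᶠ p in 𝓝 ((x₀, 0) : E × ℝ), G (p, Γ p) = G u := by
    filter_upwards [hdom] with p hp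
    rw [hGu]
    ext t
    have hint : ∫ s in (0 : ℝ)..t, X (α (p.1, s * p.2)) =
        ∫ s in (0 : ℝ)..t, (superposition Xc (Γ p)) (Set.projIcc 0 1 zero_le_one s) := by
      refine intervalIntegral.integral_congr fun s hs => ?_
      rw [Set.uIcc_of_le t.2.1] at hs
      have hs1 : s ∈ Set.Icc (0 : ℝ) 1 := ⟨hs.1, hs.2.trans t.2.2⟩
      simp only [superposition, ContinuousMap.comp_apply]
      rw [hΓapp p hp.1 hp.2, Set.projIcc_of_mem _ hs1]
      rfl
    have hmem : ∀ s ∈ Set.Icc (0 : ℝ) 1, s * p.2 ∈ Set.Ioo (-ε) ε := by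
      intro s hs
      have h1 := hp.2.1
      have h2 := hp.2.2
      rcases le_total 0 p.2 with h | h
      · exact ⟨by nlinarith [hs.1], by nlinarith [hs.1, hs.2]⟩
      · exact ⟨by nlinarith [hs.1, hs.2], by nlinarith [hs.1, hs.2]⟩
    have hder : ∀ s ∈ Set.uIcc (0 : ℝ) t,
        HasDerivAt (fun s => α (p.1, s * p.2)) (p.2 • X (α (p.1, s * p.2))) s := by
      intro s hs
      rw [Set.uIcc_of_le t.2.1] at hs
      have hm := hmem s ⟨hs.1, hs.2.trans t.2.2⟩
      have h1 := (hα p.1 hp.1 (s * p.2) (Set.Ioo_subset_Icc_self hm)).hasDerivAt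
        (Icc_mem_nhds hm.1 hm.2)
      have h2 : HasDerivAt (fun s : ℝ => s * p.2) p.2 s := by
        simpa using (hasDerivAt_id s).mul_const p.2
      exact h1.scomp s h2
    have hcont : ContinuousOn (fun s => p.2 • X (α (p.1, s * p.2))) (Set.uIcc (0 : ℝ) t) := by
      refine continuousOn_const.smul (hX.continuous.comp_continuousOn ?_)
      exact fun s hs => (hder s hs).continuousAt.continuousWithinAt
    have hftc := intervalIntegral.integral_eq_sub_of_hasDerivAt hder hcont.intervalIntegrable
    rw [intervalIntegral.integral_smul, hint, zero_mul, h0 _ hp.1] at hftc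
    simp only [hG, ContinuousMap.sub_apply, ContinuousMap.smul_apply, primitiveCLM_apply,
      ContinuousMap.zero_apply, hΓapp p hp.1 hp.2, hftc]
    simp
  have hpair : Filter.Tendsto (fun p => (p, Γ p)) (𝓝 ((x₀, 0) : E × ℝ)) (𝓝 u) :=
    Filter.Tendsto.prodMk_nhds Filter.tendsto_id hΓt
  -- The end point s = 1 of the rescaled curve is α(x, τ).
  have hfin : α =ᶠ[𝓝 (x₀, 0)] fun p => ContinuousMap.evalCLM ℝ (1 : UnitI) (ψ p) := by
    filter_upwards [hpair.eventually hψe, hΓG, hdom] with p h1 h2 h3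
    have := h1.1 h2
    rw [hψ, this]
    change α p = Γ p 1
    rw [hΓapp p h3.1 h3.2]
    simp
  exact (((ContinuousMap.evalCLM (M := E) ℝ (1 : UnitI)).contDiff.contDiffAt
    (x := ψ (x₀, 0))).comp (x₀, 0) hψd).congr_of_eventuallyEq hfin

end LocalFlow

/-! ### Local and global flows of vector fields on manifolds. -/

section ManifoldFlow

variable {E : Type*} [NormedAddCommGroup E] [NormedSpace ℝ E]
  {H : Type*} [TopologicalSpace H] {I : ModelWithCorners ℝ E H} [I.Boundaryless]
  {N : Type*} [TopologicalSpace N] [ChartedSpace H N]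

/-- The expression of a vector field in the chart at `x₀`. -/
def chartField (v : (x : N) → TangentSpace I x) (x₀ : N) (y : E) : E :=
  mfderiv I 𝓘(ℝ, E) (extChartAt I x₀) ((extChartAt I x₀).symm y) (v ((extChartAt I x₀).symm y))

variable [IsManifold I ∞ N]

omit [I.Boundaryless] in
lemma isManifold_one : IsManifold I 1 N := IsManifold.of_le (n := ∞) (by exact_mod_cast le_top)

omit [I.Boundaryless] in
lemma trivialization_eq_mfderiv (v : (x : N) → TangentSpace I x) {x₀ x : N}
    (hx : x ∈ (chartAt H x₀).source) :
    haveI : IsManifold I 1 N := isManifold_one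
    (trivializationAt E (TangentSpace I) x₀ ⟨x, v x⟩).2 =
      mfderiv I 𝓘(ℝ, E) (extChartAt I x₀) x (v x) := by
  have : IsManifold I 1 N := isManifold_one
  exact (Bundle.Trivialization.continuousLinearMapAt_apply_of_mem (R := ℝ) _ (by simpa using hx)
    (v x)).symm.trans (DFunLike.congr_fun
      (TangentBundle.continuousLinearMapAt_trivializationAt (I := I) (𝕜 := ℝ) hx) (v x))

/-- Over a chart domain, the trivialization of the tangent bundle is the derivative of the chart. -/
lemma contMDiff_section_iff_chartField (v : (x : N) → TangentSpace I x) :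
    ContMDiff I I.tangent ∞ (fun x => (⟨x, v x⟩ : TangentBundle I N)) ↔
      ∀ x₀, ContDiffOn ℝ ∞ (chartField v x₀) (extChartAt I x₀).target := by
  have : IsManifold I 1 N := isManifold_one
  constructor
  · intro h x₀ y hy
    refine ContDiffAt.contDiffWithinAt ?_
    rw [← contMDiffAt_iff_contDiffAt]
    set x := (extChartAt I x₀).symm y with hx
    have hxs : x ∈ (extChartAt I x₀).source := (extChartAt I x₀).map_target hy
    rw [extChartAt_source] at hxs
    have h1 := ((trivializationAt E (TangentSpace I) x₀).contMDiffAt_section_iff (n := ∞)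
      (IB := I) (s := v) (x₀ := x) (by simpa using hxs)).1 h.contMDiffAt
    have h2 : ContMDiffAt 𝓘(ℝ, E) I ∞ (extChartAt I x₀).symm y :=
      (contMDiffOn_extChartAt_symm (n := ∞) x₀).contMDiffAt (extChartAt_target_mem_nhds' hy)
    refine (h1.comp y h2).congr_of_eventuallyEq ?_
    filter_upwards [extChartAt_target_mem_nhds' hy] with z hz
    have hzs : (extChartAt I x₀).symm z ∈ (chartAt H x₀).source := by
      have := (extChartAt I x₀).map_target hz
      rwa [extChartAt_source] at this
    exact (trivialization_eq_mfderiv v hzs).symm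
  · intro h x₀
    refine ((trivializationAt E (TangentSpace I) x₀).contMDiffAt_section_iff (n := ∞)
      (IB := I) (s := v) (x₀ := x₀) (by simp)).2 ?_
    have h1 : ContMDiffAt 𝓘(ℝ, E) 𝓘(ℝ, E) ∞ (chartField v x₀) (extChartAt I x₀ x₀) :=
      ((h x₀).contDiffAt (extChartAt_target_mem_nhds x₀)).contMDiffAt
    refine (h1.comp x₀ (contMDiffAt_extChartAt (n := ∞))).congr_of_eventuallyEq ?_
    filter_upwards [(chartAt H x₀).open_source.mem_nhds (mem_chart_source H x₀)] with z hz
    rw [trivialization_eq_mfderiv v hz]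
    simp only [Function.comp, chartField]
    rw [(extChartAt I x₀).left_inv (by simpa using hz)]

/-- A solution of the chart expression of a differential equation gives an integral curve. -/
lemma hasMFDerivAt_of_chartField {v : (x : N) → TangentSpace I x} {x₀ : N} {f : ℝ → E} {t : ℝ}
    (hf : HasDerivAt f (chartField v x₀ (f t)) t) (ht : f t ∈ (extChartAt I x₀).target) :
    HasMFDerivAt 𝓘(ℝ, ℝ) I ((extChartAt I x₀).symm ∘ f) t
      ((1 : ℝ →L[ℝ] ℝ).smulRight (v ((extChartAt I x₀).symm (f t)))) := by
  have : IsManifold I 1 N := isManifold_one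
  have h2 : MDifferentiableAt 𝓘(ℝ, E) I (extChartAt I x₀).symm (f t) :=
    ((contMDiffOn_extChartAt_symm (n := ∞) x₀).contMDiffAt
      (extChartAt_target_mem_nhds' ht)).mdifferentiableAt (by simp)
  have h3 := h2.hasMFDerivAt.comp t hf.hasFDerivAt.hasMFDerivAt
  have hinv := mfderivWithin_extChartAt_symm_comp_mfderiv_extChartAt (I := I) ht
  rw [I.range_eq_univ, mfderivWithin_univ] at hinv
  refine h3.congr_mfderiv ?_
  ext
  have := DFunLike.congr_fun hinv (v ((extChartAt I x₀).symm (f t)))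
  change mfderiv 𝓘(ℝ, E) I (extChartAt I x₀).symm (f t) ((1 : ℝ) • chartField v x₀ (f t)) =
    (1 : ℝ) • v ((extChartAt I x₀).symm (f t))
  rw [one_smul, one_smul]
  exact this

/-- A smooth vector field has a local flow, smooth at time `0`. -/
lemma exists_localFlow [FiniteDimensional ℝ E] {v : (x : N) → TangentSpace I x}
    (hv : ContMDiff I I.tangent ∞ (fun x => (⟨x, v x⟩ : TangentBundle I N))) (x₀ : N) :
    ∃ ε > (0 : ℝ), ∃ U ∈ 𝓝 x₀, ∃ φ : N → ℝ → N,
      (∀ x ∈ U, φ x 0 = x ∧ IsMIntegralCurveOn (I := I) (φ x) v (Set.Ioo (-ε) ε)) ∧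
      ∀ n : ℕ, n ≠ 0 → ContMDiffAt (I.prod 𝓘(ℝ, ℝ)) I n (Function.uncurry φ) (x₀, 0) := by
  have : CompleteSpace E := FiniteDimensional.complete ℝ E
  set c := extChartAt I x₀ with hc
  have hX := (contMDiff_section_iff_chartField v).1 hv x₀
  obtain ⟨ρ, hρ, hρt⟩ := Metric.isOpen_iff.1 (isOpen_extChartAt_target (I := I) x₀) (c x₀)
    (mem_extChartAt_target x₀)
  -- A cut-off extends the chart expression to a smooth field on the whole model space, as
  -- `contDiffAt_localFlow` requires. It equals 1 on the ball of radius ρ/4.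
  let b : ContDiffBump (c x₀) := ⟨ρ / 4, ρ / 2, by positivity, by linarith⟩
  set X : E → E := fun y => b y • chartField v x₀ y with hXdef
  have hXs : ContDiff ℝ ∞ X := by
    rw [contDiff_iff_contDiffAt]
    intro y
    by_cases hy : y ∈ c.target
    · exact b.contDiff.contDiffAt.smul (hX.contDiffAt (extChartAt_target_mem_nhds' hy))
    · have hyt : y ∉ tsupport b := by
        rw [b.tsupport_eq]
        intro h
        exact hy (hρt (Metric.closedBall_subset_ball (show ρ / 2 < ρ by linarith) h))
      have : X =ᶠ[𝓝 y] fun _ => 0 := by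
        filter_upwards [(isClosed_tsupport b).isOpen_compl.mem_nhds hyt] with z hz
        simp [hXdef, image_eq_zero_of_notMem_tsupport hz]
      exact contDiffAt_const.congr_of_eventuallyEq this
  obtain ⟨ε₀, hε₀, a, r, L, K, hr, hpl⟩ := IsPicardLindelof.of_contDiffAt_one
    ((hXs.contDiffAt (x := c x₀)).of_le (by exact_mod_cast le_top))
  obtain ⟨α, hα, hαc⟩ := (hpl 0).exists_forall_mem_closedBall_eq_hasDerivWithinAt_continuousOn
  simp only [zero_sub, zero_add] at hα hαc
  have hsm : ∀ n : ℕ, n ≠ 0 → ContDiffAt ℝ n α (c x₀, 0) := fun n hn =>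
    contDiffAt_localFlow hn (hXs.of_le (by exact_mod_cast le_top)) hr hε₀
      (fun x hx => (hα x hx).1) (fun x hx => (hα x hx).2) hαc
  have hα0 : α (c x₀, 0) = c x₀ := (hα _ (Metric.mem_closedBall_self r.2)).1
  -- For short times near x₀ the solutions stay where the cut-off is 1, so they solve the original
  -- equation.
  have hev : ∀ᶠ p in 𝓝 (c x₀, (0 : ℝ)), α p ∈ Metric.ball (c x₀) (ρ / 4) := by
    have := (hsm 1 one_ne_zero).continuousAt
    refine this.eventually_mem ?_
    rw [hα0]
    exact Metric.ball_mem_nhds _ (by positivity)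
  rw [nhds_prod_eq] at hev
  obtain ⟨P, hP, Q, hQ, hPQ⟩ := Filter.eventually_prod_iff.1 hev
  obtain ⟨ε₁, hε₁, hQε⟩ := Metric.eventually_nhds_iff.1 hQ
  set ε := min ε₀ ε₁ with hε
  have hεpos : 0 < ε := lt_min hε₀ hε₁
  refine ⟨ε, hεpos, c.source ∩ c ⁻¹' {y | P y ∧ y ∈ Metric.closedBall (c x₀) r}, ?_,
    fun x t => c.symm (α (c x, t)), ?_, ?_⟩
  · refine Filter.inter_mem (extChartAt_source_mem_nhds x₀) ?_
    exact (continuousAt_extChartAt x₀).preimage_mem_nhds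
      (hP.and (Metric.closedBall_mem_nhds _ hr))
  · rintro x ⟨hxs, hxP, hxr⟩
    refine ⟨?_, ?_⟩
    · change c.symm (α (c x, 0)) = x
      rw [(hα _ hxr).1, c.left_inv hxs]
    · intro t ht
      have ht0 : t ∈ Set.Ioo (-ε₀) ε₀ := ⟨by linarith [ht.1, min_le_left ε₀ ε₁],
        lt_of_lt_of_le ht.2 (min_le_left _ _)⟩
      have ht1 : Q t := hQε (by
        rw [Real.dist_eq, sub_zero, abs_lt]
        exact ⟨by linarith [ht.1, min_le_right ε₀ ε₁], lt_of_lt_of_le ht.2 (min_le_right _ _)⟩)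
      have hball := hPQ hxP ht1
      have hd := ((hα _ hxr).2 t (Set.Ioo_subset_Icc_self ht0)).hasDerivAt
        (Icc_mem_nhds ht0.1 ht0.2)
      have hXeq : X (α (c x, t)) = chartField v x₀ (α (c x, t)) := by
        rw [hXdef]
        simp only
        rw [b.one_of_mem_closedBall (Metric.ball_subset_closedBall hball), one_smul]
      rw [hXeq] at hd
      exact (hasMFDerivAt_of_chartField (I := I) (f := fun t => α (c x, t)) hd
        (hρt (Metric.ball_subset_ball (by linarith) hball))).hasMFDerivWithinAt
  · intro n hn
    have h1 : ContMDiffAt (I.prod 𝓘(ℝ, ℝ)) (𝓘(ℝ, E).prod 𝓘(ℝ, ℝ)) n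
        (fun p : N × ℝ => (c p.1, p.2)) (x₀, 0) :=
      ContMDiffAt.prodMk (((contMDiffAt_extChartAt (n := ∞)).of_le
        (by exact_mod_cast le_top)).comp (x₀, (0 : ℝ)) contMDiffAt_fst) contMDiffAt_snd
    have h2 : ContMDiffAt (𝓘(ℝ, E).prod 𝓘(ℝ, ℝ)) 𝓘(ℝ, E) n α (c x₀, 0) := by
      rw [← modelWithCornersSelf_prod, chartedSpaceSelf_prod]
      exact (hsm n hn).contMDiffAt
    have h3 : ContMDiffAt 𝓘(ℝ, E) I n c.symm (α (c x₀, 0)) := by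
      rw [hα0]
      exact ((contMDiffOn_extChartAt_symm (n := ∞) x₀).contMDiffAt
        (extChartAt_target_mem_nhds x₀)).of_le (by exact_mod_cast le_top)
    exact h3.comp (x₀, (0 : ℝ)) (h2.comp (x₀, (0 : ℝ)) h1)

/-- A smooth vector field that has a smooth flow for a uniform time outside a compact set has a
global smooth flow. -/
theorem exists_flow_of_isCompact [FiniteDimensional ℝ E] [T2Space N]
    {v : (x : N) → TangentSpace I x}
    (hv : ContMDiff I I.tangent ∞ (fun x => (⟨x, v x⟩ : TangentBundle I N)))
    {K : Set N} (hK : IsCompact K) {ψ : N → ℝ → N} {r : ℝ} (hr : 0 < r)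
    (hψ0 : ∀ x ∉ K, ψ x 0 = x)
    (hψ : ∀ x ∉ K, IsMIntegralCurveOn (I := I) (ψ x) v (Set.Ioo (-r) r))
    (hψs : ContMDiff (I.prod 𝓘(ℝ, ℝ)) I ∞ (Function.uncurry ψ)) :
    ∃ Θ : N → ℝ → N, (∀ x, Θ x 0 = x) ∧ (∀ x, IsMIntegralCurve (I := I) (Θ x) v) ∧
      ContMDiff (I.prod 𝓘(ℝ, ℝ)) I ∞ (Function.uncurry Θ) ∧
      ∀ x s t, Θ x (s + t) = Θ (Θ x s) t := by
  have : CompleteSpace E := FiniteDimensional.complete ℝ E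
  have : IsManifold I 1 N := isManifold_one
  have hv1 : ContMDiff I I.tangent 1 (fun x => (⟨x, v x⟩ : TangentBundle I N)) :=
    hv.of_le (by exact_mod_cast le_top)
  choose ε hε U hU φ hφ hφs using exists_localFlow hv
  -- a uniform existence time
  obtain ⟨δ, hδ, hδK⟩ : ∃ δ > (0 : ℝ), ∀ x ∈ K, ∃ γ : ℝ → N, γ 0 = x ∧
      IsMIntegralCurveOn (I := I) γ v (Set.Ioo (-δ) δ) := by
    refine hK.induction_on (p := fun S => ∃ δ > (0 : ℝ), ∀ x ∈ S, ∃ γ : ℝ → N, γ 0 = x ∧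
      IsMIntegralCurveOn (I := I) γ v (Set.Ioo (-δ) δ)) ⟨1, one_pos, by simp⟩ ?_ ?_ ?_
    · rintro S T hST ⟨δ, hδ, h⟩
      exact ⟨δ, hδ, fun x hx => h x (hST hx)⟩
    · rintro S T ⟨δ, hδ, h⟩ ⟨δ', hδ', h'⟩
      refine ⟨min δ δ', lt_min hδ hδ', ?_⟩
      rintro x (hx | hx)
      · obtain ⟨γ, h0, hγ⟩ := h x hx
        exact ⟨γ, h0, hγ.mono (Set.Ioo_subset_Ioo (neg_le_neg (min_le_left _ _)) (min_le_left _ _))⟩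
      · obtain ⟨γ, h0, hγ⟩ := h' x hx
        exact ⟨γ, h0, hγ.mono
          (Set.Ioo_subset_Ioo (neg_le_neg (min_le_right _ _)) (min_le_right _ _))⟩
    · intro x _
      exact ⟨U x, mem_nhdsWithin_of_mem_nhds (hU x), ε x, hε x, fun y hy => ⟨φ x y, hφ x y hy⟩⟩
  have hglob : ∀ x, ∃ γ : ℝ → N, γ 0 = x ∧ IsMIntegralCurve (I := I) γ v := by
    refine exists_isMIntegralCurve_of_isMIntegralCurveOn hv1 (lt_min hδ hr) fun x => ?_
    by_cases hx : x ∈ K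
    · obtain ⟨γ, h0, hγ⟩ := hδK x hx
      exact ⟨γ, h0, hγ.mono (Set.Ioo_subset_Ioo (neg_le_neg (min_le_left _ _)) (min_le_left _ _))⟩
    · exact ⟨ψ x, hψ0 x hx, (hψ x hx).mono
        (Set.Ioo_subset_Ioo (neg_le_neg (min_le_right _ _)) (min_le_right _ _))⟩
  choose Θ hΘ0 hΘ using hglob
  have huniq : ∀ (γ γ' : ℝ → N) , IsMIntegralCurve (I := I) γ v →
      IsMIntegralCurve (I := I) γ' v → ∀ t, γ t = γ' t → γ = γ' := fun γ γ' h h' t ht =>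
    isMIntegralCurve_Ioo_eq_of_contMDiff_boundaryless (t₀ := t) hv1 h h' ht
  have hgroup : ∀ x s t, Θ x (s + t) = Θ (Θ x s) t := by
    intro x s t
    have := huniq (Θ x ∘ (· + s)) (Θ (Θ x s)) ((hΘ x).comp_add s) (hΘ _) 0 (by simp [hΘ0])
    have := congrFun this t
    simpa [add_comm] using this
  refine ⟨Θ, hΘ0, hΘ, ?_, hgroup⟩
  rw [contMDiff_infty]
  intro n
  have hn1 : ∀ n : ℕ, n ≠ 0 → ContMDiff (I.prod 𝓘(ℝ, ℝ)) I n (Function.uncurry Θ) := by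
    clear n
    intro n hn
    -- For finite n the set where Θ is C^n is open. It contains time 0 by the local flows, and the
    -- rest of the argument spreads it to all times.
    set S : Set (N × ℝ) := {p | ContMDiffAt (I.prod 𝓘(ℝ, ℝ)) I n (Function.uncurry Θ) p} with hS
    have : IsManifold I n N := IsManifold.of_le (n := ∞) (by exact_mod_cast le_top)
    have hSopen : IsOpen S := by
      rw [isOpen_iff_mem_nhds]
      intro p hp
      exact (contMDiffAt_iff_contMDiffAt_nhds (by simp)).1 hp
    have h0 : ∀ x, (x, (0 : ℝ)) ∈ S := by
      intro x
      refine (hφs x n hn).congr_of_eventuallyEq ?_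
      have hmem : U x ×ˢ Set.Ioo (-ε x) (ε x) ∈ 𝓝 (x, (0 : ℝ)) :=
        prod_mem_nhds (hU x) (Ioo_mem_nhds (by linarith [hε x]) (hε x))
      filter_upwards [hmem] with p hp
      have h1 := (hφ x p.1 hp.1)
      exact isMIntegralCurveOn_Ioo_eqOn_of_contMDiff_boundaryless (t₀ := 0)
        ⟨by linarith [hε x], hε x⟩ hv1 ((hΘ p.1).isMIntegralCurveOn _) h1.2
        (by rw [hΘ0, h1.1]) hp.2
    have hout : ∀ x ∉ K, ∀ t, |t| < r → (x, t) ∈ S := by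
      intro x hx t ht
      have : Function.uncurry Θ =ᶠ[𝓝 (x, t)] Function.uncurry ψ := by
        have hmem : Kᶜ ×ˢ Set.Ioo (-r) r ∈ 𝓝 (x, t) :=
          prod_mem_nhds (hK.isClosed.isOpen_compl.mem_nhds hx)
            (Ioo_mem_nhds (abs_lt.1 ht).1 (abs_lt.1 ht).2)
        filter_upwards [hmem] with p hp
        exact isMIntegralCurveOn_Ioo_eqOn_of_contMDiff_boundaryless (t₀ := 0)
          ⟨by linarith, hr⟩ hv1 ((hΘ p.1).isMIntegralCurveOn _) (hψ p.1 hp.1)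
          (by rw [hΘ0, hψ0 p.1 hp.1]) hp.2
      exact (hψs.contMDiffAt.of_le (by exact_mod_cast le_top)).congr_of_eventuallyEq this
    -- The tube lemma gives a uniform time over K. Outside K, Θ agrees with the smooth flow ψ for
    -- times below r.
    obtain ⟨δ, hδ, hδS⟩ : ∃ δ > (0 : ℝ), ∀ x, ∀ t, |t| < δ → (x, t) ∈ S := by
      obtain ⟨A, B, hA, hB, hKA, h0B, hAB⟩ := generalized_tube_lemma hK
        (isCompact_singleton (x := (0 : ℝ))) hSopen (by
          rintro ⟨x, t⟩ ⟨-, ht⟩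
          rw [Set.mem_singleton_iff] at ht
          subst ht
          exact h0 x)
      obtain ⟨δ, hδ, hδB⟩ := Metric.isOpen_iff.1 hB 0 (h0B rfl)
      refine ⟨min δ r, lt_min hδ hr, fun x t ht => ?_⟩
      by_cases hx : x ∈ K
      · exact hAB ⟨hKA hx, hδB (by simpa [Real.dist_eq] using ht.trans_le (min_le_left _ _))⟩
      · exact hout x hx t (ht.trans_le (min_le_right _ _))
    -- The identity Θ(x, t) = Θ(Θ(x, t/2), t/2) doubles the time interval on which smoothness is
    -- known.
    have hdouble : ∀ k : ℕ, ∀ x, ∀ t, |t| < 2 ^ k * δ → (x, t) ∈ S := by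
      intro k
      induction k with
      | zero => simpa using hδS
      | succ k ih =>
        intro x t ht
        have ht2 : |t / 2| < 2 ^ k * δ := by
          rw [abs_div, abs_two, div_lt_iff₀ two_pos]
          rw [pow_succ] at ht
          linarith
        have h1 : ContMDiffAt (I.prod 𝓘(ℝ, ℝ)) (I.prod 𝓘(ℝ, ℝ)) n
            (fun p : N × ℝ => (p.1, p.2 / 2)) (x, t) := by
          refine contMDiffAt_fst.prodMk ?_
          have : ContMDiff 𝓘(ℝ, ℝ) 𝓘(ℝ, ℝ) n (fun s : ℝ => s / 2) := by
            rw [contMDiff_iff_contDiff]; fun_prop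
          exact this.contMDiffAt.comp (x, t) contMDiffAt_snd
        have h2 : ContMDiffAt (I.prod 𝓘(ℝ, ℝ)) I n
            (fun p : N × ℝ => Function.uncurry Θ (p.1, p.2 / 2)) (x, t) :=
          ContMDiffAt.comp (x, t) (g := Function.uncurry Θ) (ih x _ ht2) h1
        have h3 : ContMDiffAt (I.prod 𝓘(ℝ, ℝ)) (I.prod 𝓘(ℝ, ℝ)) n
            (fun p : N × ℝ => (Function.uncurry Θ (p.1, p.2 / 2), p.2 / 2)) (x, t) :=
          h2.prodMk (contMDiffAt_snd.comp (x, t) h1)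
        have h5 : ContMDiffAt (I.prod 𝓘(ℝ, ℝ)) I n (Function.uncurry Θ)
            ((fun p : N × ℝ => (Function.uncurry Θ (p.1, p.2 / 2), p.2 / 2)) (x, t)) :=
          ih (Function.uncurry Θ (x, t / 2)) (t / 2) ht2
        have h4 := h5.comp (x, t) h3
        refine h4.congr_of_eventuallyEq (Filter.Eventually.of_forall fun p => ?_)
        simp only [Function.comp, Function.uncurry]
        rw [← hgroup, add_halves]
    intro p
    obtain ⟨k, hk⟩ := pow_unbounded_of_one_lt (|p.2| / δ) (one_lt_two)
    rw [div_lt_iff₀ hδ] at hk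
    exact hdouble k p.1 p.2 hk
  -- The implicit function theorem needs n ≠ 0; the case n = 0 follows from n = 1.
  rcases Nat.eq_zero_or_pos n with rfl | hn
  · exact (hn1 1 one_ne_zero).of_le (by simp)
  · exact hn1 n hn.ne'

end ManifoldFlow

/-- A basis of E identifies the linear maps from E to F with a finite power of F. -/
lemma contDiffAt_clm_of_apply {D E F : Type*} [NormedAddCommGroup D] [NormedSpace ℝ D]
    [NormedAddCommGroup E] [NormedSpace ℝ E] [NormedAddCommGroup F] [NormedSpace ℝ F]
    [FiniteDimensional ℝ E] {n : WithTop ℕ∞} {f : D → E →L[ℝ] F} {x : D}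
    (h : ∀ y, ContDiffAt ℝ n (fun x => f x y) x) : ContDiffAt ℝ n f x := by
  let e₁ := ContinuousLinearEquiv.ofFinrankEq
    (Module.finrank_fin_fun ℝ (n := Module.finrank ℝ E)).symm
  let e₂ := (e₁.arrowCongr (1 : F ≃L[ℝ] F)).trans
    (ContinuousLinearEquiv.piRing (Fin (Module.finrank ℝ E)))
  rw [← Function.id_comp f, ← e₂.symm_comp_self]
  exact e₂.symm.contDiff.contDiffAt.comp x (contDiffAt_pi.mpr fun i => h _)

/-! ### Gray's equation as a linear system. -/

section GrayAlgebra

/-- The bilinear form `b` is nondegenerate on the kernel of the nonzero linear form `a`. -/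
def Nondegenerate {V : Type*} [AddCommGroup V] (a : V → ℝ) (b : V → V → ℝ) : Prop :=
  (∃ w, a w ≠ 0) ∧ ∀ v, a v = 0 → (∀ w, a w = 0 → b v w = 0) → v = 0

variable {E : Type*} [NormedAddCommGroup E] [NormedSpace ℝ E]

/-- The exterior derivative in the space directions of a time-dependent 1-form. -/
def spaceD (a : ℝ × E → E →L[ℝ] ℝ) (q : ℝ × E) : E →L[ℝ] E →L[ℝ] ℝ :=
  (fderiv ℝ a q).comp (ContinuousLinearMap.inr ℝ ℝ E) -
    ((fderiv ℝ a q).comp (ContinuousLinearMap.inr ℝ ℝ E)).flip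

lemma spaceD_apply (a : ℝ × E → E →L[ℝ] ℝ) (q : ℝ × E) (v w : E) :
    spaceD a q v w = fderiv ℝ a q (0, v) w - fderiv ℝ a q (0, w) v := by
  simp [spaceD]

lemma d1_eq_spaceD {a : ℝ × E → E →L[ℝ] ℝ} {s : ℝ} {u : E} (ha : DifferentiableAt ℝ a (s, u))
    (v w : E) : d1 (fun u => a (s, u)) u v w = spaceD a (s, u) v w := by
  have h : HasFDerivAt (fun u => a (s, u))
      ((fderiv ℝ a (s, u)).comp (ContinuousLinearMap.inr ℝ ℝ E)) u :=
    ha.hasFDerivAt.comp u (hasFDerivAt_prodMk_right s u)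
  rw [d1, h.fderiv, spaceD_apply]
  simp

/-- The linear operator `(X, μ) ↦ (ι_X da - μ a, a X)`. -/
def grayOperator (a : ℝ × E → E →L[ℝ] ℝ) (q : ℝ × E) : E × ℝ →L[ℝ] (E →L[ℝ] ℝ) × ℝ :=
  ((spaceD a q).comp (ContinuousLinearMap.fst ℝ E ℝ) -
    (ContinuousLinearMap.snd ℝ E ℝ).smulRight (a q)).prod
      ((a q).comp (ContinuousLinearMap.fst ℝ E ℝ))

lemma grayOperator_apply (a : ℝ × E → E →L[ℝ] ℝ) (q : ℝ × E) (p : E × ℝ) :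
    grayOperator a q p = (spaceD a q p.1 - p.2 • a q, a q p.1) := by
  simp [grayOperator]

/-- The solution `(X, μ)` of Gray's equation `ι_X da + ∂a/∂s = μ a`, `a X = 0`. -/
def graySolution (a : ℝ × E → E →L[ℝ] ℝ) (q : ℝ × E) : E × ℝ :=
  (grayOperator a q).inverse (-(fderiv ℝ a q (1, 0)), 0)

variable [FiniteDimensional ℝ E]

/-- If a(X) = 0 and ι_X da = μ a, then da(X, ·) vanishes on ker a, so X = 0 by nondegeneracy; then μ
a = 0 and μ = 0 since a ≠ 0. Source and target have equal dimension. -/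
lemma exists_equiv_grayOperator {a : ℝ × E → E →L[ℝ] ℝ} {q : ℝ × E}
    (h : Nondegenerate (a q) (fun v w => spaceD a q v w)) :
    ∃ e : (E × ℝ) ≃L[ℝ] (E →L[ℝ] ℝ) × ℝ, (e : E × ℝ →L[ℝ] (E →L[ℝ] ℝ) × ℝ) = grayOperator a q := by
  have hinj : Function.Injective (grayOperator a q).toLinearMap := by
    rw [← LinearMap.ker_eq_bot, LinearMap.ker_eq_bot']
    rintro ⟨X, μ⟩ hX
    have hX' : grayOperator a q (X, μ) = 0 := hX
    rw [grayOperator_apply, Prod.mk_eq_zero] at hX'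
    obtain ⟨h1, h2⟩ := hX'
    have h3 : ∀ w, spaceD a q X w = μ * a q w := fun w => by
      have := DFunLike.congr_fun h1 w
      simp at this
      linarith
    have hX0 : X = 0 := h.2 X h2 fun w hw => (h3 w).trans (by rw [hw, mul_zero])
    obtain ⟨w, hw⟩ := h.1
    have := h3 w
    rw [hX0] at this
    simp only [map_zero, _root_.zero_apply, zero_eq_mul] at this
    rw [hX0, this.resolve_right hw]
    rfl
  have hdim : Module.finrank ℝ (E × ℝ) = Module.finrank ℝ ((E →L[ℝ] ℝ) × ℝ) := by
    have : Module.finrank ℝ (E →L[ℝ] ℝ) = Module.finrank ℝ E := by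
      rw [← (LinearMap.toContinuousLinearMap (𝕜 := ℝ) (E := E) (F' := ℝ)).finrank_eq]
      exact Subspace.dual_finrank_eq
    rw [Module.finrank_prod, Module.finrank_prod, this]
  refine ⟨(LinearEquiv.ofInjectiveOfFinrankEq (grayOperator a q).toLinearMap hinj
    hdim).toContinuousLinearEquiv, ?_⟩
  ext1
  · ext <;> rfl
  · ext <;> rfl

lemma grayOperator_graySolution {a : ℝ × E → E →L[ℝ] ℝ} {q : ℝ × E}
    (h : Nondegenerate (a q) (fun v w => spaceD a q v w)) :
    grayOperator a q (graySolution a q) = (-(fderiv ℝ a q (1, 0)), 0) := by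
  obtain ⟨e, he⟩ := exists_equiv_grayOperator h
  rw [graySolution, ← he, ContinuousLinearMap.inverse_equiv]
  simp

lemma graySolution_spec {a : ℝ × E → E →L[ℝ] ℝ} {q : ℝ × E}
    (h : Nondegenerate (a q) (fun v w => spaceD a q v w)) :
    a q (graySolution a q).1 = 0 ∧ ∀ w, spaceD a q (graySolution a q).1 w =
      -(fderiv ℝ a q (1, 0) w) + (graySolution a q).2 * a q w := by
  have h1 := grayOperator_graySolution h
  rw [grayOperator_apply, Prod.mk.injEq] at h1
  refine ⟨h1.2, fun w => ?_⟩
  have := DFunLike.congr_fun h1.1 w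
  simp only [_root_.sub_apply, _root_.smul_apply, smul_eq_mul,
    _root_.neg_apply] at this
  linarith

lemma graySolution_unique {a : ℝ × E → E →L[ℝ] ℝ} {q : ℝ × E}
    (h : Nondegenerate (a q) (fun v w => spaceD a q v w)) {X : E} {μ : ℝ} (h1 : a q X = 0)
    (h2 : ∀ w, spaceD a q X w = -(fderiv ℝ a q (1, 0) w) + μ * a q w) :
    graySolution a q = (X, μ) := by
  obtain ⟨e, he⟩ := exists_equiv_grayOperator h
  have h3 : grayOperator a q (X, μ) = (-(fderiv ℝ a q (1, 0)), 0) := by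
    rw [grayOperator_apply, Prod.mk.injEq]
    refine ⟨?_, h1⟩
    ext w
    simp [h2]
  have h4 := grayOperator_graySolution h
  rw [← h3, ← he] at h4
  exact e.injective h4

/-- Inversion is smooth at invertible operators, and the coefficients involve only a and its first
derivatives. -/
lemma contDiffAt_graySolution {a : ℝ × E → E →L[ℝ] ℝ} {q : ℝ × E} (ha : ContDiffAt ℝ ∞ a q)
    (h : Nondegenerate (a q) (fun v w => spaceD a q v w)) :
    ContDiffAt ℝ ∞ (graySolution a) q := by
  have : CompleteSpace E := FiniteDimensional.complete ℝ E
  obtain ⟨e, he⟩ := exists_equiv_grayOperator h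
  have hd : ContDiffAt ℝ ∞ (fderiv ℝ a) q := ha.fderiv_right (by simp)
  have hop : ContDiffAt ℝ ∞ (grayOperator a) q := by
    refine contDiffAt_clm_of_apply fun p => ?_
    simp only [grayOperator_apply]
    refine ContDiffAt.prodMk (ContDiffAt.sub ?_ (ha.const_smul p.2))
      (ha.clm_apply contDiffAt_const)
    refine contDiffAt_clm_of_apply fun w => ?_
    simp only [spaceD_apply]
    exact ((hd.clm_apply contDiffAt_const).clm_apply contDiffAt_const).sub
      ((hd.clm_apply contDiffAt_const).clm_apply contDiffAt_const)
  have hinv : ContDiffAt ℝ ∞ (fun q => (grayOperator a q).inverse) q :=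
    ContDiffAt.comp q (g := ContinuousLinearMap.inverse) (by rw [← he]; exact contDiffAt_map_inverse e) hop
  exact hinv.clm_apply (((hd.clm_apply contDiffAt_const).neg).prodMk contDiffAt_const)

end GrayAlgebra

/-! ### Cartan's formula along an isotopy. -/

section GrayDerivative

variable {E : Type*} [NormedAddCommGroup E] [NormedSpace ℝ E]

/-- The derivative of the pull-back of a time-dependent 1-form along a flow whose velocity is in
the kernel of the form. -/
lemma hasDerivAt_pullback_of_isotopy {a : ℝ × E → E →L[ℝ] ℝ} {w : ℝ × E → E} {t₀ : ℝ} {u₀ : E}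
    (hw : ContDiffAt ℝ 2 w (t₀, u₀)) (ha : DifferentiableAt ℝ a (t₀, w (t₀, u₀)))
    (h0 : ∀ᶠ q in 𝓝 (t₀, u₀), a (q.1, w q) (fderiv ℝ w q (1, 0)) = 0) (v : E) :
    HasDerivAt (fun t => a (t, w (t, u₀)) (fderiv ℝ w (t, u₀) (0, v)))
      (fderiv ℝ a (t₀, w (t₀, u₀)) (1, 0) (fderiv ℝ w (t₀, u₀) (0, v)) +
        spaceD a (t₀, w (t₀, u₀)) (fderiv ℝ w (t₀, u₀) (1, 0)) (fderiv ℝ w (t₀, u₀) (0, v)))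
      t₀ := by
  set q₀ := (t₀, u₀) with hq₀
  set A := fderiv ℝ a (t₀, w q₀)
  have hwd : HasFDerivAt w (fderiv ℝ w q₀) q₀ := (hw.differentiableAt (by simp)).hasFDerivAt
  have hdw : DifferentiableAt ℝ (fderiv ℝ w) q₀ :=
    (hw.fderiv_right (m := 1) (by norm_num)).differentiableAt (by simp)
  have hsymm : fderiv ℝ (fderiv ℝ w) q₀ (1, 0) (0, v) = fderiv ℝ (fderiv ℝ w) q₀ (0, v) (1, 0) :=
    (hw.isSymmSndFDerivAt (by simp)).eq _ _
  have hG : HasFDerivAt (fun q : ℝ × E => a (q.1, w q))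
      (A.comp ((ContinuousLinearMap.fst ℝ ℝ E).prod (fderiv ℝ w q₀))) q₀ :=
    HasFDerivAt.comp q₀ (f := fun q : ℝ × E => (q.1, w q)) ha.hasFDerivAt
      (hasFDerivAt_fst.prodMk hwd)
  have hk : HasFDerivAt (fun q : ℝ × E => a (q.1, w q) (fderiv ℝ w q (1, 0))) _ q₀ :=
    hG.clm_apply (hdw.hasFDerivAt.clm_apply (hasFDerivAt_const ((1 : ℝ), (0 : E)) q₀))
  -- Differentiating a(∂w/∂t) = 0 in the direction v expresses the term with the mixed second
  -- derivative of w through first derivatives. This is Cartan's formula, whose term d(a(X))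
  -- vanishes.
  have hk0 := hk.unique ((hasFDerivAt_const (0 : ℝ) q₀).congr_of_eventuallyEq h0)
  have hk1 := DFunLike.congr_fun hk0 (0, v)
  have hh : HasFDerivAt (fun q : ℝ × E => a (q.1, w q) (fderiv ℝ w q (0, v))) _ q₀ :=
    hG.clm_apply (hdw.hasFDerivAt.clm_apply (hasFDerivAt_const ((0 : ℝ), v) q₀))
  have hline : HasDerivAt (fun t : ℝ => (t, u₀)) ((1 : ℝ), (0 : E)) t₀ :=
    (hasDerivAt_id t₀).prodMk (hasDerivAt_const t₀ u₀)
  refine (hh.comp_hasDerivAt t₀ hline).congr_deriv ?_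
  have hsplit : ((1 : ℝ), fderiv ℝ w q₀ (1, 0)) = (1, 0) + (0, fderiv ℝ w q₀ (1, 0)) := by simp
  simp [ContinuousLinearMap.comp_apply] at hk1 ⊢
  rw [hsplit, map_add, _root_.add_apply, hsymm, spaceD_apply]
  linarith

end GrayDerivative

/-! ### Gray's vector field on a manifold. -/

section GrayField

variable {E : Type*} [NormedAddCommGroup E] [NormedSpace ℝ E]
  {M : Type*} [TopologicalSpace M] [ChartedSpace E M]

/-- A family of 1-forms that is smooth jointly in the parameter and the point. -/
def IsSmoothFamily (δ : ℝ → OneForm 𝓘(ℝ, E) M) : Prop :=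
  ∀ x₀ : M, ContDiffOn ℝ ∞ (fun q : ℝ × E => (δ q.1).inChart x₀ q.2)
    (Set.univ ×ˢ (extChartAt 𝓘(ℝ, E) x₀).target)

/-- The expression of a family of 1-forms in a chart. -/
def familyInChart (δ : ℝ → OneForm 𝓘(ℝ, E) M) (x₀ : M) (q : ℝ × E) : E →L[ℝ] ℝ :=
  (δ q.1).inChart x₀ q.2

lemma IsSmoothFamily.contDiffAt {δ : ℝ → OneForm 𝓘(ℝ, E) M} (hδ : IsSmoothFamily δ) {x₀ : M}
    {s : ℝ} {u : E} (hu : u ∈ (extChartAt 𝓘(ℝ, E) x₀).target) :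
    ContDiffAt ℝ ∞ (familyInChart δ x₀) (s, u) :=
  (hδ x₀).contDiffAt (prod_mem_nhds Filter.univ_mem (extChartAt_target_mem_nhds' hu))

lemma IsSmoothFamily.isSmooth {δ : ℝ → OneForm 𝓘(ℝ, E) M} (hδ : IsSmoothFamily δ) (s : ℝ) :
    (δ s).IsSmooth := fun x₀ _ hu =>
  ((hδ.contDiffAt (s := s) hu).comp (f := fun u => (s, u)) _ (by fun_prop)).contDiffWithinAt

/-- The value of a 1-form as a linear form on the model space. -/
def OneForm.val (α : OneForm 𝓘(ℝ, E) M) (x : M) : E →L[ℝ] ℝ := α x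

/-- The value of the exterior derivative of a 1-form as a form on the model space. -/
def OneForm.dval (α : OneForm 𝓘(ℝ, E) M) (x : M) (v w : E) : ℝ := α.d x v w

/-- A 1-form that does not vanish and whose exterior derivative is nondegenerate on its kernel. -/
def OneForm.IsNondegenerate (α : OneForm 𝓘(ℝ, E) M) : Prop :=
  ∀ x, Nondegenerate (fun v => α.val x v) (α.dval x)

variable [IsManifold 𝓘(ℝ, E) ∞ M]

lemma OneForm.val_eq_inChart (α : OneForm 𝓘(ℝ, E) M) {x₀ x : M}
    (hx : x ∈ (extChartAt 𝓘(ℝ, E) x₀).source) (v : E) : α.val x v =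
      α.inChart x₀ (extChartAt 𝓘(ℝ, E) x₀ x) (dmap (extChartAt 𝓘(ℝ, E) x₀) x v) :=
  OneForm.apply_eq_inChart hx v

/-- The tangent space at x is identified with the model space by the preferred chart at x. -/
lemma dmap_extChartAt_self (x : M) :
    dmap (extChartAt 𝓘(ℝ, E) x) x = ContinuousLinearMap.id ℝ E := by
  rw [dmap_eq_fderiv_chartMap (mdifferentiableAt_extChartAt' (mem_extChartAt_source x))]
  have : chartMap (E := E) (E' := E) (extChartAt 𝓘(ℝ, E) x) x (extChartAt 𝓘(ℝ, E) x x)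
      =ᶠ[𝓝 (extChartAt 𝓘(ℝ, E) x x)] id := by
    filter_upwards [extChartAt_target_mem_nhds x] with u hu
    exact (extChartAt 𝓘(ℝ, E) x).right_inv hu
  rw [this.fderiv_eq, fderiv_id]

lemma dmap_extChartAt_surjective {x₀ x : M} (hx : x ∈ (extChartAt 𝓘(ℝ, E) x₀).source) :
    Function.Surjective (dmap (extChartAt 𝓘(ℝ, E) x₀) x : E → E) := fun w => by
  have : IsManifold 𝓘(ℝ, E) 1 M := isManifold_one
  obtain ⟨e, he⟩ := isInvertible_mfderiv_extChartAt (I := 𝓘(ℝ, E)) hx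
  refine ⟨e.symm w, ?_⟩
  change mfderiv 𝓘(ℝ, E) 𝓘(ℝ, E) (extChartAt 𝓘(ℝ, E) x₀) x (e.symm w) = w
  rw [← he]
  exact e.apply_symm_apply w

variable {δ : ℝ → OneForm 𝓘(ℝ, E) M}

lemma IsSmoothFamily.hasDerivAt (hδ : IsSmoothFamily δ) {x₀ x : M}
    (hx : x ∈ (extChartAt 𝓘(ℝ, E) x₀).source) (s : ℝ) (w : E) :
    HasDerivAt (fun r => (δ r).val x w) (fderiv ℝ (familyInChart δ x₀) (s, extChartAt 𝓘(ℝ, E) x₀ x) (1, 0)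
      (dmap (extChartAt 𝓘(ℝ, E) x₀) x w)) s := by
  have hd := ((hδ.contDiffAt (s := s) ((extChartAt 𝓘(ℝ, E) x₀).map_source hx)).differentiableAt
    (by simp)).hasFDerivAt
  have hline : HasDerivAt (fun t : ℝ => (t, extChartAt 𝓘(ℝ, E) x₀ x)) ((1 : ℝ), (0 : E)) s :=
    (hasDerivAt_id s).prodMk (hasDerivAt_const s _)
  have h1 : HasDerivAt (fun r => familyInChart δ x₀ (r, extChartAt 𝓘(ℝ, E) x₀ x))
      (fderiv ℝ (familyInChart δ x₀) (s, extChartAt 𝓘(ℝ, E) x₀ x) (1, 0)) s :=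
    HasFDerivAt.comp_hasDerivAt (l := familyInChart δ x₀)
      (f := fun t => (t, extChartAt 𝓘(ℝ, E) x₀ x)) s hd hline
  have h2 := h1.clm_apply
    (hasDerivAt_const s (dmap (E := E) (E' := E) (extChartAt 𝓘(ℝ, E) x₀) x w))
  rw [map_zero, add_zero] at h2
  have h3 : (fun r => (δ r).val x w) = fun r => familyInChart δ x₀ (r, extChartAt 𝓘(ℝ, E) x₀ x)
      (dmap (E := E) (E' := E) (extChartAt 𝓘(ℝ, E) x₀) x w) :=
    funext fun r => (δ r).val_eq_inChart hx w
  rw [h3]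
  exact h2

lemma IsSmoothFamily.d_eq_spaceD (hδ : IsSmoothFamily δ) {x₀ x : M}
    (hx : x ∈ (extChartAt 𝓘(ℝ, E) x₀).source) (s : ℝ) (v w : E) :
    (δ s).dval x v w = spaceD (familyInChart δ x₀) (s, extChartAt 𝓘(ℝ, E) x₀ x)
      (dmap (extChartAt 𝓘(ℝ, E) x₀) x v) (dmap (extChartAt 𝓘(ℝ, E) x₀) x w) := by
  rw [OneForm.dval, OneForm.d_eq_inChart (hδ.isSmooth s) hx, ← d1_eq_spaceD
    ((hδ.contDiffAt ((extChartAt 𝓘(ℝ, E) x₀).map_source hx)).differentiableAt (by simp))]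
  rfl

lemma IsSmoothFamily.nondegenerate_inChart (hδ : IsSmoothFamily δ) {x₀ x : M}
    (hx : x ∈ (extChartAt 𝓘(ℝ, E) x₀).source) {s : ℝ}
    (h : (δ s).IsNondegenerate) :
    Nondegenerate (fun v => familyInChart δ x₀ (s, extChartAt 𝓘(ℝ, E) x₀ x) v)
      (fun v w => spaceD (familyInChart δ x₀) (s, extChartAt 𝓘(ℝ, E) x₀ x) v w) := by
  obtain ⟨⟨w, hw⟩, h2⟩ := h x
  refine ⟨⟨dmap (E := E) (E' := E) (extChartAt 𝓘(ℝ, E) x₀) x w, ?_⟩, ?_⟩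
  · exact fun h => hw (((δ s).val_eq_inChart hx w).trans h)
  · intro v hv hvw
    obtain ⟨v', rfl⟩ := dmap_extChartAt_surjective hx v
    have : v' = 0 := h2 v' (((δ s).val_eq_inChart hx v').trans hv) fun w' hw' => by
      refine (hδ.d_eq_spaceD hx s v' w').trans (hvw _ ?_)
      exact ((δ s).val_eq_inChart hx w').symm.trans hw'
    rw [this, map_zero]

/-- Gray's vector field of a family of contact forms. -/
def grayField (δ : ℝ → OneForm 𝓘(ℝ, E) M) (s : ℝ) (x : M) : E :=
  (graySolution (familyInChart δ x) (s, extChartAt 𝓘(ℝ, E) x x)).1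

/-- The rate at which the contact form is rescaled along Gray's vector field. -/
def grayRate (δ : ℝ → OneForm 𝓘(ℝ, E) M) (s : ℝ) (x : M) : ℝ :=
  (graySolution (familyInChart δ x) (s, extChartAt 𝓘(ℝ, E) x x)).2

variable [FiniteDimensional ℝ E]

/-- Gray's equation transforms naturally under changes of chart and has a unique solution, so the
pointwise definition by preferred charts can be read in any fixed chart. This gives smoothness of
the field and continuity of the rate. -/
lemma graySolution_inChart (hδ : IsSmoothFamily δ) {x₀ x : M}
    (hx : x ∈ (extChartAt 𝓘(ℝ, E) x₀).source) {s : ℝ}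
    (h : (δ s).IsNondegenerate) :
    graySolution (familyInChart δ x₀) (s, extChartAt 𝓘(ℝ, E) x₀ x) =
      (dmap (extChartAt 𝓘(ℝ, E) x₀) x (grayField δ s x), grayRate δ s x) := by
  have hxx := mem_extChartAt_source (I := 𝓘(ℝ, E)) x
  obtain ⟨h1, h2⟩ := graySolution_spec (hδ.nondegenerate_inChart hxx h)
  have hid : ∀ w : E, dmap (E := E) (E' := E) (extChartAt 𝓘(ℝ, E) x) x w = w := fun w => by
    rw [dmap_extChartAt_self]; rfl
  have h3 : (δ s).val x (grayField δ s x) = 0 := by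
    refine ((δ s).val_eq_inChart hxx (grayField δ s x)).trans ?_
    rw [hid]
    exact h1
  refine graySolution_unique (hδ.nondegenerate_inChart hx h)
    (((δ s).val_eq_inChart hx (grayField δ s x)).symm.trans h3) fun w => ?_
  obtain ⟨w', rfl⟩ := dmap_extChartAt_surjective hx w
  have h4 := h2 w'
  have e1 : (δ s).dval x (grayField δ s x) w' = _ := hδ.d_eq_spaceD hx s (grayField δ s x) w'
  have e2 : (δ s).dval x (grayField δ s x) w' = _ := hδ.d_eq_spaceD hxx s (grayField δ s x) w'
  have e3 := (hδ.hasDerivAt hx s w').unique (hδ.hasDerivAt hxx s w')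
  have e4 : (δ s).val x w' = _ := (δ s).val_eq_inChart hx w'
  have e5 : (δ s).val x w' = _ := (δ s).val_eq_inChart hxx w'
  rw [hid] at e3 e5
  rw [hid, hid] at e2
  refine e1.symm.trans (e2.trans (h4.trans ?_))
  rw [e3]
  congr 2
  exact e5.symm.trans e4

lemma apply_grayField (hδ : IsSmoothFamily δ) {x : M} {s : ℝ}
    (h : (δ s).IsNondegenerate) :
    (δ s).val x (grayField δ s x) = 0 := by
  have hxx := mem_extChartAt_source (I := 𝓘(ℝ, E)) x
  refine ((δ s).val_eq_inChart hxx (grayField δ s x)).trans ?_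
  rw [dmap_extChartAt_self]
  exact (graySolution_spec (hδ.nondegenerate_inChart hxx h)).1

/-- Where the family is locally constant in time, the inhomogeneous term vanishes and (0, 0) solves
the equation. -/
lemma grayField_eq_zero (hδ : IsSmoothFamily δ) {x : M} {s : ℝ}
    (h : (δ s).IsNondegenerate)
    (hs : ∀ᶠ r in 𝓝 s, δ r = δ s) : grayField δ s x = 0 := by
  have hxx := mem_extChartAt_source (I := 𝓘(ℝ, E)) x
  have : graySolution (familyInChart δ x) (s, extChartAt 𝓘(ℝ, E) x x) = (0, 0) := by
    refine graySolution_unique (hδ.nondegenerate_inChart hxx h) (map_zero _) fun w => ?_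
    have h1 := hδ.hasDerivAt hxx s w
    rw [dmap_extChartAt_self] at h1
    have h2 : HasDerivAt (fun r => (δ r).val x w) 0 s :=
      (hasDerivAt_const s ((δ s).val x w)).congr_of_eventuallyEq (hs.mono fun r hr => by simp only [hr])
    have h3 := h1.unique h2
    simp only [ContinuousLinearMap.id_apply] at h3
    rw [h3]; simp
  rw [grayField, this]

/-- Gray's vector field on the product of the parameter space with the manifold. -/
def suspendedGrayField (δ : ℝ → OneForm 𝓘(ℝ, E) M) (q : ℝ × M) :
    TangentSpace (𝓘(ℝ, ℝ).prod 𝓘(ℝ, E)) q := ((1 : ℝ), grayField δ q.1 q.2)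

lemma chartField_suspendedGrayField (hδ : IsSmoothFamily δ)
    (h : ∀ s, (δ s).IsNondegenerate)
    (q₀ : ℝ × M) {y : ℝ × E} (hy : y ∈ (extChartAt (𝓘(ℝ, ℝ).prod 𝓘(ℝ, E)) q₀).target) :
    chartField (I := 𝓘(ℝ, ℝ).prod 𝓘(ℝ, E)) (suspendedGrayField δ) q₀ y =
      ((1 : ℝ), (graySolution (familyInChart δ q₀.2) y).1) := by
  rw [extChartAt_prod] at hy
  obtain ⟨-, hy2⟩ := hy
  set c := extChartAt 𝓘(ℝ, E) q₀.2 with hc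
  have hx : c.symm y.2 ∈ c.source := c.map_target hy2
  have h1 := graySolution_inChart hδ (x₀ := q₀.2) hx (h y.1)
  rw [c.right_inv hy2] at h1
  have hs : (extChartAt (𝓘(ℝ, ℝ).prod 𝓘(ℝ, E)) q₀).symm y = (y.1, c.symm y.2) := by
    rw [extChartAt_prod]; rfl
  have hm : mfderiv (𝓘(ℝ, ℝ).prod 𝓘(ℝ, E)) 𝓘(ℝ, ℝ × E) (extChartAt (𝓘(ℝ, ℝ).prod 𝓘(ℝ, E)) q₀)
      (y.1, c.symm y.2) = (ContinuousLinearMap.id ℝ ℝ).prodMap (dmap (E := E) (E' := E) c (c.symm y.2)) := by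
    rw [extChartAt_prod]
    have h2 := mfderiv_prodMap (I := 𝓘(ℝ, ℝ)) (J := 𝓘(ℝ, ℝ)) (I' := 𝓘(ℝ, E)) (J' := 𝓘(ℝ, E))
      (f := (id : ℝ → ℝ)) (g := c) (p := (y.1, c.symm y.2)) mdifferentiableAt_id
      (mdifferentiableAt_extChartAt' hx)
    rw [mfderiv_id] at h2
    rw [modelWithCornersSelf_prod, ← chartedSpaceSelf_prod]
    exact h2
  rw [chartField, hs, hm, h1]
  rfl

lemma contMDiff_suspendedGrayField (hδ : IsSmoothFamily δ)
    (h : ∀ s, (δ s).IsNondegenerate) :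
    ContMDiff (𝓘(ℝ, ℝ).prod 𝓘(ℝ, E)) (𝓘(ℝ, ℝ).prod 𝓘(ℝ, E)).tangent ∞
      (fun q => (⟨q, suspendedGrayField δ q⟩ :
        TangentBundle (𝓘(ℝ, ℝ).prod 𝓘(ℝ, E)) (ℝ × M))) := by
  rw [contMDiff_section_iff_chartField]
  intro q₀ y hy
  have hy' := hy
  rw [extChartAt_prod] at hy'
  obtain ⟨-, hy2⟩ := hy'
  set c := extChartAt 𝓘(ℝ, E) q₀.2 with hc
  have hx : c.symm y.2 ∈ c.source := c.map_target hy2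
  have hnd := hδ.nondegenerate_inChart hx (h y.1)
  rw [c.right_inv hy2] at hnd
  have h1 : ContDiffAt ℝ ∞ (graySolution (familyInChart δ q₀.2)) y :=
    contDiffAt_graySolution (hδ.contDiffAt hy2) hnd
  have h2 : ContDiffAt ℝ ∞ (fun y => ((1 : ℝ), (graySolution (familyInChart δ q₀.2) y).1)) y :=
    contDiffAt_const.prodMk (contDiff_fst.contDiffAt.comp y h1)
  refine h2.contDiffWithinAt.congr_of_mem (fun z hz => ?_) hy
  exact chartField_suspendedGrayField hδ h q₀ hz

end GrayField

/-! ### Rescaling of the forms along the flow of Gray's field. -/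

section GrayStability

variable {E : Type*} [NormedAddCommGroup E] [NormedSpace ℝ E]
  {M : Type*} [TopologicalSpace M] [ChartedSpace E M] [IsManifold 𝓘(ℝ, E) ∞ M]
  {δ : ℝ → OneForm 𝓘(ℝ, E) M} {Ψ : ℝ → M → M}

/-- `Ψ` is a flow of the time-dependent vector field `X`. -/
def IsFlowOf (Ψ : ℝ → M → M) (X : ℝ → M → E) : Prop :=
  ∀ t x, HasMFDerivAt 𝓘(ℝ, ℝ) 𝓘(ℝ, E) (fun t => Ψ t x) t
    (ContinuousLinearMap.toSpanSingleton ℝ (X t (Ψ t x)) : ℝ →L[ℝ] E)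

/-- The expression of an isotopy in charts. -/
def isotopyInChart (Ψ : ℝ → M → M) (x₀ y₀ : M) (q : ℝ × E) : E :=
  extChartAt 𝓘(ℝ, E) y₀ (Ψ q.1 ((extChartAt 𝓘(ℝ, E) x₀).symm q.2))

omit [IsManifold 𝓘(ℝ, E) ∞ M] in
lemma contMDiff_slice (hΨ : ContMDiff (𝓘(ℝ, ℝ).prod 𝓘(ℝ, E)) 𝓘(ℝ, E) ∞ (fun q : ℝ × M => Ψ q.1 q.2))
    (t : ℝ) : ContMDiff 𝓘(ℝ, E) 𝓘(ℝ, E) ∞ (Ψ t) :=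
  hΨ.comp (contMDiff_const.prodMk contMDiff_id : ContMDiff 𝓘(ℝ, E) (𝓘(ℝ, ℝ).prod 𝓘(ℝ, E)) ∞
    (fun x : M => (t, x)))

lemma contDiffAt_isotopyInChart
    (hΨ : ContMDiff (𝓘(ℝ, ℝ).prod 𝓘(ℝ, E)) 𝓘(ℝ, E) ∞ (fun q : ℝ × M => Ψ q.1 q.2)) {x₀ y₀ : M}
    {q : ℝ × E} (hq : q.2 ∈ (extChartAt 𝓘(ℝ, E) x₀).target)
    (hy : Ψ q.1 ((extChartAt 𝓘(ℝ, E) x₀).symm q.2) ∈ (extChartAt 𝓘(ℝ, E) y₀).source) :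
    ContDiffAt ℝ ∞ (isotopyInChart Ψ x₀ y₀) q := by
  rw [← contMDiffAt_iff_contDiffAt]
  have h1 : ContMDiffAt 𝓘(ℝ, ℝ × E) 𝓘(ℝ, E) ∞
      (fun q : ℝ × E => (extChartAt 𝓘(ℝ, E) x₀).symm q.2) q :=
    ((contMDiffOn_extChartAt_symm (n := ∞) x₀).contMDiffAt
      (extChartAt_target_mem_nhds' hq)).comp q contDiff_snd.contMDiff.contMDiffAt
  have h2 : ContMDiffAt 𝓘(ℝ, ℝ × E) 𝓘(ℝ, E) ∞
      (fun q : ℝ × E => Ψ q.1 ((extChartAt 𝓘(ℝ, E) x₀).symm q.2)) q :=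
    (hΨ (q.1, (extChartAt 𝓘(ℝ, E) x₀).symm q.2)).comp q (contDiff_fst.contMDiff.contMDiffAt.prodMk h1)
  exact (contMDiffAt_extChartAt' (n := ∞) (by simpa using hy)).comp q h2

lemma fderiv_isotopyInChart_time
    (hΨ : ContMDiff (𝓘(ℝ, ℝ).prod 𝓘(ℝ, E)) 𝓘(ℝ, E) ∞ (fun q : ℝ × M => Ψ q.1 q.2))
    {X : ℝ → M → E} (hX : IsFlowOf Ψ X) {x₀ y₀ : M}
    {q : ℝ × E} (hq : q.2 ∈ (extChartAt 𝓘(ℝ, E) x₀).target)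
    (hy : Ψ q.1 ((extChartAt 𝓘(ℝ, E) x₀).symm q.2) ∈ (extChartAt 𝓘(ℝ, E) y₀).source) :
    fderiv ℝ (isotopyInChart Ψ x₀ y₀) q (1, 0) =
      dmap (extChartAt 𝓘(ℝ, E) y₀) (Ψ q.1 ((extChartAt 𝓘(ℝ, E) x₀).symm q.2))
        (X q.1 (Ψ q.1 ((extChartAt 𝓘(ℝ, E) x₀).symm q.2))) := by
  obtain ⟨t, u⟩ := q
  set z := (extChartAt 𝓘(ℝ, E) x₀).symm u with hz
  have h0 : HasMFDerivAt 𝓘(ℝ, ℝ) 𝓘(ℝ, E) (fun r => isotopyInChart Ψ x₀ y₀ (r, u)) t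
      ((dmap (E := E) (E' := E) (extChartAt 𝓘(ℝ, E) y₀) (Ψ t z)).comp
        (ContinuousLinearMap.toSpanSingleton ℝ (X t (Ψ t z)))) :=
    (mdifferentiableAt_extChartAt' (E := E) hy).hasMFDerivAt.comp t (hX t z)
  have h0' : HasFDerivAt (fun r => isotopyInChart Ψ x₀ y₀ (r, u))
      ((dmap (E := E) (E' := E) (extChartAt 𝓘(ℝ, E) y₀) (Ψ t z)).comp
        (ContinuousLinearMap.toSpanSingleton ℝ (X t (Ψ t z)))) t := h0.hasFDerivAt
  have h1 := h0'.hasDerivAt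
  have hline : HasDerivAt (fun r : ℝ => (r, u)) ((1 : ℝ), (0 : E)) t :=
    (hasDerivAt_id t).prodMk (hasDerivAt_const t u)
  have h2 := HasFDerivAt.comp_hasDerivAt (l := isotopyInChart Ψ x₀ y₀)
      (f := fun r => (r, u)) t
      ((contDiffAt_isotopyInChart hΨ hq hy).differentiableAt (by simp)).hasFDerivAt hline
  refine (h2.unique h1).trans ?_
  rw [ContinuousLinearMap.comp_apply, ContinuousLinearMap.toSpanSingleton_apply, one_smul]

lemma fderiv_isotopyInChart_space
    (hΨ : ContMDiff (𝓘(ℝ, ℝ).prod 𝓘(ℝ, E)) 𝓘(ℝ, E) ∞ (fun q : ℝ × M => Ψ q.1 q.2)) {x y₀ : M}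
    {t : ℝ} (hy : Ψ t x ∈ (extChartAt 𝓘(ℝ, E) y₀).source) (v : E) :
    fderiv ℝ (isotopyInChart Ψ x y₀) (t, extChartAt 𝓘(ℝ, E) x x) (0, v) =
      dmap (extChartAt 𝓘(ℝ, E) y₀) (Ψ t x) (dmap (E := E) (E' := E) (Ψ t) x v) := by
  have hxx : (extChartAt 𝓘(ℝ, E) x).symm (extChartAt 𝓘(ℝ, E) x x) = x := extChartAt_to_inv x
  have hd1 : MDifferentiableAt 𝓘(ℝ, E) 𝓘(ℝ, E) (Ψ t) x :=
    (contMDiff_slice hΨ t).contMDiffAt.mdifferentiableAt (by simp)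
  have hd2 := mdifferentiableAt_extChartAt' (E := E) hy
  have h1 : dmap (extChartAt 𝓘(ℝ, E) y₀ ∘ Ψ t) x =
      (dmap (E := E) (E' := E) (extChartAt 𝓘(ℝ, E) y₀) (Ψ t x)).comp (dmap (E := E) (E' := E) (Ψ t) x) :=
    mfderiv_comp x hd2 hd1
  have h2 := dmap_eq_fderiv_chartMap (hd2.comp x hd1)
  have h3 : HasFDerivAt (fun u => isotopyInChart Ψ x y₀ (t, u))
      ((fderiv ℝ (isotopyInChart Ψ x y₀) (t, extChartAt 𝓘(ℝ, E) x x)).comp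
        (ContinuousLinearMap.inr ℝ ℝ E)) (extChartAt 𝓘(ℝ, E) x x) :=
    HasFDerivAt.comp (g := isotopyInChart Ψ x y₀) (f := fun u => (t, u)) _
      ((contDiffAt_isotopyInChart hΨ (q := (t, extChartAt 𝓘(ℝ, E) x x)) (mem_extChartAt_target x)
        (by simpa only [hxx] using hy)).differentiableAt (by simp)).hasFDerivAt
      (hasFDerivAt_prodMk_right _ _)
  have h4 : chartMap (E := E) (E' := E) (extChartAt 𝓘(ℝ, E) y₀ ∘ Ψ t) x
      ((extChartAt 𝓘(ℝ, E) y₀ ∘ Ψ t) x) = fun u => isotopyInChart Ψ x y₀ (t, u) := rfl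
  rw [h4, h3.fderiv] at h2
  have h5 := DFunLike.congr_fun (h1.symm.trans h2) v
  simpa using h5.symm

variable [FiniteDimensional ℝ E]

lemma continuousAt_grayRate (hδ : IsSmoothFamily δ) (h : ∀ s, (δ s).IsNondegenerate) (s : ℝ)
    (x : M) : ContinuousAt (fun q : ℝ × M => grayRate δ q.1 q.2) (s, x) := by
  have hxx := mem_extChartAt_source (I := 𝓘(ℝ, E)) x
  have h1 : ContinuousAt (graySolution (familyInChart δ x)) (s, extChartAt 𝓘(ℝ, E) x x) :=
    (contDiffAt_graySolution (hδ.contDiffAt (mem_extChartAt_target x))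
      (hδ.nondegenerate_inChart hxx (h s))).continuousAt
  have h2 : ContinuousAt (fun q : ℝ × M => (q.1, extChartAt 𝓘(ℝ, E) x q.2)) (s, x) :=
    continuousAt_fst.prodMk (ContinuousAt.comp (g := extChartAt 𝓘(ℝ, E) x) (f := Prod.snd)
      (continuousAt_extChartAt (I := 𝓘(ℝ, E)) x) continuousAt_snd)
  have h3 : ContinuousAt (fun q : ℝ × M =>
      (graySolution (familyInChart δ x) (q.1, extChartAt 𝓘(ℝ, E) x q.2)).2) (s, x) :=
    continuousAt_snd.comp (ContinuousAt.comp (g := graySolution (familyInChart δ x))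
      (f := fun q : ℝ × M => (q.1, extChartAt 𝓘(ℝ, E) x q.2)) h1 h2)
  refine h3.congr ?_
  filter_upwards [(continuous_snd.tendsto (s, x)).eventually
    (extChartAt_source_mem_nhds (I := 𝓘(ℝ, E)) x)] with q hq
  rw [graySolution_inChart hδ hq (h q.1)]

/-- Cartan's formula gives (∂a/∂t + ι_X da)(dΨ v), and Gray's equation turns this into μ a(dΨ v). -/
lemma hasDerivAt_pullback_isotopy (hδ : IsSmoothFamily δ) (h : ∀ s, (δ s).IsNondegenerate)
    (hΨ : ContMDiff (𝓘(ℝ, ℝ).prod 𝓘(ℝ, E)) 𝓘(ℝ, E) ∞ (fun q : ℝ × M => Ψ q.1 q.2))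
    (hX : IsFlowOf Ψ (grayField δ)) (x : M) (v : E) (t₀ : ℝ) :
    HasDerivAt (fun t => (δ t).val (Ψ t x) (dmap (E := E) (E' := E) (Ψ t) x v))
      (grayRate δ t₀ (Ψ t₀ x) * (δ t₀).val (Ψ t₀ x) (dmap (E := E) (E' := E) (Ψ t₀) x v)) t₀ := by
  have hxx : (extChartAt 𝓘(ℝ, E) x).symm (extChartAt 𝓘(ℝ, E) x x) = x := extChartAt_to_inv x
  set y := Ψ t₀ x with hy
  set w := isotopyInChart (E := E) Ψ x y with hw
  set u₀ := extChartAt 𝓘(ℝ, E) x x with hu₀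
  set a := familyInChart δ y with ha
  have hu : u₀ ∈ (extChartAt 𝓘(ℝ, E) x).target := mem_extChartAt_target x
  have hys : y ∈ (extChartAt 𝓘(ℝ, E) y).source := mem_extChartAt_source y
  have hwq : ∀ t, w (t, u₀) = extChartAt 𝓘(ℝ, E) y (Ψ t x) := fun t => by
    rw [hw, isotopyInChart, hxx]
  have hevt : ∀ᶠ t in 𝓝 t₀, Ψ t x ∈ (extChartAt 𝓘(ℝ, E) y).source :=
    (hX t₀ x).continuousAt (extChartAt_source_mem_nhds y)
  have hev : ∀ᶠ q in 𝓝 (t₀, u₀), q.2 ∈ (extChartAt 𝓘(ℝ, E) x).target ∧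
      Ψ q.1 ((extChartAt 𝓘(ℝ, E) x).symm q.2) ∈ (extChartAt 𝓘(ℝ, E) y).source := by
    have hu' : ∀ᶠ u in 𝓝 u₀, u ∈ (extChartAt 𝓘(ℝ, E) x).target := extChartAt_target_mem_nhds x
    refine ((continuous_snd.tendsto (t₀, u₀)).eventually hu').and ?_
    have hc : ContinuousAt (fun q : ℝ × E => (q.1, (extChartAt 𝓘(ℝ, E) x).symm q.2)) (t₀, u₀) :=
      continuousAt_fst.prodMk (ContinuousAt.comp (g := (extChartAt 𝓘(ℝ, E) x).symm) (f := Prod.snd)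
        (mdifferentiableAt_extChartAt_symm' hu).continuousAt continuousAt_snd)
    have hc2 : ContinuousAt (fun q : ℝ × E => Ψ q.1 ((extChartAt 𝓘(ℝ, E) x).symm q.2)) (t₀, u₀) :=
      ContinuousAt.comp (g := fun q : ℝ × M => Ψ q.1 q.2) hΨ.continuous.continuousAt hc
    refine hc2 (extChartAt_source_mem_nhds' ?_)
    simpa only [hxx] using hys
  have h0 : ∀ᶠ q in 𝓝 (t₀, u₀), a (q.1, w q) (fderiv ℝ w q (1, 0)) = 0 := by
    filter_upwards [hev] with q hq
    rw [hw, fderiv_isotopyInChart_time hΨ hX hq.1 hq.2]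
    exact ((δ q.1).val_eq_inChart hq.2 _).symm.trans (apply_grayField hδ (h q.1))
  have hwt : w (t₀, u₀) ∈ (extChartAt 𝓘(ℝ, E) y).target := by
    rw [hwq]; exact mem_extChartAt_target y
  have hmain := hasDerivAt_pullback_of_isotopy (a := a) (w := w) (t₀ := t₀) (u₀ := u₀)
    ((contDiffAt_isotopyInChart hΨ hu (by simpa only [hxx] using hys)).of_le two_le_infty)
    ((hδ.contDiffAt hwt).differentiableAt (by simp)) h0 v
  have hsp : ∀ t, Ψ t x ∈ (extChartAt 𝓘(ℝ, E) y).source →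
      a (t, w (t, u₀)) (fderiv ℝ w (t, u₀) (0, v)) = (δ t).val (Ψ t x) (dmap (E := E) (E' := E) (Ψ t) x v) :=
    fun t ht => by
      rw [hwq, hw, fderiv_isotopyInChart_space hΨ ht]
      exact ((δ t).val_eq_inChart ht _).symm
  have hsol := graySolution_spec (hδ.nondegenerate_inChart hys (h t₀))
  rw [graySolution_inChart hδ hys (h t₀)] at hsol
  have hw1 : fderiv ℝ w (t₀, u₀) (1, 0) = dmap (extChartAt 𝓘(ℝ, E) y) y (grayField δ t₀ y) := by
    rw [hw, fderiv_isotopyInChart_time hΨ hX hu (by simpa only [hxx] using hys)]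
    simp only [hxx]
    rfl
  refine (hmain.congr_of_eventuallyEq ?_).congr_deriv ?_
  · filter_upwards [hevt] with t ht
    exact (hsp t ht).symm
  · rw [← hsp t₀ hys, hwq, hw1]
    simp only [← hy]
    rw [hsol.2]
    ring

/-- The values on dΨ_t v satisfy the scalar equation y' = μ y, whose rate does not depend on v. The
same exponential factor therefore serves all v. -/
lemma exists_smul_of_isotopy (hδ : IsSmoothFamily δ) (h : ∀ s, (δ s).IsNondegenerate)
    (hΨ : ContMDiff (𝓘(ℝ, ℝ).prod 𝓘(ℝ, E)) 𝓘(ℝ, E) ∞ (fun q : ℝ × M => Ψ q.1 q.2))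
    (hX : IsFlowOf Ψ (grayField δ)) (hΨ0 : Ψ 0 = id) (x : M) :
    ∃ c : ℝ, 0 < c ∧ OneForm.pullback (I := 𝓘(ℝ, E)) (Ψ 1) (δ 1) x = c • δ 0 x := by
  have hcont : Continuous fun t => grayRate δ t (Ψ t x) := by
    rw [continuous_iff_continuousAt]
    intro t
    exact ContinuousAt.comp (g := fun q : ℝ × M => grayRate δ q.1 q.2) (f := fun t => (t, Ψ t x))
      (continuousAt_grayRate hδ h t _) (continuousAt_id.prodMk (hX t x).continuousAt)
  refine ⟨Real.exp (∫ t in (0 : ℝ)..1, grayRate δ t (Ψ t x)), Real.exp_pos _, ?_⟩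
  refine ContinuousLinearMap.ext fun (v : E) => ?_
  -- Multiplication by the integrating factor makes the pulled-back value constant in time.
  set k : ℝ → ℝ := fun t => (δ t).val (Ψ t x) (dmap (E := E) (E' := E) (Ψ t) x v) *
    Real.exp (-∫ r in (0 : ℝ)..t, grayRate δ r (Ψ r x)) with hk
  have hk' : ∀ t, HasDerivAt k 0 t := fun t => by
    have h1 := hasDerivAt_pullback_isotopy hδ h hΨ hX x v t
    have h2 : HasDerivAt (fun t => ∫ r in (0 : ℝ)..t, grayRate δ r (Ψ r x))
      (grayRate δ t (Ψ t x)) t := (hcont.integral_hasStrictDerivAt 0 t).hasDerivAt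
    have h3 : HasDerivAt k _ t := h1.mul h2.neg.exp
    refine h3.congr_deriv ?_
    simp only [Pi.neg_apply]
    ring
  have hconst := is_const_of_deriv_eq_zero (f := k) (fun t => (hk' t).differentiableAt)
    (fun t => (hk' t).deriv) 1 0
  have hid : dmap (Ψ 0) x = ContinuousLinearMap.id ℝ E := by
    rw [hΨ0]; exact mfderiv_id
  have hk0 : k 0 = (δ 0).val x (v : E) := by
    simp only [hk, intervalIntegral.integral_same, neg_zero, Real.exp_zero, mul_one]
    rw [hid]
    simp [hΨ0]
  rw [hk0] at hconst
  change (δ 1).val (Ψ 1 x) (dmap (E := E) (E' := E) (Ψ 1) x v) = Real.exp _ * (δ 0).val x v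
  rw [← hconst, hk]
  simp only
  rw [mul_left_comm, ← Real.exp_add, add_neg_cancel, Real.exp_zero, mul_one]

end GrayStability

/-! ### Gray's theorem on a compact manifold. -/

section GrayTheorem

variable {E : Type*} [NormedAddCommGroup E] [NormedSpace ℝ E] [FiniteDimensional ℝ E]
  {M : Type*} [TopologicalSpace M] [T2Space M] [CompactSpace M] [ChartedSpace E M]
  [IsManifold 𝓘(ℝ, E) ∞ M]

omit [FiniteDimensional ℝ E] [T2Space M] [CompactSpace M] [IsManifold 𝓘(ℝ, E) ∞ M] in
lemma hasDerivAt_fst_integralCurve {δ : ℝ → OneForm 𝓘(ℝ, E) M} {γ : ℝ → ℝ × M}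
    (hγ : IsMIntegralCurve (I := 𝓘(ℝ, ℝ).prod 𝓘(ℝ, E)) γ (suspendedGrayField δ)) (t : ℝ) :
    HasDerivAt (fun t => (γ t).1) 1 t := by
  have h0 : HasMFDerivAt 𝓘(ℝ, ℝ) 𝓘(ℝ, ℝ) (fun t => (γ t).1) t
      ((ContinuousLinearMap.fst ℝ ℝ E).comp ((1 : ℝ →L[ℝ] ℝ).smulRight
        (((1 : ℝ), grayField δ (γ t).1 (γ t).2) : ℝ × E))) :=
    (hasMFDerivAt_fst (I := 𝓘(ℝ, ℝ)) (I' := 𝓘(ℝ, E)) (γ t)).comp t (hγ t)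
  have h1 : HasFDerivAt (fun t => (γ t).1) ((ContinuousLinearMap.fst ℝ ℝ E).comp
      ((1 : ℝ →L[ℝ] ℝ).smulRight (((1 : ℝ), grayField δ (γ t).1 (γ t).2) : ℝ × E))) t :=
    h0.hasFDerivAt
  refine h1.hasDerivAt.congr_deriv ?_
  simp

omit [FiniteDimensional ℝ E] [T2Space M] [CompactSpace M] [IsManifold 𝓘(ℝ, E) ∞ M] in
lemma hasMFDerivAt_snd_integralCurve {δ : ℝ → OneForm 𝓘(ℝ, E) M} {γ : ℝ → ℝ × M}
    (hγ : IsMIntegralCurve (I := 𝓘(ℝ, ℝ).prod 𝓘(ℝ, E)) γ (suspendedGrayField δ)) (t : ℝ) :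
    HasMFDerivAt 𝓘(ℝ, ℝ) 𝓘(ℝ, E) (fun t => (γ t).2) t
      (ContinuousLinearMap.toSpanSingleton ℝ (grayField δ (γ t).1 (γ t).2) : ℝ →L[ℝ] E) := by
  have h0 : HasMFDerivAt 𝓘(ℝ, ℝ) 𝓘(ℝ, E) (fun t => (γ t).2) t
      ((ContinuousLinearMap.snd ℝ ℝ E).comp ((1 : ℝ →L[ℝ] ℝ).smulRight
        (((1 : ℝ), grayField δ (γ t).1 (γ t).2) : ℝ × E))) :=
    (hasMFDerivAt_snd (I := 𝓘(ℝ, ℝ)) (I' := 𝓘(ℝ, E)) (γ t)).comp t (hγ t)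
  refine h0.congr_mfderiv ?_
  refine ContinuousLinearMap.ext fun r => ?_
  rfl

/-- Gray stability for families of contact forms that are constant near the ends of the parameter
interval. -/
theorem exists_gray_isotopy {δ : ℝ → OneForm 𝓘(ℝ, E) M} (hδ : IsSmoothFamily δ)
    (h : ∀ s, (δ s).IsNondegenerate) (h0 : ∀ s ≤ 0, δ s = δ 0) (h1 : ∀ s, 1 ≤ s → δ s = δ 1) :
    ∃ Ψ : ℝ → M → M,
      ContMDiff (𝓘(ℝ, ℝ).prod 𝓘(ℝ, E)) 𝓘(ℝ, E) ∞ (fun q : ℝ × M => Ψ q.1 q.2) ∧ Ψ 0 = id ∧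
      (∀ t, ∃ D : M ≃ₘ^∞⟮𝓘(ℝ, E), 𝓘(ℝ, E)⟯ M, ⇑D = Ψ t) ∧
      ∀ x, ∃ c : ℝ, 0 < c ∧ OneForm.pullback (I := 𝓘(ℝ, E)) (Ψ 1) (δ 1) x = c • δ 0 x := by
  have hzero : ∀ s x, (s < 0 ∨ 1 < s) → grayField δ s x = 0 := by
    rintro s x (hs | hs)
    · refine grayField_eq_zero hδ (h s) ?_
      filter_upwards [Iio_mem_nhds hs] with r hr
      rw [h0 r (le_of_lt hr), h0 s hs.le]
    · refine grayField_eq_zero hδ (h s) ?_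
      filter_upwards [Ioi_mem_nhds hs] with r hr
      rw [h1 r (le_of_lt hr), h1 s hs.le]
  -- The family is constant for times outside [0, 1]. The margin of 1 on each side ensures that a
  -- point outside K stays in the constant range for times in (-1, 1), where the flow is translation
  -- in the ℝ factor.
  set K : Set (ℝ × M) := Set.Icc (-1) 2 ×ˢ Set.univ with hK
  have hKc : IsCompact K := isCompact_Icc.prod isCompact_univ
  have hout : ∀ q ∉ K, q.1 < -1 ∨ 2 < q.1 := by
    intro q hq
    by_contra! hcon
    exact hq ⟨⟨hcon.1, hcon.2⟩, trivial⟩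
  have hcurve : ∀ q ∉ K, IsMIntegralCurveOn (I := 𝓘(ℝ, ℝ).prod 𝓘(ℝ, E))
      (fun t : ℝ => ((q.1 + t, q.2) : ℝ × M)) (suspendedGrayField δ) (Set.Ioo (-1) 1) := by
    intro q hq t ht
    have hz : grayField δ (q.1 + t) q.2 = 0 := by
      apply hzero
      rcases hout q hq with h' | h'
      · left; linarith [ht.2]
      · right; linarith [ht.1]
    have hd : HasDerivAt (fun t : ℝ => q.1 + t) 1 t := (hasDerivAt_id t).const_add q.1
    have hd2 := (hd.hasFDerivAt.hasMFDerivAt.prodMk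
      (hasMFDerivAt_const (I := 𝓘(ℝ, ℝ)) (I' := 𝓘(ℝ, E)) q.2 t))
    refine (hd2.congr_mfderiv ?_).hasMFDerivWithinAt
    refine ContinuousLinearMap.ext fun (r : ℝ) => ?_
    change ((r • (1 : ℝ), (0 : E)) : ℝ × E) = r • ((1 : ℝ), grayField δ (q.1 + t) q.2)
    rw [hz]
    simp
  have htrans : ContMDiff ((𝓘(ℝ, ℝ).prod 𝓘(ℝ, E)).prod 𝓘(ℝ, ℝ)) (𝓘(ℝ, ℝ).prod 𝓘(ℝ, E)) ∞
      (Function.uncurry fun (q : ℝ × M) (t : ℝ) => (q.1 + t, q.2)) := by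
    have hadd : ContMDiff ((𝓘(ℝ, ℝ).prod 𝓘(ℝ, E)).prod 𝓘(ℝ, ℝ)) 𝓘(ℝ, ℝ) ∞
        (fun p : (ℝ × M) × ℝ => p.1.1 + p.2) := by
      have h1 : ContMDiff ((𝓘(ℝ, ℝ).prod 𝓘(ℝ, E)).prod 𝓘(ℝ, ℝ)) 𝓘(ℝ, ℝ) ∞
        (fun p : (ℝ × M) × ℝ => p.1.1) := contMDiff_fst.comp contMDiff_fst
      exact h1.add contMDiff_snd
    exact hadd.prodMk (contMDiff_snd.comp contMDiff_fst)
  obtain ⟨Θ, hΘ0, hΘ, hΘs, hΘg⟩ := exists_flow_of_isCompact (I := 𝓘(ℝ, ℝ).prod 𝓘(ℝ, E))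
    (contMDiff_suspendedGrayField hδ h) hKc one_pos (fun q _ => by simp) hcurve htrans
  -- The ℝ component of the field is 1, so the flow carries the slice at time 0 to the slice at time
  -- t; its M component is Ψ t.
  have hfst : ∀ q t, (Θ q t).1 = q.1 + t := by
    intro q t
    have hd : ∀ t, HasDerivAt (fun t => (Θ q t).1 - t) 0 t := fun t =>
      ((hasDerivAt_fst_integralCurve (hΘ q) t).sub (hasDerivAt_id t)).congr_deriv (sub_self _)
    have := is_const_of_deriv_eq_zero (f := fun t => (Θ q t).1 - t)
      (fun t => (hd t).differentiableAt) (fun t => (hd t).deriv) t 0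
    simp only [hΘ0] at this
    linarith
  set Ψ : ℝ → M → M := fun t x => (Θ (0, x) t).2 with hΨ
  have hpair : ∀ t x, Θ (0, x) t = (t, Ψ t x) := fun t x =>
    Prod.ext (by rw [hfst]; simp) rfl
  have hsm : ContMDiff (𝓘(ℝ, ℝ).prod 𝓘(ℝ, E)) 𝓘(ℝ, E) ∞ (fun q : ℝ × M => Ψ q.1 q.2) :=
    contMDiff_snd.comp (hΘs.comp ((contMDiff_const.prodMk contMDiff_snd).prodMk contMDiff_fst :
      ContMDiff (𝓘(ℝ, ℝ).prod 𝓘(ℝ, E)) ((𝓘(ℝ, ℝ).prod 𝓘(ℝ, E)).prod 𝓘(ℝ, ℝ)) ∞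
        (fun q : ℝ × M => (((0 : ℝ), q.2), q.1))))
  have hΨ0 : Ψ 0 = id := funext fun x => by simp only [hΨ, hΘ0, id]
  have hflow : IsFlowOf Ψ (grayField δ) := fun t x => by
    have := hasMFDerivAt_snd_integralCurve (hΘ (0, x)) t
    rw [hpair] at this
    exact this
  refine ⟨Ψ, hsm, hΨ0, fun t => ?_, exists_smul_of_isotopy hδ h hsm hflow hΨ0⟩
  -- The inverse of Ψ t flows back from the slice at time t for time -t.
  have hinv : ContMDiff 𝓘(ℝ, E) 𝓘(ℝ, E) ∞ (fun y : M => (Θ (t, y) (-t)).2) :=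
    contMDiff_snd.comp (hΘs.comp ((contMDiff_const.prodMk contMDiff_id).prodMk contMDiff_const :
      ContMDiff 𝓘(ℝ, E) ((𝓘(ℝ, ℝ).prod 𝓘(ℝ, E)).prod 𝓘(ℝ, ℝ)) ∞
        (fun y : M => ((t, y), -t))))
  refine ⟨⟨⟨Ψ t, fun y => (Θ (t, y) (-t)).2, fun x => ?_, fun y => ?_⟩, contMDiff_slice hsm t,
    hinv⟩, rfl⟩
  · change (Θ (t, Ψ t x) (-t)).2 = x
    rw [← hpair, ← hΘg, add_neg_cancel, hΘ0]
  · change (Θ (0, (Θ (t, y) (-t)).2) t).2 = y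
    have h2 : ((0 : ℝ), (Θ (t, y) (-t)).2) = Θ (t, y) (-t) := Prod.ext (by rw [hfst]; simp) rfl
    rw [h2, ← hΘg, neg_add_cancel, hΘ0]

end GrayTheorem

/-! ### Positive frames, volumes and nondegeneracy of contact forms. -/

section Frames

variable {d : ℕ} {M : Type*} [TopologicalSpace M] [ChartedSpace (EuclideanSpace ℝ (Fin d)) M]
  [IsManifold (𝓡 d) ∞ M]

/-- A basis can be adjusted to any orientation when there is a vector whose sign can be changed. In
dimension 0 the negative orientation has no positive frame. -/
lemma ManifoldOrientation.exists_isPositiveFrame (o : ManifoldOrientation d M) (hd : d ≠ 0)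
    (x : M) : ∃ v, o.IsPositiveFrame x v := by
  have : Nonempty (Fin d) := ⟨⟨0, Nat.pos_of_ne_zero hd⟩⟩
  let b : Module.Basis (Fin d) ℝ (TangentSpace (𝓡 d) x) := (EuclideanSpace.basisFun (Fin d) ℝ).toBasis
  exact ⟨_, b.adjustToOrientation (o.at_ x), b.orientation_adjustToOrientation _, rfl⟩

/-- Positive frames at nearby points with the same expression in a chart. -/
lemma ManifoldOrientation.eventually_exists_isPositiveFrame (o : ManifoldOrientation d M) (x₀ : M) :
    ∀ᶠ x in 𝓝 x₀, ∀ v : Fin d → EuclideanSpace ℝ (Fin d), o.IsPositiveFrame x₀ v →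
      ∃ v' : Fin d → EuclideanSpace ℝ (Fin d), o.IsPositiveFrame x v' ∧
        ∀ i, dmap (extChartAt (𝓡 d) x₀) x (v' i) = v i := by
  have : IsManifold (𝓡 d) 1 M := isManifold_one
  filter_upwards [o.locally_constant x₀] with x ⟨hx, hx₀, hmap⟩ v ⟨b, hb, hbv⟩
  set e := (trivializationAt (EuclideanSpace ℝ (Fin d)) (TangentSpace (𝓡 d) (M := M))
          x₀).continuousLinearEquivAt ℝ x hx with he
  set e₀ := (trivializationAt (EuclideanSpace ℝ (Fin d)) (TangentSpace (𝓡 d) (M := M))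
          x₀).continuousLinearEquivAt ℝ x₀ hx₀ with he₀
  have hxs : x ∈ (chartAt (EuclideanSpace ℝ (Fin d)) x₀).source := by simpa using hx
  have hcoe : ∀ w : EuclideanSpace ℝ (Fin d), e w = dmap (extChartAt (𝓡 d) x₀) x w := fun w => by
    exact (congrFun (Bundle.Trivialization.coe_continuousLinearEquivAt_eq _ hx) w).trans
      (DFunLike.congr_fun
        (TangentBundle.continuousLinearMapAt_trivializationAt (I := 𝓡 d) (𝕜 := ℝ) hxs) w)
  have hcoe₀ : ∀ w : EuclideanSpace ℝ (Fin d), e₀ w = w := fun w => by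
    refine (congrFun (Bundle.Trivialization.coe_continuousLinearEquivAt_eq _ hx₀) w).trans
      ((DFunLike.congr_fun (TangentBundle.continuousLinearMapAt_trivializationAt (I := 𝓡 d) (𝕜 := ℝ)
        (mem_chart_source _ x₀)) w).trans ?_)
    change dmap (extChartAt (𝓡 d) x₀) x₀ w = w
    rw [dmap_extChartAt_self]
    rfl
  refine ⟨fun i => e.symm (e₀ (v i)),
    ⟨b.map (e₀.toLinearEquiv.trans e.symm.toLinearEquiv), ?_, ?_⟩, fun i => ?_⟩
  · have h1 : Orientation.map (Fin d) e.toLinearEquiv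
        (b.map (e₀.toLinearEquiv.trans e.symm.toLinearEquiv)).orientation =
        Orientation.map (Fin d) e.toLinearEquiv (o.at_ x) := by
      rw [hmap, ← hb, ← Module.Basis.orientation_map, ← Module.Basis.orientation_map]
      congr 1
      ext i : 1
      exact e.apply_symm_apply _
    exact (Orientation.map (Fin d) e.toLinearEquiv).injective h1
  · funext i
    rw [← hbv]
    rfl
  · exact (hcoe _).symm.trans ((e.apply_symm_apply _).trans (hcoe₀ _))

end Frames

/-- The exterior derivative of a 1-form on a normed space as a bilinear map. -/
def d1Bilin {E : Type*} [NormedAddCommGroup E] [NormedSpace ℝ E] (A : E → E →L[ℝ] ℝ) (u : E) :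
    E →ₗ[ℝ] E →ₗ[ℝ] ℝ :=
  LinearMap.mk₂ ℝ (d1 A u) (fun u v w => by simp [d1]; ring) (fun c v w => by simp [d1]; ring)
    (fun u v w => by simp [d1]; ring) (fun c v w => by simp [d1]; ring)

section ContactNondegenerate

variable {n : ℕ} {M : Type*} [TopologicalSpace M]
  [ChartedSpace (EuclideanSpace ℝ (Fin (2 * n + 1))) M] [IsManifold (𝓡 (2 * n + 1)) ∞ M]

lemma OneForm.IsSmooth.wedgePower_eq_inChart {α : OneForm (𝓡 (2 * n + 1)) M} (hα : α.IsSmooth)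
    {x₀ x : M} (hx : x ∈ (extChartAt (𝓡 (2 * n + 1)) x₀).source) (m : ℕ)
    (v : Fin (2 * m + 1) → EuclideanSpace ℝ (Fin (2 * n + 1))) :
    wedgePower m (α.val x) (α.dval x) v =
      wedgePower m (α.inChart x₀ (extChartAt (𝓡 (2 * n + 1)) x₀ x))
        (d1 (α.inChart x₀) (extChartAt (𝓡 (2 * n + 1)) x₀ x))
        (fun i => dmap (extChartAt (𝓡 (2 * n + 1)) x₀) x (v i)) := by
  have h1 : ⇑(α.val x) = fun v => α.inChart x₀ (extChartAt (𝓡 (2 * n + 1)) x₀ x)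
      (dmap (extChartAt (𝓡 (2 * n + 1)) x₀) x v) := funext fun v => α.val_eq_inChart hx v
  have h2 : α.dval x = fun v w => d1 (α.inChart x₀) (extChartAt (𝓡 (2 * n + 1)) x₀ x)
      (dmap (extChartAt (𝓡 (2 * n + 1)) x₀) x v) (dmap (extChartAt (𝓡 (2 * n + 1)) x₀) x w) :=
    funext fun v => funext fun w => OneForm.d_eq_inChart hα hx v w
  rw [h1, h2]
  rfl

omit [IsManifold (𝓡 (2 * n + 1)) ∞ M] in
lemma OneForm.IsSmooth.nondegenerate_of_wedgePower_ne_zero {α : OneForm (𝓡 (2 * n + 1)) M}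
    (hα : α.IsSmooth) {x : M}
    (e : Module.Basis (Fin (2 * n + 1)) ℝ (EuclideanSpace ℝ (Fin (2 * n + 1))))
    (h : wedgePower n (α.val x) (α.dval x) e ≠ 0) :
    Nondegenerate (fun v => α.val x v) (α.dval x) := by
  have hom : ∀ v w, d1Bilin (α.inChart x) (extChartAt (𝓡 (2 * n + 1)) x x) v w = α.dval x v w :=
    fun v w => (OneForm.d_eq_d1 hα x v w).symm
  have := ContactBraid.nondegenerate_of_wedgePower_ne_zero (α.val x).toLinearMap
    (d1Bilin (α.inChart x) (extChartAt (𝓡 (2 * n + 1)) x x))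
    (fun v w => d1_antisymm _ _ _ _) e (by simp only [hom]; exact h)
  simp only [hom] at this
  exact this

lemma OneForm.IsSmooth.nondegenerate_of_isPositiveFrame {α : OneForm (𝓡 (2 * n + 1)) M}
    (hα : α.IsSmooth) {o : ManifoldOrientation (2 * n + 1) M} {x : M}
    {e : Fin (2 * n + 1) → EuclideanSpace ℝ (Fin (2 * n + 1))} (he : o.IsPositiveFrame x e)
    (h : wedgePower n (α.val x) (α.dval x) e ≠ 0) :
    Nondegenerate (fun v => α.val x v) (α.dval x) := by
  obtain ⟨b, -, rfl⟩ := he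
  exact hα.nondegenerate_of_wedgePower_ne_zero b h

end ContactNondegenerate

section WedgeSmooth

variable {F V : Type*} [NormedAddCommGroup F] [NormedSpace ℝ F]

lemma contDiffWithinAt_wedgePower {k : WithTop ℕ∞} {m : ℕ} {a : F → V → ℝ} {om : F → V → V → ℝ}
    {s : Set F} {p : F} (ha : ∀ v, ContDiffWithinAt ℝ k (fun p => a p v) s p)
    (hom : ∀ v w, ContDiffWithinAt ℝ k (fun p => om p v w) s p) (v : Fin (2 * m + 1) → V) :
    ContDiffWithinAt ℝ k (fun p => wedgePower m (a p) (om p) v) s p := by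
  unfold wedgePower
  refine contDiffWithinAt_const.mul (ContDiffWithinAt.sum fun σ _ => ?_)
  exact (contDiffWithinAt_const.mul (ha _)).mul (contDiffWithinAt_prod fun i _ => hom _ _)

end WedgeSmooth

/-! ### Paths of 1-forms on [0, 1], with one-sided derivatives at t = 0. -/

section HalfPathCalculus

variable {E : Type*} [NormedAddCommGroup E] [NormedSpace ℝ E]

/-- The exterior derivative in the space directions of a path of 1-forms defined on a set. -/
def spaceDWithin (b : ℝ × E → E →L[ℝ] ℝ) (S : Set (ℝ × E)) (q : ℝ × E) : E →L[ℝ] E →L[ℝ] ℝ :=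
  (fderivWithin ℝ b S q).comp (ContinuousLinearMap.inr ℝ ℝ E) -
    ((fderivWithin ℝ b S q).comp (ContinuousLinearMap.inr ℝ ℝ E)).flip

lemma spaceDWithin_apply (b : ℝ × E → E →L[ℝ] ℝ) (S : Set (ℝ × E)) (q : ℝ × E) (v w : E) :
    spaceDWithin b S q v w = fderivWithin ℝ b S q (0, v) w - fderivWithin ℝ b S q (0, w) v := by
  simp [spaceDWithin]

variable {b : ℝ × E → E →L[ℝ] ℝ} {T : Set E}

lemma uniqueDiffOn_Icc_prod (hT : IsOpen T) : UniqueDiffOn ℝ (Set.Icc (0 : ℝ) 1 ×ˢ T) :=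
  (uniqueDiffOn_Icc zero_lt_one).prod hT.uniqueDiffOn

lemma hasFDerivAt_space_of_within {F : Type*} [NormedAddCommGroup F] [NormedSpace ℝ F]
    {g : ℝ × E → F} {g' : ℝ × E →L[ℝ] F} (hT : IsOpen T) {t : ℝ} (ht : t ∈ Set.Icc (0 : ℝ) 1) {u : E}
    (hu : u ∈ T) (hg : HasFDerivWithinAt g g' (Set.Icc (0 : ℝ) 1 ×ˢ T) (t, u)) :
    HasFDerivAt (fun u => g (t, u)) (g'.comp (ContinuousLinearMap.inr ℝ ℝ E)) u := by
  have h1 : HasFDerivWithinAt (fun u => g (t, u)) (g'.comp (ContinuousLinearMap.inr ℝ ℝ E)) T u :=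
    HasFDerivWithinAt.comp (g := g) (f := fun u => (t, u)) u hg
      (hasFDerivAt_prodMk_right t u).hasFDerivWithinAt (fun z hz => ⟨ht, hz⟩)
  exact h1.hasFDerivAt (hT.mem_nhds hu)

lemma hasDerivWithinAt_time_of_within {F : Type*} [NormedAddCommGroup F] [NormedSpace ℝ F]
    {g : ℝ × E → F} {g' : ℝ × E →L[ℝ] F} {t : ℝ} {u : E}
    (hu : u ∈ T) (hg : HasFDerivWithinAt g g' (Set.Icc (0 : ℝ) 1 ×ˢ T) (t, u)) :
    HasDerivWithinAt (fun t => g (t, u)) (g' (1, 0)) (Set.Icc 0 1) t := by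
  have hline : HasDerivWithinAt (fun t : ℝ => (t, u)) ((1 : ℝ), (0 : E)) (Set.Icc 0 1) t :=
    ((hasDerivAt_id t).prodMk (hasDerivAt_const t u)).hasDerivWithinAt
  exact HasFDerivWithinAt.comp_hasDerivWithinAt (l := g) (f := fun t => (t, u)) t hg hline
    (fun z hz => ⟨hz, hu⟩)

lemma d1_eq_spaceDWithin (hT : IsOpen T) (hb : ContDiffOn ℝ ∞ b (Set.Icc (0 : ℝ) 1 ×ˢ T)) {t : ℝ}
    (ht : t ∈ Set.Icc (0 : ℝ) 1) {u : E} (hu : u ∈ T) (v w : E) :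
    d1 (fun u => b (t, u)) u v w = spaceDWithin b (Set.Icc (0 : ℝ) 1 ×ˢ T) (t, u) v w := by
  have h := hasFDerivAt_space_of_within hT ht hu
    ((hb (t, u) ⟨ht, hu⟩).differentiableWithinAt (by simp)).hasFDerivWithinAt
  rw [d1, h.fderiv, spaceDWithin_apply]
  simp

lemma contDiffOn_fderivWithin_Icc_prod (hT : IsOpen T)
    (hb : ContDiffOn ℝ ∞ b (Set.Icc (0 : ℝ) 1 ×ˢ T)) :
    ContDiffOn ℝ ∞ (fderivWithin ℝ b (Set.Icc (0 : ℝ) 1 ×ˢ T)) (Set.Icc (0 : ℝ) 1 ×ˢ T) :=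
  hb.fderivWithin (uniqueDiffOn_Icc_prod hT) (by simp)

lemma contDiffOn_spaceDWithin (hT : IsOpen T) (hb : ContDiffOn ℝ ∞ b (Set.Icc (0 : ℝ) 1 ×ˢ T))
    (v w : E) : ContDiffOn ℝ ∞ (fun q => spaceDWithin b (Set.Icc (0 : ℝ) 1 ×ˢ T) q v w)
      (Set.Icc (0 : ℝ) 1 ×ˢ T) := by
  have h := contDiffOn_fderivWithin_Icc_prod hT hb
  simp only [spaceDWithin_apply]
  exact ((h.clm_apply contDiffOn_const).clm_apply contDiffOn_const).sub
    ((h.clm_apply contDiffOn_const).clm_apply contDiffOn_const)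

/-- The initial velocity of a path of 1-forms. -/
def initialVelocity (b : ℝ × E → E →L[ℝ] ℝ) (T : Set E) (u : E) : E →L[ℝ] ℝ :=
  fderivWithin ℝ b (Set.Icc (0 : ℝ) 1 ×ˢ T) (0, u) (1, 0)

lemma hasDerivWithinAt_initialVelocity (hb : ContDiffOn ℝ ∞ b (Set.Icc (0 : ℝ) 1 ×ˢ T)) {u : E}
    (hu : u ∈ T) : HasDerivWithinAt (fun t => b (t, u)) (initialVelocity b T u) (Set.Icc 0 1) 0 :=
  hasDerivWithinAt_time_of_within hu
    ((hb (0, u) ⟨by simp, hu⟩).differentiableWithinAt (by simp)).hasFDerivWithinAt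

lemma contDiffOn_initialVelocity (hT : IsOpen T) (hb : ContDiffOn ℝ ∞ b (Set.Icc (0 : ℝ) 1 ×ˢ T)) :
    ContDiffOn ℝ ∞ (initialVelocity b T) T := by
  have h : ContDiffOn ℝ ∞ (fun u => fderivWithin ℝ b (Set.Icc (0 : ℝ) 1 ×ˢ T) ((0 : ℝ), u)) T :=
    ContDiffOn.comp (f := fun u : E => ((0 : ℝ), u)) (contDiffOn_fderivWithin_Icc_prod hT hb)
      (by fun_prop) (fun u hu => ⟨by simp, hu⟩)
  exact h.clm_apply contDiffOn_const

/-- The exterior derivative in space commutes with the time derivative, even at the boundary time 0.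
-/
lemma hasDerivWithinAt_spaceDWithin (hT : IsOpen T)
    (hb : ContDiffOn ℝ ∞ b (Set.Icc (0 : ℝ) 1 ×ˢ T)) {u : E} (hu : u ∈ T) (v w : E) :
    HasDerivWithinAt (fun t => spaceDWithin b (Set.Icc (0 : ℝ) 1 ×ˢ T) (t, u) v w)
      (d1 (initialVelocity b T) u v w) (Set.Icc 0 1) 0 := by
  set S := Set.Icc (0 : ℝ) 1 ×ˢ T with hS
  have h0 : ((0 : ℝ), u) ∈ S := ⟨by simp, hu⟩
  have hG : HasFDerivWithinAt (fderivWithin ℝ b S) (fderivWithin ℝ (fderivWithin ℝ b S) S (0, u))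
      S (0, u) :=
    ((contDiffOn_fderivWithin_Icc_prod hT hb _ h0).differentiableWithinAt
      (by simp)).hasFDerivWithinAt
  set G' := fderivWithin ℝ (fderivWithin ℝ b S) S (0, u) with hG'
  -- A boundary point of [0, 1] × T lies in the closure of the interior, so the second derivative
  -- within the set is still symmetric there.
  have hsymm : ∀ v : E, G' (1, 0) (0, v) = G' (0, v) (1, 0) := fun v => by
    refine (hb _ h0).isSymmSndFDerivWithinAt (by simpa using two_le_infty) (uniqueDiffOn_Icc_prod hT) ?_ h0 _ _
    rw [hS, interior_prod_eq, closure_prod_eq, interior_Icc, hT.interior_eq,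
      closure_Ioo zero_ne_one]
    exact ⟨by simp, subset_closure hu⟩
  have h1 := hasDerivWithinAt_time_of_within (T := T) (t := 0) (g := fderivWithin ℝ b S) hu hG
  have h2 := hasFDerivAt_space_of_within (g := fderivWithin ℝ b S) hT (by simp : (0 : ℝ) ∈ Set.Icc (0 : ℝ) 1) hu hG
  have h3 : HasFDerivAt (initialVelocity b T)
      (((ContinuousLinearMap.apply ℝ (E →L[ℝ] ℝ) ((1 : ℝ), (0 : E))).comp
        (G'.comp (ContinuousLinearMap.inr ℝ ℝ E)))) u :=
    HasFDerivAt.comp (g := ContinuousLinearMap.apply ℝ (E →L[ℝ] ℝ) ((1 : ℝ), (0 : E)))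
      (f := fun u => fderivWithin ℝ b S (0, u)) u (ContinuousLinearMap.hasFDerivAt _) h2
  have h4 : d1 (initialVelocity b T) u v w = G' (1, 0) (0, v) w - G' (1, 0) (0, w) v := by
    rw [d1, h3.fderiv, hsymm, hsymm]
    simp
  have h5 : ∀ v w : E, HasDerivWithinAt (fun t => fderivWithin ℝ b S (t, u) (0, v) w)
      (G' (1, 0) (0, v) w) (Set.Icc 0 1) 0 := fun v w => by
    have := (h1.clm_apply (hasDerivWithinAt_const (0 : ℝ) _ ((0 : ℝ), v))).clm_apply
      (hasDerivWithinAt_const (0 : ℝ) _ w)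
    simpa using this
  rw [h4]
  simp only [spaceDWithin_apply]
  exact (h5 v w).sub (h5 w v)

end HalfPathCalculus

/-! ### Positivity for small positive times. -/

section Positivity

variable {E : Type*} [NormedAddCommGroup E] [NormedSpace ℝ E]

omit [NormedSpace ℝ E] in
lemma eventually_Icc_of_eventually {u₀ : E} {P : ℝ × E → Prop} (h : ∀ᶠ q in 𝓝 ((0 : ℝ), u₀), P q) :
    ∃ t₁ ∈ Set.Ioc (0 : ℝ) 1, ∃ N ∈ 𝓝 u₀, ∀ t ∈ Set.Icc 0 t₁, ∀ u ∈ N, P (t, u) := by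
  rw [nhds_prod_eq] at h
  obtain ⟨p, hp, r, hr, hpr⟩ := Filter.eventually_prod_iff.1 h
  obtain ⟨ε, hε, hpε⟩ := Metric.eventually_nhds_iff.1 hp
  refine ⟨min 1 (ε / 2), ⟨lt_min one_pos (by positivity), min_le_left _ _⟩, {u | r u}, hr,
    fun t ht u hu => hpr (hpε ?_) hu⟩
  rw [Real.dist_eq, sub_zero, abs_of_nonneg ht.1]
  linarith [ht.2.trans (min_le_right _ _)]

/-- A function `V ((t, u), s)` that is positive for `s = 0` and `t > 0`, and does not depend on `s`
for `t = 0`, is positive for small `t > 0` near `u₀` for all `s ∈ [0, 1]` if its value for `t = 0`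
does not vanish or its derivative in `t` at `t = 0` is positive for all `s`. -/
lemma exists_pos_of_initial {V : (ℝ × E) × ℝ → ℝ} {T : Set E} (hT : IsOpen T) {u₀ : E}
    (hu₀ : u₀ ∈ T) (hV : ContDiffOn ℝ ∞ V ((Set.Icc (0 : ℝ) 1 ×ˢ T) ×ˢ Set.univ))
    (h0 : ∀ s, ∀ u ∈ T, V ((0, u), s) = V ((0, u), 0))
    (hpos : ∀ t ∈ Set.Ioc (0 : ℝ) 1, ∀ u ∈ T, 0 < V ((t, u), 0))
    (hcase : V ((0, u₀), 0) ≠ 0 ∨ ∀ s ∈ Set.Icc (0 : ℝ) 1, ∃ D > 0,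
      HasDerivWithinAt (fun t => V ((t, u₀), s)) D (Set.Icc 0 1) 0) :
    ∃ t₁ ∈ Set.Ioc (0 : ℝ) 1, ∃ N ∈ 𝓝 u₀, ∀ s ∈ Set.Icc (0 : ℝ) 1, ∀ t ∈ Set.Ioc 0 t₁, ∀ u ∈ N,
      0 < V ((t, u), s) := by
  set S := (Set.Icc (0 : ℝ) 1 ×ˢ T) ×ˢ (Set.univ : Set ℝ) with hS
  have hcontT : ∀ u ∈ T, ∀ s, ContinuousOn (fun t => V ((t, u), s)) (Set.Icc 0 1) := fun u hu s =>
    hV.continuousOn.comp (by fun_prop) (fun t ht => ⟨⟨ht, hu⟩, trivial⟩)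
  -- The initial value is a limit of positive values. This fixes the sign in the nonvanishing case
  -- and the starting point of the monotonicity argument in the other.
  have hnonneg : ∀ u ∈ T, 0 ≤ V ((0, u), 0) := fun u hu => by
    have h1 : Filter.Tendsto (fun t => V ((t, u), 0)) (𝓝[>] (0 : ℝ)) (𝓝 (V ((0, u), 0))) :=
      ((hcontT u hu 0 0 (by simp)).mono_left (nhdsWithin_mono _ Set.Ioc_subset_Icc_self)).mono_left
        (by rw [nhdsWithin_Ioc_eq_nhdsGT zero_lt_one])
    refine ge_of_tendsto h1 ?_
    filter_upwards [Ioc_mem_nhdsGT (zero_lt_one' ℝ)] with t ht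
    exact (hpos t ht u hu).le
  -- Compactness of [0, 1] makes the neighbourhood of (0, u₀) independent of s.
  have htube : ∀ {G : (ℝ × E) × ℝ → ℝ}, ContinuousOn G S → (∀ s ∈ Set.Icc (0 : ℝ) 1,
      0 < G ((0, u₀), s)) → ∃ t₁ ∈ Set.Ioc (0 : ℝ) 1, ∃ N ∈ 𝓝 u₀, N ⊆ T ∧
        ∀ s ∈ Set.Icc (0 : ℝ) 1, ∀ t ∈ Set.Icc 0 t₁, ∀ u ∈ N, 0 < G ((t, u), s) := by
    intro G hG hG0
    have h1 : ∀ᶠ q in 𝓝 ((0 : ℝ), u₀), ∀ s ∈ Set.Icc (0 : ℝ) 1,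
        (q ∈ Set.Icc (0 : ℝ) 1 ×ˢ T → 0 < G (q, s)) := by
      refine isCompact_Icc.eventually_forall_of_forall_eventually
        (P := fun q s => q ∈ Set.Icc (0 : ℝ) 1 ×ˢ T → 0 < G (q, s)) fun s hs => ?_
      have h2 := (hG ((0, u₀), s) ⟨⟨by simp, hu₀⟩, trivial⟩).eventually (lt_mem_nhds (hG0 s hs))
      rw [eventually_nhdsWithin_iff] at h2
      filter_upwards [h2] with z hz hzS
      exact hz ⟨hzS, trivial⟩
    obtain ⟨t₁, ht₁, N, hN, h⟩ := eventually_Icc_of_eventually h1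
    refine ⟨t₁, ht₁, N ∩ T, Filter.inter_mem hN (hT.mem_nhds hu₀), Set.inter_subset_right,
      fun s hs t ht u hu => h t ht u hu.1 s hs ⟨⟨ht.1, ht.2.trans ht₁.2⟩, hu.2⟩⟩
  rcases hcase with hne | hder
  · obtain ⟨t₁, ht₁, N, hN, -, h⟩ := htube hV.continuousOn fun s _ => by
      rw [h0 s u₀ hu₀]; exact lt_of_le_of_ne (hnonneg u₀ hu₀) hne.symm
    exact ⟨t₁, ht₁, N, hN, fun s hs t ht u hu => h s hs t ⟨ht.1.le, ht.2⟩ u hu⟩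
  · have huniq : UniqueDiffOn ℝ S := (uniqueDiffOn_Icc_prod hT).prod uniqueDiffOn_univ
    have hdV : ∀ t ∈ Set.Icc (0 : ℝ) 1, ∀ u ∈ T, ∀ s, HasDerivWithinAt (fun t => V ((t, u), s))
        (fderivWithin ℝ V S ((t, u), s) ((1, 0), 0)) (Set.Icc 0 1) t := fun t ht u hu s => by
      have h1 : HasFDerivWithinAt V (fderivWithin ℝ V S ((t, u), s)) S ((t, u), s) :=
        ((hV _ ⟨⟨ht, hu⟩, trivial⟩).differentiableWithinAt (by simp)).hasFDerivWithinAt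
      have hline : HasDerivWithinAt (fun t : ℝ => ((t, u), s)) (((1 : ℝ), (0 : E)), (0 : ℝ))
          (Set.Icc 0 1) t :=
        (((hasDerivAt_id t).prodMk (hasDerivAt_const t u)).prodMk
          (hasDerivAt_const t s)).hasDerivWithinAt
      exact HasFDerivWithinAt.comp_hasDerivWithinAt (l := V) (f := fun t => ((t, u), s)) t h1 hline
        (fun z hz => ⟨⟨hz, hu⟩, trivial⟩)
    have hGc : ContinuousOn (fun p => fderivWithin ℝ V S p ((1, 0), 0)) S :=
      (hV.continuousOn_fderivWithin huniq (by simp)).clm_apply continuousOn_const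
    obtain ⟨t₁, ht₁, N, hN, hNT, h⟩ := htube hGc fun s hs => by
      obtain ⟨D, hD, hDV⟩ := hder s hs
      have := (uniqueDiffOn_Icc (zero_lt_one' ℝ) 0 (by simp)).eq_deriv _
        (hdV 0 (by simp) u₀ hu₀ s) hDV
      rw [this]; exact hD
    refine ⟨t₁, ht₁, N, hN, fun s hs t ht u hu => ?_⟩
    have hsub : Set.Icc 0 t₁ ⊆ Set.Icc (0 : ℝ) 1 := Set.Icc_subset_Icc_right ht₁.2
    -- The time derivative stays positive nearby, so V increases strictly from a nonnegative initial
    -- value, also at points u ≠ u₀ where that value may be positive.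
    have hmono : StrictMonoOn (fun t => V ((t, u), s)) (Set.Icc 0 t₁) := by
      refine strictMonoOn_of_deriv_pos (convex_Icc 0 t₁) ((hcontT u (hNT hu) s).mono hsub) ?_
      intro r hr
      rw [interior_Icc] at hr
      have h1 := (hdV r (hsub (Set.Ioo_subset_Icc_self hr)) u (hNT hu) s).hasDerivAt
        (Icc_mem_nhds hr.1 (hr.2.trans_le ht₁.2))
      rw [h1.deriv]
      exact h s hs r (Set.Ioo_subset_Icc_self hr) u hu
    have h2 := hmono ⟨le_rfl, ht₁.1.le⟩ ⟨ht.1.le, ht.2⟩ ht.1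
    simp only at h2
    rw [h0 s u (hNT hu)] at h2
    exact (hnonneg u (hNT hu)).trans_lt h2

end Positivity

/-! ### Initial velocities and convex combinations of paths of forms on a manifold. -/

section Paths

variable {E : Type*} [NormedAddCommGroup E] [NormedSpace ℝ E]
  {M : Type*} [TopologicalSpace M] [ChartedSpace E M]
  {β γ : ℝ → OneForm 𝓘(ℝ, E) M}

lemma IsSmoothPath.isSmooth (hβ : IsSmoothPath β) {t : ℝ} (ht : t ∈ Set.Icc (0 : ℝ) 1) :
    (β t).IsSmooth := fun x₀ =>
  (hβ x₀).comp (f := fun u => (t, u)) (by fun_prop) (fun _ hu => ⟨ht, hu⟩)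

lemma IsSmoothPath.contDiffOn (hβ : IsSmoothPath β) (x₀ : M) :
    ContDiffOn ℝ ∞ (familyInChart β x₀)
      (Set.Icc (0 : ℝ) 1 ×ˢ (extChartAt 𝓘(ℝ, E) x₀).target) := hβ x₀

/-- The convex combination of two 1-forms. -/
def convexForm (α α' : OneForm 𝓘(ℝ, E) M) (s : ℝ) : OneForm 𝓘(ℝ, E) M :=
  fun x => (1 - s) • α x + s • α' x

lemma inChart_convexForm (α α' : OneForm 𝓘(ℝ, E) M) (s : ℝ) (x₀ : M) (u : E) :
    (convexForm α α' s).inChart x₀ u = (1 - s) • α.inChart x₀ u + s • α'.inChart x₀ u :=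
  ContinuousLinearMap.ext fun _ => rfl

lemma OneForm.IsSmooth.convexForm {α α' : OneForm 𝓘(ℝ, E) M} (hα : α.IsSmooth)
    (hα' : α'.IsSmooth) (s : ℝ) : (convexForm α α' s).IsSmooth := fun x₀ => by
  have : (ContactBraid.convexForm α α' s).inChart x₀ = fun u => (1 - s) • α.inChart x₀ u + s • α'.inChart x₀ u :=
    funext fun u => inChart_convexForm α α' s x₀ u
  rw [this]
  exact ((hα x₀).const_smul (1 - s)).add ((hα' x₀).const_smul s)

lemma d1_inChart_convexForm {α α' : OneForm 𝓘(ℝ, E) M} (hα : α.IsSmooth)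
    (hα' : α'.IsSmooth) (s : ℝ) {x₀ : M} {u : E} (hu : u ∈ (extChartAt 𝓘(ℝ, E) x₀).target) (v w : E) :
    d1 ((convexForm α α' s).inChart x₀) u v w =
      (1 - s) * d1 (α.inChart x₀) u v w + s * d1 (α'.inChart x₀) u v w := by
  have : (ContactBraid.convexForm α α' s).inChart x₀ = fun u => (1 - s) • α.inChart x₀ u + s • α'.inChart x₀ u :=
    funext fun u => inChart_convexForm α α' s x₀ u
  have h2 : HasFDerivAt ((ContactBraid.convexForm α α' s).inChart x₀)
      ((1 - s) • fderiv ℝ (α.inChart x₀) u + s • fderiv ℝ (α'.inChart x₀) u) u := by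
    rw [this]
    exact ((hα.differentiableAt hu).hasFDerivAt.const_smul (1 - s)).add
      ((hα'.differentiableAt hu).hasFDerivAt.const_smul s)
  rw [d1, h2.fderiv, d1, d1]
  simp
  ring

lemma dval_convexForm {α α' : OneForm 𝓘(ℝ, E) M} (hα : α.IsSmooth)
    (hα' : α'.IsSmooth) (s : ℝ) (x : M) (v w : E) :
    (convexForm α α' s).dval x v w = (1 - s) * α.dval x v w + s * α'.dval x v w := by
  simp only [OneForm.dval]
  rw [OneForm.d_eq_d1 (hα.convexForm hα' s), OneForm.d_eq_d1 hα, OneForm.d_eq_d1 hα',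
    d1_inChart_convexForm hα hα' s (mem_extChartAt_target x)]

variable [IsManifold 𝓘(ℝ, E) ∞ M]

/-- `η` is the initial velocity of the path `β` of 1-forms. -/
def IsInitialVelocity (β : ℝ → OneForm 𝓘(ℝ, E) M) (η : OneForm 𝓘(ℝ, E) M) : Prop :=
  ∀ x (v : E), HasDerivWithinAt (fun t => (β t).val x v) (η.val x v) (Set.Icc 0 1) 0

variable {η : OneForm 𝓘(ℝ, E) M}

omit [IsManifold 𝓘(ℝ, E) ∞ M] in
lemma IsInitialVelocity.inChart_eq (hη : IsInitialVelocity β η) (hβ : IsSmoothPath β) {x₀ : M}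
    {u : E} (hu : u ∈ (extChartAt 𝓘(ℝ, E) x₀).target) :
    η.inChart x₀ u = initialVelocity (familyInChart β x₀) (extChartAt 𝓘(ℝ, E) x₀).target u := by
  refine ContinuousLinearMap.ext fun (v : E) => ?_
  have h1 := hη ((extChartAt 𝓘(ℝ, E) x₀).symm u) (dmap (extChartAt 𝓘(ℝ, E) x₀).symm u v)
  have h2 := (hasDerivWithinAt_initialVelocity (hβ.contDiffOn x₀) hu).clm_apply
    (hasDerivWithinAt_const (0 : ℝ) _ v)
  simp only [map_zero, add_zero] at h2
  exact (uniqueDiffOn_Icc (zero_lt_one' ℝ) 0 (by simp)).eq_deriv _ h1 h2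

-- Only pointwise one-sided derivatives are assumed. Their uniqueness identifies η with the time
-- derivative of the chart expressions, which is smooth.
omit [IsManifold 𝓘(ℝ, E) ∞ M] in
lemma IsInitialVelocity.isSmooth (hη : IsInitialVelocity β η) (hβ : IsSmoothPath β) :
    η.IsSmooth := fun x₀ =>
  (contDiffOn_initialVelocity (isOpen_extChartAt_target x₀) (hβ.contDiffOn x₀)).congr
    fun _ hu => hη.inChart_eq hβ hu

omit [IsManifold 𝓘(ℝ, E) ∞ M] in
lemma IsInitialVelocity.hasDerivWithinAt_dval (hη : IsInitialVelocity β η) (hβ : IsSmoothPath β)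
    (x : M) (v w : E) :
    HasDerivWithinAt (fun t => (β t).dval x v w) (η.dval x v w) (Set.Icc 0 1) 0 := by
  have hT := isOpen_extChartAt_target (I := 𝓘(ℝ, E)) x
  have hu := mem_extChartAt_target (I := 𝓘(ℝ, E)) x
  have h1 := hasDerivWithinAt_spaceDWithin hT (hβ.contDiffOn x) hu v w
  have h2 : η.dval x v w = d1 (initialVelocity (familyInChart β x) (extChartAt 𝓘(ℝ, E) x).target)
      (extChartAt 𝓘(ℝ, E) x x) v w := by
    rw [OneForm.dval, OneForm.d_eq_d1 (hη.isSmooth hβ)]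
    refine Filter.EventuallyEq.d1_eq ?_ v w
    filter_upwards [hT.mem_nhds hu] with u hu
    exact hη.inChart_eq hβ hu
  have h3 : ∀ t ∈ Set.Icc (0 : ℝ) 1, (β t).dval x v w = spaceDWithin (familyInChart β x)
      (Set.Icc (0 : ℝ) 1 ×ˢ (extChartAt 𝓘(ℝ, E) x).target) (t, extChartAt 𝓘(ℝ, E) x x) v w :=
    fun t ht => by
      rw [OneForm.dval, OneForm.d_eq_d1 (hβ.isSmooth ht), ← d1_eq_spaceDWithin hT (hβ.contDiffOn x) ht hu]
      rfl
  rw [h2]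
  exact h1.congr h3 (h3 0 (by simp))

end Paths

/-! ### Nondegeneracy of the convex combinations near a point. -/

section LocalPositivity

variable {n : ℕ} {M : Type*} [TopologicalSpace M]
  [ChartedSpace (EuclideanSpace ℝ (Fin (2 * n + 1))) M] [IsManifold (𝓡 (2 * n + 1)) ∞ M]
  {β γ : ℝ → OneForm (𝓡 (2 * n + 1)) M}

local notation "𝔼" => EuclideanSpace ℝ (Fin (2 * n + 1))

/-- The volume of a frame with constant expression in a chart with respect to the convex
combinations of two paths of 1-forms. -/
def pathVolume (β γ : ℝ → OneForm (𝓡 (2 * n + 1)) M) (x₀ : M) (e : Fin (2 * n + 1) → 𝔼)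
    (p : (ℝ × 𝔼) × ℝ) : ℝ :=
  wedgePower n
    (fun v => (1 - p.2) * familyInChart β x₀ p.1 v + p.2 * familyInChart γ x₀ p.1 v)
    (fun v w => (1 - p.2) * spaceDWithin (familyInChart β x₀)
        (Set.Icc (0 : ℝ) 1 ×ˢ (extChartAt (𝓡 (2 * n + 1)) x₀).target) p.1 v w +
      p.2 * spaceDWithin (familyInChart γ x₀)
        (Set.Icc (0 : ℝ) 1 ×ˢ (extChartAt (𝓡 (2 * n + 1)) x₀).target) p.1 v w) e

omit [IsManifold (𝓡 (2 * n + 1)) ∞ M] in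
lemma contDiffOn_pathVolume (hβ : IsSmoothPath β) (hγ : IsSmoothPath γ) (x₀ : M)
    (e : Fin (2 * n + 1) → 𝔼) : ContDiffOn ℝ ∞ (pathVolume β γ x₀ e)
      ((Set.Icc (0 : ℝ) 1 ×ˢ (extChartAt (𝓡 (2 * n + 1)) x₀).target) ×ˢ Set.univ) := by
  have hT := isOpen_extChartAt_target (I := 𝓡 (2 * n + 1)) x₀
  set S := Set.Icc (0 : ℝ) 1 ×ˢ (extChartAt (𝓡 (2 * n + 1)) x₀).target with hS
  have hfst : ∀ {g : ℝ × 𝔼 → ℝ}, ContDiffOn ℝ ∞ g S →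
      ContDiffOn ℝ ∞ (fun p : (ℝ × 𝔼) × ℝ => g p.1) (S ×ˢ Set.univ) := fun hg =>
    hg.comp contDiffOn_fst (fun p hp => hp.1)
  have h1 : ContDiffOn ℝ ∞ (fun p : (ℝ × 𝔼) × ℝ => 1 - p.2) (S ×ˢ Set.univ) := by fun_prop
  have h2 : ContDiffOn ℝ ∞ (fun p : (ℝ × 𝔼) × ℝ => p.2) (S ×ˢ Set.univ) := by fun_prop
  intro p hp
  refine contDiffWithinAt_wedgePower (fun v => ?_) (fun v w => ?_) e
  · exact ((h1.mul (hfst ((hβ.contDiffOn x₀).clm_apply contDiffOn_const))).add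
      (h2.mul (hfst ((hγ.contDiffOn x₀).clm_apply contDiffOn_const)))) p hp
  · exact ((h1.mul (hfst (contDiffOn_spaceDWithin hT (hβ.contDiffOn x₀) v w))).add
      (h2.mul (hfst (contDiffOn_spaceDWithin hT (hγ.contDiffOn x₀) v w)))) p hp

lemma wedgePower_convexForm (hβ : IsSmoothPath β) (hγ : IsSmoothPath γ) {x₀ x : M}
    (hx : x ∈ (extChartAt (𝓡 (2 * n + 1)) x₀).source) {t : ℝ} (ht : t ∈ Set.Icc (0 : ℝ) 1) (s : ℝ)
    {e e' : Fin (2 * n + 1) → 𝔼} (he : ∀ i, dmap (extChartAt (𝓡 (2 * n + 1)) x₀) x (e' i) = e i) :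
    wedgePower n ((convexForm (β t) (γ t) s).val x) ((convexForm (β t) (γ t) s).dval x) e' =
      pathVolume β γ x₀ e ((t, extChartAt (𝓡 (2 * n + 1)) x₀ x), s) := by
  have hT := isOpen_extChartAt_target (I := 𝓡 (2 * n + 1)) x₀
  have hu := (extChartAt (𝓡 (2 * n + 1)) x₀).map_source hx
  have hb := hβ.isSmooth ht
  have hg := hγ.isSmooth ht
  rw [(hb.convexForm hg s).wedgePower_eq_inChart hx, funext he, pathVolume]
  congr 1
  funext v w
  rw [d1_inChart_convexForm hb hg s hu, ← d1_eq_spaceDWithin hT (hβ.contDiffOn x₀) ht hu,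
    ← d1_eq_spaceDWithin hT (hγ.contDiffOn x₀) ht hu]
  rfl

/-- `exists_pos_of_initial` is applied to the volume of a frame that is constant in a chart. At s =
0 the volume is that of the contact forms β t, hence positive for t > 0. At t = 0 the paths agree,
so s does not matter. -/
lemma exists_nondegenerate_near {oM : ManifoldOrientation (2 * n + 1) M}
    (hβ : IsSmoothPath β) (hγ : IsSmoothPath γ) (h0 : β 0 = γ 0)
    (hc : ∀ t ∈ Set.Ioc (0 : ℝ) 1, IsContactForm oM (β t)) {x₀ : M} {e : Fin (2 * n + 1) → 𝔼}
    (he : oM.IsPositiveFrame x₀ e)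
    (hcase : wedgePower n ((β 0).val x₀) ((β 0).dval x₀) e ≠ 0 ∨
      ∀ s ∈ Set.Icc (0 : ℝ) 1, ∃ D > 0, HasDerivWithinAt
        (fun t => wedgePower n ((convexForm (β t) (γ t) s).val x₀)
          ((convexForm (β t) (γ t) s).dval x₀) e) D (Set.Icc 0 1) 0) :
    ∃ t₁ ∈ Set.Ioc (0 : ℝ) 1, ∃ N ∈ 𝓝 x₀, ∀ x ∈ N, ∀ s ∈ Set.Icc (0 : ℝ) 1,
      ∀ t ∈ Set.Ioc 0 t₁, Nondegenerate (fun v => (convexForm (β t) (γ t) s).val x v)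
        ((convexForm (β t) (γ t) s).dval x) := by
  set c := extChartAt (𝓡 (2 * n + 1)) x₀ with hcdef
  have hxs : x₀ ∈ c.source := mem_extChartAt_source x₀
  have hut : c x₀ ∈ c.target := mem_extChartAt_target x₀
  have hself : ∀ i, dmap c x₀ (e i) = e i := fun i => by
    rw [hcdef, dmap_extChartAt_self]; rfl
  -- On T the frame with constant chart expression e is positive for the orientation, so positivity
  -- of β t as a contact form transfers to `pathVolume`.
  obtain ⟨T, hTsub, hTo, huT⟩ : ∃ T ⊆ c.target, IsOpen T ∧ c x₀ ∈ T ∧ ∀ u ∈ T,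
      ∃ e' : Fin (2 * n + 1) → 𝔼, oM.IsPositiveFrame (c.symm u) e' ∧
        ∀ i, dmap c (c.symm u) (e' i) = e i := by
    have h1 : ∀ᶠ u in 𝓝 (c x₀), ∃ e' : Fin (2 * n + 1) → 𝔼, oM.IsPositiveFrame (c.symm u) e' ∧
        ∀ i, dmap c (c.symm u) (e' i) = e i := by
      have hcont : Filter.Tendsto c.symm (𝓝 (c x₀)) (𝓝 x₀) := by
        have := continuousAt_extChartAt_symm (I := 𝓡 (2 * n + 1)) x₀
        rwa [ContinuousAt, extChartAt_to_inv] at this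
      filter_upwards [hcont.eventually (oM.eventually_exists_isPositiveFrame x₀)] with u hu
      exact hu e he
    obtain ⟨T, hT, hTo, huT⟩ := eventually_nhds_iff.1 (h1.and (extChartAt_target_mem_nhds x₀))
    exact ⟨T, fun u hu => (hT u hu).2, hTo, huT, fun u hu => (hT u hu).1⟩
  have hsm : ContDiffOn ℝ ∞ (pathVolume β γ x₀ e) ((Set.Icc (0 : ℝ) 1 ×ˢ T) ×ˢ Set.univ) :=
    (contDiffOn_pathVolume hβ hγ x₀ e).mono
      (Set.prod_mono (Set.prod_mono le_rfl hTsub) le_rfl)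
  have hvol : ∀ {u : 𝔼} (hu : u ∈ T) {t : ℝ} (ht : t ∈ Set.Icc (0 : ℝ) 1) (s : ℝ)
      {e' : Fin (2 * n + 1) → 𝔼}, (∀ i, dmap c (c.symm u) (e' i) = e i) →
      wedgePower n ((convexForm (β t) (γ t) s).val (c.symm u))
        ((convexForm (β t) (γ t) s).dval (c.symm u)) e' = pathVolume β γ x₀ e ((t, u), s) := by
    intro u hu t ht s e' he'
    have := wedgePower_convexForm hβ hγ (c.map_target (hTsub hu)) ht s he'
    rwa [← hcdef, c.right_inv (hTsub hu)] at this
  have hconv0 : ∀ t, convexForm (β t) (γ t) 0 = β t := fun t => by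
    funext x; simp [convexForm]
  have hconvs : ∀ s, convexForm (β 0) (γ 0) s = β 0 := fun s => by
    funext x; rw [convexForm, ← h0, ← add_smul]; simp
  obtain ⟨t₁, ht₁, N, hN, hpos⟩ := exists_pos_of_initial hTo huT.1 hsm
    (fun s u hu => by
      obtain ⟨e', -, he'⟩ := huT.2 u hu
      rw [← hvol hu (by simp) s he', ← hvol hu (by simp) 0 he', hconvs, hconvs])
    (fun t ht u hu => by
      obtain ⟨e', hpe', he'⟩ := huT.2 u hu
      rw [← hvol hu ⟨ht.1.le, ht.2⟩ 0 he', hconv0]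
      exact (hc t ht).2 _ _ hpe')
    (by
      have hvol0 : ∀ t ∈ Set.Icc (0 : ℝ) 1, ∀ s : ℝ, wedgePower n
          ((convexForm (β t) (γ t) s).val x₀) ((convexForm (β t) (γ t) s).dval x₀) e =
          pathVolume β γ x₀ e ((t, c x₀), s) := fun t ht s =>
        wedgePower_convexForm hβ hγ hxs ht s hself
      refine hcase.imp (fun h => ?_) (fun h s hs => ?_)
      · rwa [← hvol0 0 (by simp), hconvs]
      · obtain ⟨D, hD, hd⟩ := h s hs
        exact ⟨D, hD, hd.congr (fun t ht => (hvol0 t ht s).symm) (hvol0 0 (by simp) s).symm⟩)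
  refine ⟨t₁, ht₁, c.source ∩ c ⁻¹' (N ∩ T), Filter.inter_mem (extChartAt_source_mem_nhds x₀)
    ((continuousAt_extChartAt x₀).preimage_mem_nhds
      (Filter.inter_mem hN (hTo.mem_nhds huT.1))), ?_⟩
  rintro x ⟨hx, hxN, hxT⟩ s hs t ht
  have ht' : t ∈ Set.Icc (0 : ℝ) 1 := ⟨ht.1.le, ht.2.trans ht₁.2⟩
  have hxx := c.left_inv hx
  have h1 : ∀ y, c.symm (c x) = y → ∃ e' : Fin (2 * n + 1) → 𝔼, oM.IsPositiveFrame y e' ∧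
      ∀ i, dmap c y (e' i) = e i := by
    rintro _ rfl
    exact huT.2 _ hxT
  obtain ⟨e', hpe', he'⟩ := h1 x hxx
  have h2 := hvol hxT ht' s (e' := e') (by simpa only [hxx] using he')
  simp only [hxx] at h2
  refine ((hβ.isSmooth ht').convexForm (hγ.isSmooth ht') s).nondegenerate_of_isPositiveFrame hpe' ?_
  rw [h2]
  exact (hpos s hs t ht _ hxN).ne'

end LocalPositivity

/-! ### Volume growth at ramified points and the uniform range of nondegeneracy. -/

section RamifiedPositivity

variable {n m : ℕ}
  {M : Type*} [TopologicalSpace M] [ChartedSpace (EuclideanSpace ℝ (Fin (2 * n + 1))) M]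
  [IsManifold (𝓡 (2 * n + 1)) ∞ M]
  {Y : Type*} [TopologicalSpace Y] [ChartedSpace (EuclideanSpace ℝ (Fin (2 * n + 1))) Y]
  [IsManifold (𝓡 (2 * n + 1)) ∞ Y]
  {B : Type*} [TopologicalSpace B] [ChartedSpace (EuclideanSpace ℝ (Fin (2 * m + 1))) B]
  [IsManifold (𝓡 (2 * m + 1)) ∞ B]

lemma wedgePower_pullback {q : M → Y} (hq : ContMDiff (𝓡 (2 * n + 1)) (𝓡 (2 * n + 1)) ∞ q)
    {α : OneForm (𝓡 (2 * n + 1)) Y} (hα : α.IsSmooth) (k : ℕ) (x : M)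
    (e : Fin (2 * k + 1) → EuclideanSpace ℝ (Fin (2 * n + 1))) :
    wedgePower k ((OneForm.pullback (I := 𝓡 (2 * n + 1)) q α).val x)
      ((OneForm.pullback (I := 𝓡 (2 * n + 1)) q α).dval x) e =
    wedgePower k (α.val (q x)) (α.dval (q x))
      (fun i => dmap (E := EuclideanSpace ℝ (Fin (2 * n + 1)))
        (E' := EuclideanSpace ℝ (Fin (2 * n + 1))) q x (e i)) := by
  have h2 : (OneForm.pullback (I := 𝓡 (2 * n + 1)) q α).dval x =
      fun v w => α.dval (q x) (dmap (E := EuclideanSpace ℝ (Fin (2 * n + 1)))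
        (E' := EuclideanSpace ℝ (Fin (2 * n + 1))) q x v) (dmap q x w) :=
    funext fun v => funext fun w => OneForm.d_pullback hq hα x v w
  rw [h2]
  rfl

lemma IsContactForm.wedgePower_ne_zero {oY : ManifoldOrientation (2 * n + 1) Y}
    {α : OneForm (𝓡 (2 * n + 1)) Y} (hα : IsContactForm oY α) (y : Y)
    (e : Module.Basis (Fin (2 * n + 1)) ℝ (EuclideanSpace ℝ (Fin (2 * n + 1)))) :
    wedgePower n (α.val y) (α.dval y) e ≠ 0 := by
  obtain ⟨v, hv⟩ := oY.exists_isPositiveFrame (by simp) y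
  have hpos := hα.2 y v hv
  obtain ⟨b, -, hb⟩ := hv
  let b' : Module.Basis (Fin (2 * n + 1)) ℝ (EuclideanSpace ℝ (Fin (2 * n + 1))) := b
  have hom : ∀ v w, d1Bilin (α.inChart y) (extChartAt (𝓡 (2 * n + 1)) y y) v w = α.dval y v w :=
    fun v w => (OneForm.d_eq_d1 hα.1 y v w).symm
  have h := wedgePower_ne_zero_of_basis (α.val y).toLinearMap
    (d1Bilin (α.inChart y) (extChartAt (𝓡 (2 * n + 1)) y y)) b' e (by
      simp only [hom]
      have hb' : (b' : Fin (2 * n + 1) → EuclideanSpace ℝ (Fin (2 * n + 1))) = v := hb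
      rw [hb']
      exact hpos.ne')
  simp only [hom] at h
  exact h

/-- Only nonvanishing is claimed: q need not be compared with the orientations, because the sign
comes later from the contact forms β t. -/
lemma wedgePower_pullback_ne_zero {q : M → Y}
    (hq : ContMDiff (𝓡 (2 * n + 1)) (𝓡 (2 * n + 1)) ∞ q)
    {oY : ManifoldOrientation (2 * n + 1) Y} {α : OneForm (𝓡 (2 * n + 1)) Y}
    (hα : IsContactForm oY α) {x : M}
    (hx : Function.Bijective (dmap (E := EuclideanSpace ℝ (Fin (2 * n + 1)))
        (E' := EuclideanSpace ℝ (Fin (2 * n + 1))) q x))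
    {oM : ManifoldOrientation (2 * n + 1) M}
    {e : Fin (2 * n + 1) → EuclideanSpace ℝ (Fin (2 * n + 1))} (he : oM.IsPositiveFrame x e) :
    wedgePower n ((OneForm.pullback (I := 𝓡 (2 * n + 1)) q α).val x)
      ((OneForm.pullback (I := 𝓡 (2 * n + 1)) q α).dval x) e ≠ 0 := by
  obtain ⟨b, -, rfl⟩ := he
  let b' : Module.Basis (Fin (2 * n + 1)) ℝ (EuclideanSpace ℝ (Fin (2 * n + 1))) := b
  have h := wedgePower_pullback (k := n) hq hα.1 x b'
  refine fun h0 => ?_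
  refine (?_ : wedgePower n (α.val (q x)) (α.dval (q x)) _ ≠ 0) (h.symm.trans h0)
  exact hα.wedgePower_ne_zero (q x) (b'.map (LinearEquiv.ofBijective
    (dmap (E := EuclideanSpace ℝ (Fin (2 * n + 1)))
        (E' := EuclideanSpace ℝ (Fin (2 * n + 1))) q x).toLinearMap hx))

/-- At a ramified point the volume grows to first order along paths whose initial velocity is
positive on the fibre of the normal bundle of the ramification locus. -/
lemma exists_hasDerivWithinAt_pos {oM : ManifoldOrientation (2 * n + 1) M}
    {oB : ManifoldOrientation (2 * m + 1) B} {ι : B → Y} {q : M → Y}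
    (hq : ContMDiff (𝓡 (2 * n + 1)) (𝓡 (2 * n + 1)) ∞ q)
    (hι : ContMDiff (𝓡 (2 * m + 1)) (𝓡 (2 * n + 1)) ∞ ι)
    {α : OneForm (𝓡 (2 * n + 1)) Y} (hα : α.IsSmooth)
    (hια : IsContactForm oB (OneForm.pullback (I := 𝓡 (2 * m + 1)) ι α))
    {x : M} (hx : ∃ v w, IsPositiveNormalPair oM oB ι q x v w) :
    ∃ e : Fin (2 * n + 1) → EuclideanSpace ℝ (Fin (2 * n + 1)), oM.IsPositiveFrame x e ∧
      ∀ {β : ℝ → OneForm (𝓡 (2 * n + 1)) M} {η : OneForm (𝓡 (2 * n + 1)) M},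
      (∀ t ∈ Set.Icc (0 : ℝ) 1, (β t).IsSmooth) → β 0 = OneForm.pullback q α →
      (∀ v, HasDerivWithinAt (fun t => (β t).val x v) (η.val x v) (Set.Icc 0 1) 0) →
      (∀ v w, HasDerivWithinAt (fun t => (β t).dval x v w) (η.dval x v w) (Set.Icc 0 1) 0) →
      (∀ v w, IsPositiveNormalPair oM oB ι q x v w → 0 < η.d x v w) →
      ∃ D > 0, HasDerivWithinAt (fun t => wedgePower n ((β t).val x) ((β t).dval x) e) D
        (Set.Icc 0 1) 0 := by
  obtain ⟨v, w, hvw⟩ := hx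
  have hvw' := hvw
  obtain ⟨hv, hw, h, b, a, u, hb, ha, hu, he⟩ := hvw
  obtain rfl : n = m + 1 := by omega
  set e : Fin (2 * (m + 1) + 1) → EuclideanSpace ℝ (Fin (2 * (m + 1) + 1)) :=
    fun i => Fin.append ![v, w] u (Fin.cast h i) with hedef
  have he0 : e 0 = v := by
    have : Fin.cast h 0 = Fin.castAdd (2 * m + 1) (0 : Fin 2) := Fin.ext rfl
    exact (congrArg (Fin.append (α := EuclideanSpace ℝ (Fin (2 * (m + 1) + 1))) ![v, w] u) this).trans
      (Fin.append_left _ _ _)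
  have he1 : e 1 = w := by
    have : Fin.cast h 1 = Fin.castAdd (2 * m + 1) (1 : Fin 2) :=
      Fin.ext (Nat.mod_eq_of_lt (show 1 < 2 * (m + 1) + 1 by omega))
    exact (congrArg (Fin.append (α := EuclideanSpace ℝ (Fin (2 * (m + 1) + 1))) ![v, w] u) this).trans
      (Fin.append_left _ _ _)
  have heu : (fun k : Fin (2 * m + 1) => e ⟨k + 2, by omega⟩) = u := funext fun k => by
    have : Fin.cast h ⟨k + 2, by omega⟩ = Fin.natAdd 2 k := Fin.ext (Nat.add_comm _ _)
    exact (congrArg (Fin.append (α := EuclideanSpace ℝ (Fin (2 * (m + 1) + 1))) ![v, w] u) this).trans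
      (Fin.append_right _ _ _)
  -- The frame is fixed before the path, since one frame must serve all the convex combinations.
  refine ⟨e, he, fun {β η} hβ hβ0 hη hdη hηx => ?_⟩
  have hpos := hηx v w hvw'
  have h0 : (0 : ℝ) ∈ Set.Icc (0 : ℝ) 1 := by simp
  let om : ℝ → EuclideanSpace ℝ (Fin (2 * (m + 1) + 1)) →ₗ[ℝ]
      EuclideanSpace ℝ (Fin (2 * (m + 1) + 1)) →ₗ[ℝ] ℝ :=
    fun t => d1Bilin ((β t).inChart x) (extChartAt (𝓡 (2 * (m + 1) + 1)) x x)
  have hom : ∀ t ∈ Set.Icc (0 : ℝ) 1, ∀ v w, om t v w = (β t).dval x v w :=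
    fun t ht v w => (OneForm.d_eq_d1 (hβ t ht) x v w).symm
  have hdv : dmap (E := EuclideanSpace ℝ (Fin (2 * (m + 1) + 1)))
      (E' := EuclideanSpace ℝ (Fin (2 * (m + 1) + 1))) q x v = 0 := hv
  have hdw : dmap (E := EuclideanSpace ℝ (Fin (2 * (m + 1) + 1)))
      (E' := EuclideanSpace ℝ (Fin (2 * (m + 1) + 1))) q x w = 0 := hw
  have hom0 : ∀ v w, om 0 v w = α.dval (q x) (dmap q x v) (dmap q x w) := fun v w => by
    rw [hom 0 h0, hβ0]
    exact OneForm.d_pullback hq hα x v w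
  have hαz : ∀ z, α.dval (q x) 0 z = 0 := fun z => by
    rw [OneForm.dval, OneForm.d_eq_d1 hα]; simp [d1]
  have hαz' : ∀ z, α.dval (q x) z 0 = 0 := fun z => by
    rw [OneForm.dval, OneForm.d_eq_d1 hα]; simp [d1]
  have hval0 : ∀ v, (β 0).val x v = α.val (q x) (dmap q x v) := fun v => by
    rw [hβ0]; rfl
  -- The antisymmetry is inherited from that of dβ_t, because smoothness of η is not among the
  -- hypotheses here.
  have hηs : ∀ v w, η.dval x v w = - η.dval x w v := fun v w => by
    refine (uniqueDiffOn_Icc (zero_lt_one' ℝ) 0 (by simp)).eq_deriv _ (hdη v w)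
      ((hdη w v).neg.congr (fun t ht => ?_) ?_)
    · rw [← hom t ht, Pi.neg_apply, ← hom t ht]
      exact d1_antisymm _ _ _ _
    · rw [← hom 0 h0, Pi.neg_apply, ← hom 0 h0]
      exact d1_antisymm _ _ _ _
  -- The vectors v and w lie in ker dq, so q^*α and its differential annihilate them and the first
  -- variation formula applies.
  have hmain := hasDerivWithinAt_wedgePower (m := m) (a := fun t => ((β t).val x).toLinearMap)
    (om := om) (a' := fun v => η.val x v) (ze := η.dval x) (s := Set.Icc (0 : ℝ) 1) (t := 0) e
    (fun v => hη v)
    (fun v w => (hdη v w).congr (fun t ht => hom t ht v w) (hom 0 h0 v w))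
    ((hval0 _).trans (by rw [he0, hdv, map_zero])) ((hval0 _).trans (by rw [he1, hdw, map_zero]))
    (fun z => by rw [hom0, he0, hdv, hαz]) (fun z => by rw [hom0, he0, hdv, hαz'])
    (fun z => by rw [hom0, he1, hdw, hαz]) (fun z => by rw [hom0, he1, hdw, hαz'])
    hηs
  rw [he0, he1, heu] at hmain
  refine ⟨_, ?_, hmain.congr (fun t ht => ?_) ?_⟩
  -- The derivative is (m + 1) dη(v, w) times the volume of α on the images of u. These images are
  -- the images under dι of a positive frame of B, where α restricts to a positive contact form.
  · refine mul_pos (mul_pos (by positivity) hpos) ?_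
    have hW := hια.2 b a ha
    have e1 : wedgePower m ((β 0).val x).toLinearMap (fun v w => om 0 v w) u =
        wedgePower m (α.val (q x)) (α.dval (q x)) (fun i => dmap
          (E := EuclideanSpace ℝ (Fin (2 * (m + 1) + 1)))
          (E' := EuclideanSpace ℝ (Fin (2 * (m + 1) + 1))) q x (u i)) := by
      simp only [hom0]
      have : ⇑((β 0).val x).toLinearMap = fun v => α.val (q x) (dmap q x v) := funext hval0
      rw [this]
      rfl
    have e2 : wedgePower m (OneForm.pullback (I := 𝓡 (2 * m + 1)) ι α b)
        ((OneForm.pullback (I := 𝓡 (2 * m + 1)) ι α).d b) a =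
        wedgePower m (α.val (ι b)) (α.dval (ι b)) (fun i => dmap
          (E := EuclideanSpace ℝ (Fin (2 * m + 1)))
          (E' := EuclideanSpace ℝ (Fin (2 * (m + 1) + 1))) ι b (a i)) := by
      have h2 : (OneForm.pullback (I := 𝓡 (2 * m + 1)) ι α).d b = fun v w => α.dval (ι b)
          (dmap (E := EuclideanSpace ℝ (Fin (2 * m + 1)))
            (E' := EuclideanSpace ℝ (Fin (2 * (m + 1) + 1))) ι b v)
          (dmap (E := EuclideanSpace ℝ (Fin (2 * m + 1)))
            (E' := EuclideanSpace ℝ (Fin (2 * (m + 1) + 1))) ι b w) :=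
        funext fun v => funext fun w => OneForm.d_pullback hι hα b v w
      rw [h2]
      rfl
    rw [e1]
    rw [e2, hb] at hW
    have e3 : (fun i => dmap (E := EuclideanSpace ℝ (Fin (2 * (m + 1) + 1)))
          (E' := EuclideanSpace ℝ (Fin (2 * (m + 1) + 1))) q x (u i)) = fun i => dmap
          (E := EuclideanSpace ℝ (Fin (2 * m + 1)))
          (E' := EuclideanSpace ℝ (Fin (2 * (m + 1) + 1))) ι b (a i) := funext hu
    rw [e3]
    exact hW
  · have : (β t).dval x = fun v w => om t v w := funext fun v => funext fun w => (hom t ht v w).symm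
    rw [this]
    rfl
  · have : (β 0).dval x = fun v w => om 0 v w := funext fun v => funext fun w => (hom 0 h0 v w).symm
    rw [this]
    rfl

/-- Away from R the form q^*α is already nondegenerate. On R the volume grows to first order, since
a convex combination of positive initial velocities is positive. Compactness of M gives a common t₁.
-/
theorem exists_nondegenerate_range [CompactSpace M] {oM : ManifoldOrientation (2 * n + 1) M}
    {oY : ManifoldOrientation (2 * n + 1) Y}
    {oB : ManifoldOrientation (2 * m + 1) B} {ι : B → Y} {q : M → Y}
    (hq : ContMDiff (𝓡 (2 * n + 1)) (𝓡 (2 * n + 1)) ∞ q)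
    (hι : ContMDiff (𝓡 (2 * m + 1)) (𝓡 (2 * n + 1)) ∞ ι)
    {α : OneForm (𝓡 (2 * n + 1)) Y} (hα : IsContactForm oY α)
    (hια : IsContactForm oB (OneForm.pullback (I := 𝓡 (2 * m + 1)) ι α))
    {R : Set M} (hreg : ∀ x ∉ R, Function.Bijective (dmap (E := EuclideanSpace ℝ (Fin (2 * n + 1)))
        (E' := EuclideanSpace ℝ (Fin (2 * n + 1))) q x))
    (hram : ∀ x ∈ R, ∃ v w, IsPositiveNormalPair oM oB ι q x v w)
    {β γ : ℝ → OneForm (𝓡 (2 * n + 1)) M} {η κ : OneForm (𝓡 (2 * n + 1)) M}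
    (hβ : IsSmoothPath β) (hγ : IsSmoothPath γ)
    (hβ0 : β 0 = OneForm.pullback q α) (hγ0 : γ 0 = OneForm.pullback q α)
    (hβc : ∀ t ∈ Set.Ioc (0 : ℝ) 1, IsContactForm oM (β t))
    (hη : IsInitialVelocity β η) (hκ : IsInitialVelocity γ κ)
    (hηpos : ∀ x ∈ R, ∀ v w, IsPositiveNormalPair oM oB ι q x v w → 0 < η.d x v w)
    (hκpos : ∀ x ∈ R, ∀ v w, IsPositiveNormalPair oM oB ι q x v w → 0 < κ.d x v w) :
    ∃ t₁ ∈ Set.Ioc (0 : ℝ) 1, ∀ s ∈ Set.Icc (0 : ℝ) 1, ∀ t ∈ Set.Ioc 0 t₁,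
      (convexForm (β t) (γ t) s).IsNondegenerate := by
  have hloc : ∀ x₀ : M, ∃ t₁ ∈ Set.Ioc (0 : ℝ) 1, ∃ N ∈ 𝓝 x₀, ∀ x ∈ N, ∀ s ∈ Set.Icc (0 : ℝ) 1,
      ∀ t ∈ Set.Ioc 0 t₁, Nondegenerate (fun v => (convexForm (β t) (γ t) s).val x v)
        ((convexForm (β t) (γ t) s).dval x) := by
    intro x₀
    have h00 : β 0 = γ 0 := hβ0.trans hγ0.symm
    by_cases hx : x₀ ∈ R
    · obtain ⟨e, he, hder⟩ := exists_hasDerivWithinAt_pos hq hι hα.1 hια (hram x₀ hx)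
      refine exists_nondegenerate_near hβ hγ h00 hβc he (Or.inr fun s hs => ?_)
      · refine hder (η := convexForm η κ s)
          (fun t ht => (hβ.isSmooth ht).convexForm (hγ.isSmooth ht) s) ?_ ?_ ?_ ?_
        · funext x
          rw [convexForm, ← h00, ← add_smul, ← hβ0]
          simp
        · exact fun v => ((hη x₀ v).const_mul (1 - s)).add ((hκ x₀ v).const_mul s)
        · intro v w
          rw [dval_convexForm (hη.isSmooth hβ) (hκ.isSmooth hγ)]
          refine (((hη.hasDerivWithinAt_dval hβ x₀ v w).const_mul (1 - s)).add
            ((hκ.hasDerivWithinAt_dval hγ x₀ v w).const_mul s)).congr (fun t ht => ?_) ?_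
          · exact dval_convexForm (hβ.isSmooth ht) (hγ.isSmooth ht) s x₀ v w
          · exact dval_convexForm (hβ.isSmooth (by simp)) (hγ.isSmooth (by simp)) s x₀ v w
        · intro v w hvw
          have h1 := hηpos x₀ hx v w hvw
          have h2 := hκpos x₀ hx v w hvw
          have h3 := dval_convexForm (hη.isSmooth hβ) (hκ.isSmooth hγ) s x₀ v w
          change 0 < (convexForm η κ s).dval x₀ v w
          rw [h3]
          change 0 < η.dval x₀ v w at h1
          change 0 < κ.dval x₀ v w at h2
          rcases eq_or_lt_of_le hs.1 with h0 | h0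
          · rw [← h0]; simpa using h1
          · exact add_pos_of_nonneg_of_pos (mul_nonneg (by linarith [hs.2]) h1.le) (mul_pos h0 h2)
    · obtain ⟨e, he⟩ := oM.exists_isPositiveFrame (by simp) x₀
      refine exists_nondegenerate_near hβ hγ h00 hβc he (Or.inl ?_)
      rw [hβ0]
      exact wedgePower_pullback_ne_zero hq hα (hreg x₀ hx) he
  choose t₁ ht₁ N hN h using hloc
  obtain ⟨F, hF⟩ := isCompact_univ.elim_nhds_subcover N (fun x _ => hN x)
  have hFne : ∀ x : M, ∃ y ∈ F, x ∈ N y := fun x => by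
    have := hF.2 (Set.mem_univ x)
    simpa using this
  -- Inserting 1 keeps the finite set nonempty even when M is empty.
  refine ⟨(insert 1 (F.image t₁)).min' (Finset.insert_nonempty _ _), ⟨?_, ?_⟩, ?_⟩
  · rw [Finset.lt_min'_iff]
    intro y hy
    rcases Finset.mem_insert.1 hy with rfl | hy
    · exact one_pos
    · obtain ⟨x, -, rfl⟩ := Finset.mem_image.1 hy
      exact (ht₁ x).1
  · exact Finset.min'_le _ _ (Finset.mem_insert_self _ _)
  · intro s hs t ht x
    obtain ⟨y, hy, hxy⟩ := hFne x
    exact h y x hxy s hs t ⟨ht.1, ht.2.trans (Finset.min'_le _ _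
      (Finset.mem_insert_of_mem (Finset.mem_image_of_mem _ hy)))⟩

end RamifiedPositivity

/-! ### The form r² dθ on ℂ. -/

section RSqDTheta

/-- The form `r² dθ` as a linear map into the dual space. -/
def rSqDThetaCLM : ℂ →L[ℝ] ℂ →L[ℝ] ℝ :=
  (ContinuousLinearMap.compL ℝ ℂ ℂ ℝ Complex.imCLM).comp
    ((ContinuousLinearMap.mul ℝ ℂ).comp Complex.conjCLE.toContinuousLinearMap)

lemma inChart_rSqDTheta (z₀ : ℂ) : rSqDTheta.inChart z₀ = rSqDThetaCLM := by
  funext z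
  refine ContinuousLinearMap.ext fun (w : ℂ) => ?_
  have h1 : (extChartAt 𝓘(ℝ, ℂ) z₀).symm = (id : ℂ → ℂ) := by
    rfl
  have h2 : rSqDTheta.inChart z₀ z = (rSqDTheta z).comp (mfderiv 𝓘(ℝ, ℂ) 𝓘(ℝ, ℂ) (id : ℂ → ℂ) z) := by
    rw [OneForm.inChart, h1]; rfl
  rw [h2, mfderiv_id]
  rfl

lemma isSmooth_rSqDTheta : rSqDTheta.IsSmooth := fun z₀ => by
  rw [inChart_rSqDTheta]
  exact rSqDThetaCLM.contDiff.contDiffOn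

/-- This is d(x dy - y dx) = 2 dx ∧ dy, with the area form written as Im(v̄ w). -/
lemma d_rSqDTheta (z v w : ℂ) : rSqDTheta.d z v w = 2 * (starRingEnd ℂ v * w).im := by
  rw [OneForm.d_eq_d1 isSmooth_rSqDTheta, inChart_rSqDTheta, d1, ContinuousLinearMap.fderiv]
  change (starRingEnd ℂ v * w).im - (starRingEnd ℂ w * v).im = _
  simp [Complex.mul_im]
  ring

end RSqDTheta

/-! ### The linear path and the family joining the given form to it. -/

section LinearPath

variable {E : Type*} [NormedAddCommGroup E] [NormedSpace ℝ E]
  {M : Type*} [TopologicalSpace M] [ChartedSpace E M]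

/-- The path `ϖ + t κ` of 1-forms. -/
def linearPath (ϖ κ : OneForm 𝓘(ℝ, E) M) (t : ℝ) : OneForm 𝓘(ℝ, E) M := fun x => ϖ x + t • κ x

lemma linearPath_zero (ϖ κ : OneForm 𝓘(ℝ, E) M) : linearPath ϖ κ 0 = ϖ := by
  funext x; simp [linearPath]

lemma isSmoothPath_linearPath {ϖ κ : OneForm 𝓘(ℝ, E) M} (hϖ : ϖ.IsSmooth) (hκ : κ.IsSmooth) :
    IsSmoothPath (linearPath ϖ κ) := fun x₀ => by
  have h1 : (fun q : ℝ × E => (linearPath ϖ κ q.1).inChart x₀ q.2) =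
      fun q => ϖ.inChart x₀ q.2 + q.1 • κ.inChart x₀ q.2 :=
    funext fun q => ContinuousLinearMap.ext fun _ => rfl
  rw [h1]
  have h2 : ∀ {g : E → E →L[ℝ] ℝ}, ContDiffOn ℝ ∞ g (extChartAt 𝓘(ℝ, E) x₀).target →
      ContDiffOn ℝ ∞ (fun q : ℝ × E => g q.2)
        (Set.Icc (0 : ℝ) 1 ×ˢ (extChartAt 𝓘(ℝ, E) x₀).target) := fun hg =>
    hg.comp contDiffOn_snd (fun q hq => hq.2)
  exact (h2 (hϖ x₀)).add (contDiffOn_fst.smul (h2 (hκ x₀)))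

lemma isInitialVelocity_linearPath (ϖ κ : OneForm 𝓘(ℝ, E) M) :
    IsInitialVelocity (linearPath ϖ κ) κ := fun x v => by
  have h : HasDerivAt (fun t : ℝ => ϖ.val x v + t * κ.val x v) (κ.val x v) 0 := by
    simpa using ((hasDerivAt_id (0 : ℝ)).mul_const (κ.val x v)).const_add (ϖ.val x v)
  exact h.hasDerivWithinAt

end LinearPath

section Concatenation

variable {E : Type*} [NormedAddCommGroup E] [NormedSpace ℝ E]
  {M : Type*} [TopologicalSpace M] [ChartedSpace E M]

/-- The family that runs along `β` from `β 1` to `β t₁` and then along the convex combinations of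
`β t₁` and `γ t₁`. -/
def concatFamily (β γ : ℝ → OneForm 𝓘(ℝ, E) M) (t₁ τ : ℝ) : OneForm 𝓘(ℝ, E) M :=
  convexForm (β (1 - (1 - t₁) * Real.smoothTransition (2 * τ)))
    (γ (1 - (1 - t₁) * Real.smoothTransition (2 * τ))) (Real.smoothTransition (2 * τ - 1))

variable {β γ : ℝ → OneForm 𝓘(ℝ, E) M} {t₁ : ℝ}

lemma concatFamily_of_nonpos {τ : ℝ} (hτ : τ ≤ 0) : concatFamily β γ t₁ τ = β 1 := by
  rw [concatFamily, Real.smoothTransition.zero_of_nonpos (by linarith),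
    Real.smoothTransition.zero_of_nonpos (by linarith)]
  funext x
  simp [convexForm]

lemma concatFamily_of_one_le {τ : ℝ} (hτ : 1 ≤ τ) : concatFamily β γ t₁ τ = γ t₁ := by
  rw [concatFamily, Real.smoothTransition.one_of_one_le (by linarith),
    Real.smoothTransition.one_of_one_le (by linarith)]
  funext x
  simp [convexForm]

/-- Staying in (0, 1] lets one-sided smoothness of the paths give a family smooth for all real τ. It
also avoids t = 0, where the form degenerates at ramified points. -/
lemma concatFamily_param_mem (ht₁ : t₁ ∈ Set.Ioc (0 : ℝ) 1) (τ : ℝ) :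
    1 - (1 - t₁) * Real.smoothTransition (2 * τ) ∈ Set.Ioc (0 : ℝ) 1 := by
  have h0 := Real.smoothTransition.nonneg (2 * τ)
  have h1 := Real.smoothTransition.le_one (2 * τ)
  constructor <;> nlinarith [ht₁.1, ht₁.2]

lemma isSmoothFamily_concatFamily (hβ : IsSmoothPath β) (hγ : IsSmoothPath γ)
    (ht₁ : t₁ ∈ Set.Ioc (0 : ℝ) 1) : IsSmoothFamily (concatFamily β γ t₁) := fun x₀ => by
  set T := (extChartAt 𝓘(ℝ, E) x₀).target with hT
  have hst : ∀ {g : ℝ → ℝ}, ContDiff ℝ ∞ g →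
      ContDiffOn ℝ ∞ (fun q : ℝ × E => Real.smoothTransition (g q.1)) (Set.univ ×ˢ T) := fun hg =>
    (Real.smoothTransition.contDiff.comp (hg.comp contDiff_fst)).contDiffOn
  have ht : ContDiffOn ℝ ∞ (fun q : ℝ × E => (1 - (1 - t₁) * Real.smoothTransition (2 * q.1), q.2))
      (Set.univ ×ˢ T) :=
    (contDiffOn_const.sub (contDiffOn_const.mul
      (hst (g := fun τ => 2 * τ) (by fun_prop)))).prodMk contDiffOn_snd
  have hmaps : Set.MapsTo
      (fun q : ℝ × E => (1 - (1 - t₁) * Real.smoothTransition (2 * q.1), q.2))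
      (Set.univ ×ˢ T) (Set.Icc (0 : ℝ) 1 ×ˢ T) := fun q hq =>
    ⟨Set.Ioc_subset_Icc_self (concatFamily_param_mem ht₁ q.1), hq.2⟩
  have hs := hst (g := fun τ => 2 * τ - 1) (by fun_prop)
  have h1 : (fun q : ℝ × E => (concatFamily β γ t₁ q.1).inChart x₀ q.2) = fun q =>
      (1 - Real.smoothTransition (2 * q.1 - 1)) • familyInChart β x₀
        (1 - (1 - t₁) * Real.smoothTransition (2 * q.1), q.2) +
      Real.smoothTransition (2 * q.1 - 1) • familyInChart γ x₀
        (1 - (1 - t₁) * Real.smoothTransition (2 * q.1), q.2) :=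
    funext fun q => inChart_convexForm _ _ _ _ _
  rw [h1]
  exact ((contDiffOn_const.sub hs).smul ((hβ.contDiffOn x₀).comp ht hmaps)).add
    (hs.smul ((hγ.contDiffOn x₀).comp ht hmaps))

lemma isNondegenerate_concatFamily (ht₁ : t₁ ∈ Set.Ioc (0 : ℝ) 1)
    (hβ : ∀ t ∈ Set.Ioc (0 : ℝ) 1, (β t).IsNondegenerate)
    (hconv : ∀ s ∈ Set.Icc (0 : ℝ) 1, (convexForm (β t₁) (γ t₁) s).IsNondegenerate) (τ : ℝ) :
    (concatFamily β γ t₁ τ).IsNondegenerate := by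
  -- Up to τ = 1/2 the second transition has not begun, so only β is seen. From then on the first is
  -- complete and the parameter stays at t₁.
  rcases le_total (2 * τ) 1 with h | h
  · have : concatFamily β γ t₁ τ = β (1 - (1 - t₁) * Real.smoothTransition (2 * τ)) := by
      rw [concatFamily, Real.smoothTransition.zero_of_nonpos (show 2 * τ - 1 ≤ 0 by linarith)]
      funext x
      simp [convexForm]
    rw [this]
    exact hβ _ (concatFamily_param_mem ht₁ τ)
  · rw [concatFamily, Real.smoothTransition.one_of_one_le h]
    have : 1 - (1 - t₁) * 1 = t₁ := by ring
    rw [this]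
    exact hconv _ ⟨Real.smoothTransition.nonneg _, Real.smoothTransition.le_one _⟩

end Concatenation

section ContactIsotopy

variable {n : ℕ} {M : Type*} [TopologicalSpace M]
  [ChartedSpace (EuclideanSpace ℝ (Fin (2 * n + 1))) M] [IsManifold (𝓡 (2 * n + 1)) ∞ M]

lemma IsContactForm.isNondegenerate {o : ManifoldOrientation (2 * n + 1) M}
    {α : OneForm (𝓡 (2 * n + 1)) M} (hα : IsContactForm o α) : α.IsNondegenerate := fun x => by
  obtain ⟨e, he⟩ := o.exists_isPositiveFrame (by simp) x
  exact hα.1.nondegenerate_of_isPositiveFrame he (hα.2 x e he).ne'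

/-- The pull-back of `r² dθ` along a complex function is positive on a pair of vectors if and only if
the derivative of the function is an oriented isomorphism from their span. -/
lemma d_pullback_rSqDTheta {f : M → ℂ} (hf : ContMDiff (𝓡 (2 * n + 1)) 𝓘(ℝ, ℂ) ∞ f) (x : M)
    (v w : EuclideanSpace ℝ (Fin (2 * n + 1))) :
    (OneForm.pullback (I := 𝓡 (2 * n + 1)) f rSqDTheta).d x v w =
      2 * (starRingEnd ℂ (dmap (E := EuclideanSpace ℝ (Fin (2 * n + 1))) (E' := ℂ) f x v) *
        dmap (E := EuclideanSpace ℝ (Fin (2 * n + 1))) (E' := ℂ) f x w).im := by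
  rw [← d_rSqDTheta (f x)]
  exact OneForm.d_pullback hf isSmooth_rSqDTheta x v w

end ContactIsotopy

/-! ### Immersions: composition with diffeomorphisms and injectivity of the derivative. -/

section Immersions

variable {E H E' H' : Type*} [NormedAddCommGroup E] [NormedSpace ℝ E] [TopologicalSpace H]
  [NormedAddCommGroup E'] [NormedSpace ℝ E'] [TopologicalSpace H']
  {I : ModelWithCorners ℝ E H} {J : ModelWithCorners ℝ E' H'}
  {M : Type*} [TopologicalSpace M] [ChartedSpace H M] [IsManifold I ∞ M]
  {N : Type*} [TopologicalSpace N] [ChartedSpace H' N] [IsManifold J ∞ N]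

lemma comp_diffeomorph_mem_maximalAtlas (D : M ≃ₘ^∞⟮I, I⟯ M) {φ : OpenPartialHomeomorph M H}
    (hφ : φ ∈ IsManifold.maximalAtlas I ∞ M) :
    D.toHomeomorph.toOpenPartialHomeomorph ≫ₕ φ ∈ IsManifold.maximalAtlas I ∞ M := by
  refine OpenPartialHomeomorph.mem_maximalAtlas_of_contMDiffOn (I := I) (n := ∞) _ ?_ ?_
  · exact (contMDiffOn_of_mem_maximalAtlas hφ).comp D.contMDiff.contMDiffOn fun x hx => by
      simpa using hx
  · exact D.symm.contMDiff.comp_contMDiffOn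
      ((contMDiffOn_symm_of_mem_maximalAtlas hφ).mono fun x hx => by simpa using hx)

/-- Transporting the charts by D and D' leaves the local normal form unchanged. -/
lemma IsImmersionAtOfComplement.diffeomorph_comp {F : Type*} [NormedAddCommGroup F]
    [NormedSpace ℝ F] {f : M → N} (D : M ≃ₘ^∞⟮I, I⟯ M) (D' : N ≃ₘ^∞⟮J, J⟯ N) {x : M}
    (h : Manifold.IsImmersionAtOfComplement F I J ∞ f (D x)) :
    Manifold.IsImmersionAtOfComplement F I J ∞ (D' ∘ f ∘ D) x := by
  refine .mk_of_charts h.equiv (D.toHomeomorph.toOpenPartialHomeomorph ≫ₕ h.domChart)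
    (D'.symm.toHomeomorph.toOpenPartialHomeomorph ≫ₕ h.codChart) ?_ ?_
    (comp_diffeomorph_mem_maximalAtlas D h.domChart_mem_maximalAtlas)
    (comp_diffeomorph_mem_maximalAtlas D'.symm h.codChart_mem_maximalAtlas) ?_ ?_
  · simpa using h.mem_domChart_source
  · simpa using h.mem_codChart_source
  · intro y hy
    simpa using h.source_subset_preimage_source (show D y ∈ h.domChart.source by simpa using hy)
  · intro u hu
    have := h.writtenInCharts (show u ∈ (h.domChart.extend I).target by simpa using hu)
    simpa using this

lemma IsSmoothEmbedding.diffeomorph_comp {f : M → N} (D : M ≃ₘ^∞⟮I, I⟯ M)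
    (D' : N ≃ₘ^∞⟮J, J⟯ N) (h : Manifold.IsSmoothEmbedding I J ∞ f) :
    Manifold.IsSmoothEmbedding I J ∞ (D' ∘ f ∘ D) := by
  refine ⟨?_, D'.toHomeomorph.isEmbedding.comp (h.isEmbedding.comp D.toHomeomorph.isEmbedding)⟩
  obtain ⟨F, _, _, hF⟩ := h.isImmersion
  exact ⟨F, _, _, fun x => IsImmersionAtOfComplement.diffeomorph_comp D D' (hF (D x))⟩

omit [IsManifold I ∞ M] in
/-- A chart of the maximal atlas has injective derivative. -/
lemma mfderiv_extend_injective [I.Boundaryless]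
    {φ : OpenPartialHomeomorph M H}
    (hφ : φ ∈ IsManifold.maximalAtlas I ∞ M) {x : M} (hx : x ∈ φ.source) :
    Function.Injective (mfderiv I 𝓘(ℝ, E) (φ.extend I) x) := by
  have h1 : MDifferentiableAt I 𝓘(ℝ, E) (φ.extend I) x :=
    ((OpenPartialHomeomorph.contMDiffOn_extend hφ).contMDiffAt
      (φ.open_source.mem_nhds hx)).mdifferentiableAt (by simp)
  have hx' : φ.extend I x ∈ (φ.extend I).target :=
    (φ.extend I).map_source (by rwa [φ.extend_source])
  have h2 : MDifferentiableAt 𝓘(ℝ, E) I (φ.extend I).symm (φ.extend I x) := by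
    refine ((contMDiffOn_extend_symm hφ).contMDiffAt ?_).mdifferentiableAt (by simp)
    have := (φ.isOpen_extend_target (I := I)).mem_nhds hx'
    rwa [φ.extend_target'] at this
  have h3 : (φ.extend I).symm ∘ φ.extend I =ᶠ[𝓝 x] id := by
    filter_upwards [φ.open_source.mem_nhds hx] with y hy
    exact φ.extend_left_inv hy
  have h4 := (mfderiv_comp x h2 h1).symm.trans (h3.mfderiv_eq.trans mfderiv_id)
  intro v w hvw
  have h5 := fun v => DFunLike.congr_fun h4 v
  have e1 := (h5 v).symm.trans ((congrArg _ hvw).trans (h5 w))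
  exact e1

-- In the normal form u ↦ (u, 0), projection to the first factor composed with f is a chart of M,
-- whose derivative is injective.
omit [IsManifold I ∞ M] [IsManifold J ∞ N] in
lemma IsImmersionAt.mfderiv_injective [I.Boundaryless] {f : M → N} {x : M}
    (h : Manifold.IsImmersionAt I J ∞ f x) : Function.Injective (mfderiv I J f x) := by
  obtain ⟨F, _, _, h⟩ := h
  set r : N → E := fun y => (h.equiv.symm (h.codChart.extend J y)).1 with hr
  have h1 : MDifferentiableAt J 𝓘(ℝ, E) r (f x) := by
    have h1 : MDifferentiableAt J 𝓘(ℝ, E') (h.codChart.extend J) (f x) :=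
      ((OpenPartialHomeomorph.contMDiffOn_extend h.codChart_mem_maximalAtlas).contMDiffAt
        (h.codChart.open_source.mem_nhds h.mem_codChart_source)).mdifferentiableAt (by simp)
    have h2 : ContMDiff 𝓘(ℝ, E') 𝓘(ℝ, E) ∞
      ((ContinuousLinearMap.fst ℝ E F).comp h.equiv.symm.toContinuousLinearMap) :=
        ContinuousLinearMap.contMDiff _
    exact ((h2 _).mdifferentiableAt (by simp)).comp (f x) h1
  have h2 : MDifferentiableAt I J f x := h.contMDiffAt.mdifferentiableAt (by simp)
  have h3 : r ∘ f =ᶠ[𝓝 x] h.domChart.extend I := by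
    filter_upwards [h.domChart.open_source.mem_nhds h.mem_domChart_source] with y hy
    have hy' : y ∈ (h.domChart.extend I).source := by rwa [h.domChart.extend_source]
    have := h.writtenInCharts ((h.domChart.extend I).map_source hy')
    simp only [Function.comp_apply, (h.domChart.extend I).left_inv hy'] at this
    exact (congrArg (fun z => (h.equiv.symm z).1) this).trans
      (congrArg Prod.fst (h.equiv.symm_apply_apply _))
  have h4 := (mfderiv_comp x h1 h2).symm.trans h3.mfderiv_eq
  have h5 := mfderiv_extend_injective h.domChart_mem_maximalAtlas h.mem_domChart_source
  intro v w hvw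
  apply h5
  have h6 := fun v => DFunLike.congr_fun h4 v
  exact (h6 v).symm.trans ((congrArg _ hvw).trans (h6 w))

end Immersions

/-! ### Signs of frames under local diffeomorphisms. -/

section FrameSigns

variable {d : ℕ} {M : Type*} [TopologicalSpace M] [ChartedSpace (EuclideanSpace ℝ (Fin d)) M]
  [IsManifold (𝓡 d) ∞ M] {o : ManifoldOrientation d M} {x : M}
  {v v' : Fin d → EuclideanSpace ℝ (Fin d)}

/-- The orientation of a tangent space, as an orientation of the model space. -/
def ManifoldOrientation.modelAt (o : ManifoldOrientation d M) (x : M) :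
    Orientation ℝ (EuclideanSpace ℝ (Fin d)) (Fin d) := o.at_ x

lemma ManifoldOrientation.isPositiveFrame_iff : o.IsPositiveFrame x v ↔
    ∃ b : Module.Basis (Fin d) ℝ (EuclideanSpace ℝ (Fin d)), b.orientation = o.modelAt x ∧ ⇑b = v :=
  Iff.rfl

/-- A top-degree form changes from one basis to another by the determinant, which is positive
exactly when the orientations agree. The next two lemmas use the same formula. -/
lemma ManifoldOrientation.IsPositiveFrame.alternating_pos (hv : o.IsPositiveFrame x v)
    (hv' : o.IsPositiveFrame x v') (A : EuclideanSpace ℝ (Fin d) [⋀^Fin d]→ₗ[ℝ] ℝ)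
    (h : 0 < A v) : 0 < A v' := by
  obtain ⟨b, hb, rfl⟩ := isPositiveFrame_iff.1 hv
  obtain ⟨b', hb', rfl⟩ := isPositiveFrame_iff.1 hv'
  have h1 : 0 < b.det b' := (b.orientation_eq_iff_det_pos b').1 (hb.trans hb'.symm)
  have h2 : A b' = A b * b.det b' := by
    conv_lhs => rw [A.eq_smul_basis_det b]
    rfl
  rw [h2]
  exact mul_pos h h1

lemma ManifoldOrientation.IsPositiveFrame.of_alternating_pos (hv : o.IsPositiveFrame x v)
    (A : EuclideanSpace ℝ (Fin d) [⋀^Fin d]→ₗ[ℝ] ℝ) (h : 0 < A v) (h' : 0 < A v') :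
    o.IsPositiveFrame x v' := by
  obtain ⟨b, hb, rfl⟩ := isPositiveFrame_iff.1 hv
  have h2 : A v' = A b * b.det v' := by
    conv_lhs => rw [A.eq_smul_basis_det b]
    rfl
  have h3 : 0 < b.det v' := by
    rw [h2] at h'
    exact (pos_iff_pos_of_mul_pos h').1 h
  obtain ⟨hli, hsp⟩ := (Module.Basis.is_basis_iff_det b).2 (isUnit_iff_ne_zero.2 h3.ne')
  refine isPositiveFrame_iff.2 ⟨Module.Basis.mk hli hsp.ge, ?_, Module.Basis.coe_mk _ _⟩
  rw [← hb]
  refine ((b.orientation_eq_iff_det_pos _).2 ?_).symm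
  rwa [Module.Basis.coe_mk]

lemma ManifoldOrientation.IsPositiveFrame.alternating_neg {o' : ManifoldOrientation d M}
    (hv : o.IsPositiveFrame x v) (hv' : o'.IsPositiveFrame x v') (ho : o'.modelAt x = -o.modelAt x)
    (A : EuclideanSpace ℝ (Fin d) [⋀^Fin d]→ₗ[ℝ] ℝ) (h : 0 < A v) : A v' < 0 := by
  obtain ⟨b, hb, rfl⟩ := isPositiveFrame_iff.1 hv
  obtain ⟨b', hb', rfl⟩ := isPositiveFrame_iff.1 hv'
  have h1 : ¬ 0 < b.det b' := fun h1 => by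
    rw [← b.orientation_eq_iff_det_pos b', hb, hb', ho] at h1
    exact Module.Ray.ne_neg_self _ h1
  have h2 : b.det b' ≠ 0 := (b.isUnit_det b').ne_zero
  have h3 : A b' = A b * b.det b' := by
    conv_lhs => rw [A.eq_smul_basis_det b]
    rfl
  rw [h3]
  exact mul_neg_of_pos_of_neg h (lt_of_le_of_ne (not_lt.1 h1) h2)

lemma ManifoldOrientation.IsPositiveFrame.det_ne_zero (hv : o.IsPositiveFrame x v)
    {F : Type*} [AddCommGroup F] [Module ℝ F] (b : Module.Basis (Fin d) ℝ F)
    {L : EuclideanSpace ℝ (Fin d) →ₗ[ℝ] F} (hL : Function.Injective L) :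
    b.det (fun i => L (v i)) ≠ 0 := by
  obtain ⟨b', -, rfl⟩ := isPositiveFrame_iff.1 hv
  have : FiniteDimensional ℝ F := b.finiteDimensional_of_finite
  have hfr : Module.finrank ℝ (EuclideanSpace ℝ (Fin d)) = Module.finrank ℝ F := by
    rw [Module.finrank_eq_card_basis b, finrank_euclideanSpace]
  let e := LinearEquiv.ofInjectiveOfFinrankEq L hL hfr
  have h1 : (fun i => L (b' i)) = ⇑(b'.map e) := by
    rfl
  rw [h1]
  exact (b.isUnit_det _).ne_zero

/-- A map between manifolds of the same dimension that is a local diffeomorphism at a point sends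
nearby positive frames to frames of constant orientation. -/
lemma ManifoldOrientation.exists_sign (o : ManifoldOrientation d M) (hd : d ≠ 0) {x₀ : M}
    {F : Type*} [NormedAddCommGroup F] [NormedSpace ℝ F] (b : Module.Basis (Fin d) ℝ F)
    {τ : M → F} (hτ : ContMDiffAt (𝓡 d) 𝓘(ℝ, F) 1 τ x₀)
    (hinj : Function.Injective (dmap (E := EuclideanSpace ℝ (Fin d)) (E' := F) τ x₀)) :
    ∃ s : ℝ, s ≠ 0 ∧ ∀ᶠ x in 𝓝 x₀, ∀ v : Fin d → EuclideanSpace ℝ (Fin d),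
      o.IsPositiveFrame x v →
        0 < s * b.det (fun i => dmap (E := EuclideanSpace ℝ (Fin d)) (E' := F) τ x (v i)) := by
  have : FiniteDimensional ℝ F := b.finiteDimensional_of_finite
  obtain ⟨v₀, hv₀⟩ : ∃ v₀ : Fin d → EuclideanSpace ℝ (Fin d), o.IsPositiveFrame x₀ v₀ :=
    o.exists_isPositiveFrame hd x₀
  set φ := extChartAt (𝓡 d) x₀ with hφ
  set g : EuclideanSpace ℝ (Fin d) → F := τ ∘ φ.symm with hg
  have hgc : ContDiffAt ℝ 1 g (φ x₀) := by
    have hx : φ.symm (φ x₀) = x₀ := extChartAt_to_inv x₀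
    exact contDiffAt_chartMap (n := 1) (F := τ) (y₀ := τ x₀) (mem_extChartAt_target x₀)
      (by rw [← hφ, hx]; exact hτ) (by rw [← hφ, hx]; exact mem_extChartAt_source _)
  -- D is the determinant of the image under dτ of the frame with constant chart expression v₀. It
  -- is continuous and nonzero at x₀, so its value there serves as the sign s.
  set D : M → ℝ := fun x => b.det (fun i => fderiv ℝ g (φ x) (v₀ i)) with hD
  have hDc : ContinuousAt D x₀ := by
    have h1 : ContinuousAt (fun x => fderiv ℝ g (φ x)) x₀ :=
      ContinuousAt.comp (g := fderiv ℝ g) (hgc.fderiv_right (m := 0) (by simp)).continuousAt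
        (continuousAt_extChartAt x₀)
    simp only [hD, Module.Basis.det_apply]
    refine ContinuousAt.comp (g := Matrix.det) continuous_id.matrix_det.continuousAt ?_
    refine continuousAt_pi.2 fun i => continuousAt_pi.2 fun j => ?_
    simp only [Module.Basis.toMatrix_apply]
    have h2 : Continuous (b.coord i) := LinearMap.continuous_of_finiteDimensional _
    exact ContinuousAt.comp (g := b.coord i) h2.continuousAt (h1.clm_apply continuousAt_const)
  have hchain : ∀ᶠ x in 𝓝 x₀, ∀ w : EuclideanSpace ℝ (Fin d),
      dmap (E := EuclideanSpace ℝ (Fin d)) (E' := F) τ x w = fderiv ℝ g (φ x) (dmap φ x w) := by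
    have h1 : ∀ᶠ x in 𝓝 x₀, ContDiffAt ℝ 1 g (φ x) :=
      (continuousAt_extChartAt x₀).eventually (hgc.eventually (by simp))
    filter_upwards [h1, extChartAt_source_mem_nhds (I := 𝓡 d) x₀] with x hx hxs w
    have h2 : MDifferentiableAt 𝓘(ℝ, EuclideanSpace ℝ (Fin d)) 𝓘(ℝ, F) g (φ x) :=
      (hx.differentiableAt one_ne_zero).mdifferentiableAt
    have h3 : g ∘ φ =ᶠ[𝓝 x] τ := by
      filter_upwards [extChartAt_source_mem_nhds' hxs] with y hy
      simp only [hg, Function.comp, φ.left_inv hy]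
    have h4 := h3.mfderiv_eq.symm.trans (mfderiv_comp x h2 (mdifferentiableAt_extChartAt' hxs))
    rw [mfderiv_eq_fderiv] at h4
    exact DFunLike.congr_fun h4 w
  have hD0 : D x₀ ≠ 0 := by
    have h1 : D x₀ = b.det (fun i =>
        dmap (E := EuclideanSpace ℝ (Fin d)) (E' := F) τ x₀ (v₀ i)) := by
      refine congrArg b.det (funext fun i => ?_)
      rw [hchain.self_of_nhds, hφ, dmap_extChartAt_self]
      rfl
    rw [h1]
    exact hv₀.det_ne_zero b (L := (dmap (E := EuclideanSpace ℝ (Fin d)) (E' := F) τ x₀ :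
      EuclideanSpace ℝ (Fin d) →ₗ[ℝ] F)) hinj
  refine ⟨D x₀, hD0, ?_⟩
  have hpos : ∀ᶠ x in 𝓝 x₀, 0 < D x₀ * D x :=
    (continuousAt_const.mul hDc).eventually (lt_mem_nhds (mul_self_pos.2 hD0))
  filter_upwards [hpos, hchain, o.eventually_exists_isPositiveFrame x₀] with x hx hc hf v hv
  obtain ⟨v', hv', hvv'⟩ := hf v₀ hv₀
  refine hv'.alternating_pos hv (D x₀ • b.det.compLinearMap
    (dmap (E := EuclideanSpace ℝ (Fin d)) (E' := F) τ x : EuclideanSpace ℝ (Fin d) →ₗ[ℝ] F)) ?_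
  have h1 : b.det (fun i => dmap (E := EuclideanSpace ℝ (Fin d)) (E' := F) τ x (v' i)) = D x := by
    simp only [hc, hD]
    congr 1
    funext i
    rw [hφ, hvv']
  exact hx.trans_eq (congrArg (D x₀ * ·) h1.symm)

end FrameSigns

/-! ### A block determinant on ℂ × ℝ^c. -/

section BlockDeterminant

lemma matrix_det_of_toBlocks₂₁ {m n : Type*} [Fintype m] [DecidableEq m] [Fintype n] [DecidableEq n]
    {A : Matrix (m ⊕ n) (m ⊕ n) ℝ} (h : A.toBlocks₂₁ = 0) :
    A.det = A.toBlocks₁₁.det * A.toBlocks₂₂.det := by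
  conv_lhs => rw [← Matrix.fromBlocks_toBlocks A, h, Matrix.det_fromBlocks_zero₂₁]

/-- The standard basis of `ℂ × ℝ^c`. -/
def prodBasis (c : ℕ) {d : ℕ} (h : d = 2 + c) :
    Module.Basis (Fin d) ℝ (ℂ × EuclideanSpace ℝ (Fin c)) :=
  (Complex.basisOneI.prod (EuclideanSpace.basisFun (Fin c) ℝ).toBasis).reindex
    (finSumFinEquiv.trans (finCongr h.symm))

/-- The first two vectors have no component in ℝ^c, so the matrix is block triangular. -/
lemma prodBasis_det_append {c d : ℕ} (h : d = 2 + c) (v w : ℂ)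
    (u : Fin c → ℂ × EuclideanSpace ℝ (Fin c)) :
    (prodBasis c h).det (fun i => Fin.append ![(v, 0), (w, 0)] u (Fin.cast h i)) =
      (starRingEnd ℂ v * w).im *
        (EuclideanSpace.basisFun (Fin c) ℝ).toBasis.det (fun i => (u i).2) := by
  subst h
  rw [prodBasis, Module.Basis.det_reindex]
  rw [Module.Basis.det_apply, Module.Basis.det_apply]
  rw [matrix_det_of_toBlocks₂₁]
  · congr 1
    · rw [Matrix.det_fin_two]
      simp [Matrix.toBlocks₁₁, Module.Basis.toMatrix_apply, Complex.mul_im]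
      ring
    · congr 1
      ext i j
      simp [Matrix.toBlocks₂₂, Module.Basis.toMatrix_apply]
  · ext i j
    fin_cases j <;> simp [Matrix.toBlocks₂₁, Module.Basis.toMatrix_apply]

end BlockDeterminant

/-! ### Chain rules and local injectivity. -/

section Derivatives

variable {E : Type*} [NormedAddCommGroup E] [NormedSpace ℝ E]
  {E' : Type*} [NormedAddCommGroup E'] [NormedSpace ℝ E']
  {E'' : Type*} [NormedAddCommGroup E''] [NormedSpace ℝ E'']
  {M : Type*} [TopologicalSpace M] [ChartedSpace E M]
  {N : Type*} [TopologicalSpace N] [ChartedSpace E' N]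
  {K : Type*} [TopologicalSpace K] [ChartedSpace E'' K]

lemma dmap_comp_of_eq {F : M → N} {G : N → K} {x : M} {y : N} (h : F x = y)
    (hG : MDifferentiableAt 𝓘(ℝ, E') 𝓘(ℝ, E'') G y)
    (hF : MDifferentiableAt 𝓘(ℝ, E) 𝓘(ℝ, E') F x) :
    dmap (E := E) (E' := E'') (G ∘ F) x =
      (dmap (E := E') (E' := E'') G y).comp (dmap (E := E) (E' := E') F x) := by
  subst h
  exact mfderiv_comp x hG hF

lemma dmap_congr {F G : M → N} {x : M} (h : F =ᶠ[𝓝 x] G) :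
    dmap (E := E) (E' := E') F x = dmap (E := E) (E' := E') G x :=
  h.mfderiv_eq

lemma dmap_id (x : M) : dmap (E := E) (E' := E) (id : M → M) x = ContinuousLinearMap.id ℝ E :=
  mfderiv_id

lemma dmap_eq_fderiv {F : E → E'} {x : E} : dmap F x = fderiv ℝ F x := mfderiv_eq_fderiv

/-- A map with injective derivative between manifolds of the same dimension is locally injective. -/
lemma exists_injOn_of_injective_dmap [FiniteDimensional ℝ E] [IsManifold 𝓘(ℝ, E) ∞ M] {τ : M → E}
    {x₀ : M} (hτ : ContMDiffAt 𝓘(ℝ, E) 𝓘(ℝ, E) 1 τ x₀)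
    (hinj : Function.Injective (dmap (E := E) (E' := E) τ x₀)) :
    ∃ V ∈ 𝓝 x₀, Set.InjOn τ V := by
  have : CompleteSpace E := FiniteDimensional.complete ℝ E
  set φ := extChartAt 𝓘(ℝ, E) x₀ with hφ
  set g : E → E := τ ∘ φ.symm with hg
  have hx : φ.symm (φ x₀) = x₀ := extChartAt_to_inv x₀
  have hgc : ContDiffAt ℝ 1 g (φ x₀) :=
    contDiffAt_chartMap (n := 1) (F := τ) (y₀ := τ x₀) (mem_extChartAt_target x₀)
      (by rw [← hφ, hx]; exact hτ) (by rw [← hφ, hx]; exact mem_extChartAt_source _)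
  have hd : dmap (E := E) (E' := E) τ x₀ = fderiv ℝ g (φ x₀) :=
    dmap_eq_fderiv_chartMap (hτ.mdifferentiableAt one_ne_zero)
  let e : E ≃L[ℝ] E := (LinearEquiv.ofInjectiveEndo (fderiv ℝ g (φ x₀) : E →ₗ[ℝ] E)
    (by rw [hd] at hinj; exact hinj)).toContinuousLinearEquiv
  have he : HasStrictFDerivAt g (e : E →L[ℝ] E) (φ x₀) := hgc.hasStrictFDerivAt one_ne_zero
  set P := he.toOpenPartialHomeomorph g
  have hP : P.source ∈ 𝓝 (φ x₀) := P.open_source.mem_nhds he.mem_toOpenPartialHomeomorph_source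
  refine ⟨φ ⁻¹' P.source ∩ φ.source, Filter.inter_mem
    ((continuousAt_extChartAt x₀) hP) (extChartAt_source_mem_nhds x₀), ?_⟩
  rintro y ⟨hy, hys⟩ z ⟨hz, hzs⟩ hyz
  refine φ.injOn hys hzs (P.injOn hy hz ?_)
  change τ (φ.symm (φ y)) = τ (φ.symm (φ z))
  rwa [φ.left_inv hys, φ.left_inv hzs]

end Derivatives

/-! ### The derivative of the model (u, z) ↦ (u, z^k). -/

section BranchModel

variable {d c : ℕ}
  {M : Type*} [TopologicalSpace M] [ChartedSpace (EuclideanSpace ℝ (Fin d)) M]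
  {Y : Type*} [TopologicalSpace Y] [ChartedSpace (EuclideanSpace ℝ (Fin d)) Y]

lemma contMDiffAt_linear_chart (L : EuclideanSpace ℝ (Fin d) ≃L[ℝ] EuclideanSpace ℝ (Fin c) × ℂ)
    {φ : OpenPartialHomeomorph M (EuclideanSpace ℝ (Fin d))}
    (hφ : φ ∈ IsManifold.maximalAtlas (𝓡 d) ∞ M) {x : M} (hx : x ∈ φ.source) :
    ContMDiffAt (𝓡 d) 𝓘(ℝ, EuclideanSpace ℝ (Fin c) × ℂ) ∞ (fun x => L (φ x)) x :=
  ContMDiffAt.comp (g := L) x L.contDiff.contMDiff.contMDiffAt (contMDiffAt_of_mem_maximalAtlas hφ hx)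

lemma dmap_linear_chart_injective
    (L : EuclideanSpace ℝ (Fin d) ≃L[ℝ] EuclideanSpace ℝ (Fin c) × ℂ)
    {φ : OpenPartialHomeomorph M (EuclideanSpace ℝ (Fin d))}
    (hφ : φ ∈ IsManifold.maximalAtlas (𝓡 d) ∞ M) {x : M} (hx : x ∈ φ.source) :
    Function.Injective (dmap (E := EuclideanSpace ℝ (Fin d))
      (E' := EuclideanSpace ℝ (Fin c) × ℂ) (fun x => L (φ x)) x) := by
  have h1 : MDifferentiableAt (𝓡 d) (𝓡 d) φ x :=
    (contMDiffAt_of_mem_maximalAtlas hφ hx).mdifferentiableAt (by simp)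
  have h2 := dmap_comp_of_eq (E := EuclideanSpace ℝ (Fin d)) (E' := EuclideanSpace ℝ (Fin d))
    (F := φ) (G := L) (rfl : φ x = φ x) L.differentiableAt.mdifferentiableAt h1
  rw [dmap_eq_fderiv, L.fderiv] at h2
  have h3 : Function.Injective (dmap (E := EuclideanSpace ℝ (Fin d))
      (E' := EuclideanSpace ℝ (Fin d)) φ x) := mfderiv_extend_injective hφ hx
  intro v w hvw
  change dmap (E := EuclideanSpace ℝ (Fin d)) (E' := EuclideanSpace ℝ (Fin c) × ℂ) (L ∘ φ) x v =
    dmap (E := EuclideanSpace ℝ (Fin d)) (E' := EuclideanSpace ℝ (Fin c) × ℂ) (L ∘ φ) x w at hvw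
  rw [h2] at hvw
  exact h3 (L.injective hvw)

lemma hasFDerivAt_branch_model {k : ℕ} (hk : 2 ≤ k) (u : EuclideanSpace ℝ (Fin c)) :
    HasFDerivAt (fun q : EuclideanSpace ℝ (Fin c) × ℂ => (q.1, q.2 ^ k))
      ((ContinuousLinearMap.fst ℝ (EuclideanSpace ℝ (Fin c)) ℂ).prod 0) (u, 0) := by
  refine hasFDerivAt_fst.prodMk ?_
  have hk' : k - 1 ≠ 0 := by omega
  have h1 : HasFDerivAt (fun z : ℂ => z ^ k) (0 : ℂ →L[ℝ] ℂ) 0 := by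
    have h := (hasDerivAt_pow k (0 : ℂ)).hasFDerivAt.restrictScalars ℝ
    convert! h using 1
    ext
    simp [hk']
  exact (h1.comp (u, (0 : ℂ)) (hasFDerivAt_snd (𝕜 := ℝ) (E := EuclideanSpace ℝ (Fin c)) (F := ℂ)
    (p := (u, 0)))).congr_fderiv (by ext <;> simp)

variable {p : M → Y} {k : ℕ}
  {L : EuclideanSpace ℝ (Fin d) ≃L[ℝ] EuclideanSpace ℝ (Fin c) × ℂ}
  {φ : OpenPartialHomeomorph M (EuclideanSpace ℝ (Fin d))}
  {ψ : OpenPartialHomeomorph Y (EuclideanSpace ℝ (Fin d))}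

/-- Since k ≥ 2, the derivative of z^k vanishes at z = 0, and only the ℝ^c component survives. -/
lemma dmap_branch_model (hp : ContMDiff (𝓡 d) (𝓡 d) ∞ p) (hk : 2 ≤ k)
    (hφ : φ ∈ IsManifold.maximalAtlas (𝓡 d) ∞ M) (hψ : ψ ∈ IsManifold.maximalAtlas (𝓡 d) ∞ Y)
    (hmodel : ∀ u ∈ φ.source, p u ∈ ψ.source ∧ L (ψ (p u)) = ((L (φ u)).1, (L (φ u)).2 ^ k))
    {x : M} (hx : x ∈ φ.source) (hx0 : (L (φ x)).2 = 0) (v : EuclideanSpace ℝ (Fin d)) :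
    dmap (E := EuclideanSpace ℝ (Fin d)) (E' := EuclideanSpace ℝ (Fin c) × ℂ)
      (fun y => L (ψ y)) (p x)
      (dmap (E := EuclideanSpace ℝ (Fin d)) (E' := EuclideanSpace ℝ (Fin d)) p x v) =
    ((dmap (E := EuclideanSpace ℝ (Fin d)) (E' := EuclideanSpace ℝ (Fin c) × ℂ)
      (fun x => L (φ x)) x v).1, 0) := by
  have h1 := dmap_comp_of_eq (E := EuclideanSpace ℝ (Fin d)) (E' := EuclideanSpace ℝ (Fin d))
    (F := p) (G := fun y => L (ψ y)) (rfl : p x = p x)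
    ((contMDiffAt_linear_chart L hψ (hmodel x hx).1).mdifferentiableAt (by simp))
    (hp.contMDiffAt.mdifferentiableAt (by simp))
  have hm := hasFDerivAt_branch_model hk (L (φ x)).1
  have hx' : L (φ x) = ((L (φ x)).1, 0) := Prod.ext rfl hx0
  have h2 := dmap_comp_of_eq (E := EuclideanSpace ℝ (Fin d))
    (E' := EuclideanSpace ℝ (Fin c) × ℂ) (F := fun x => L (φ x))
    (G := fun q : EuclideanSpace ℝ (Fin c) × ℂ => (q.1, q.2 ^ k)) hx'
    hm.differentiableAt.mdifferentiableAt
    ((contMDiffAt_linear_chart L hφ hx).mdifferentiableAt (by simp))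
  have h3 : (fun y => L (ψ y)) ∘ p =ᶠ[𝓝 x]
      (fun q : EuclideanSpace ℝ (Fin c) × ℂ => (q.1, q.2 ^ k)) ∘ fun x => L (φ x) := by
    filter_upwards [φ.open_source.mem_nhds hx] with y hy
    exact (hmodel y hy).2
  rw [dmap_eq_fderiv, hm.fderiv, ← dmap_congr h3, h1] at h2
  exact DFunLike.congr_fun h2 v

lemma dmap_branch_model_eq_zero_iff (hp : ContMDiff (𝓡 d) (𝓡 d) ∞ p) (hk : 2 ≤ k)
    (hφ : φ ∈ IsManifold.maximalAtlas (𝓡 d) ∞ M) (hψ : ψ ∈ IsManifold.maximalAtlas (𝓡 d) ∞ Y)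
    (hmodel : ∀ u ∈ φ.source, p u ∈ ψ.source ∧ L (ψ (p u)) = ((L (φ u)).1, (L (φ u)).2 ^ k))
    {x : M} (hx : x ∈ φ.source) (hx0 : (L (φ x)).2 = 0) (v : EuclideanSpace ℝ (Fin d)) :
    dmap (E := EuclideanSpace ℝ (Fin d)) (E' := EuclideanSpace ℝ (Fin d)) p x v = 0 ↔
    (dmap (E := EuclideanSpace ℝ (Fin d)) (E' := EuclideanSpace ℝ (Fin c) × ℂ)
      (fun x => L (φ x)) x v).1 = 0 := by
  have h1 := dmap_branch_model hp hk hφ hψ hmodel hx hx0 v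
  constructor
  · intro h
    rw [h, map_zero] at h1
    exact (congrArg Prod.fst h1).symm
  · intro h
    rw [h] at h1
    exact (dmap_linear_chart_injective L hψ (hmodel x hx).1) (h1.trans (map_zero _).symm)

lemma not_injective_dmap_branch_model (hp : ContMDiff (𝓡 d) (𝓡 d) ∞ p) (hk : 2 ≤ k)
    (hφ : φ ∈ IsManifold.maximalAtlas (𝓡 d) ∞ M) (hψ : ψ ∈ IsManifold.maximalAtlas (𝓡 d) ∞ Y)
    (hmodel : ∀ u ∈ φ.source, p u ∈ ψ.source ∧ L (ψ (p u)) = ((L (φ u)).1, (L (φ u)).2 ^ k))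
    {x : M} (hx : x ∈ φ.source) (hx0 : (L (φ x)).2 = 0) :
    ¬ Function.Injective
      (dmap (E := EuclideanSpace ℝ (Fin d)) (E' := EuclideanSpace ℝ (Fin d)) p x) := by
  intro hinj
  have h1 := (LinearMap.injective_iff_surjective_of_finrank_eq_finrank
    L.toLinearEquiv.finrank_eq).1 (show Function.Injective
      (dmap (E := EuclideanSpace ℝ (Fin d)) (E' := EuclideanSpace ℝ (Fin c) × ℂ)
        (fun x => L (φ x)) x : EuclideanSpace ℝ (Fin d) →ₗ[ℝ] EuclideanSpace ℝ (Fin c) × ℂ) from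
      dmap_linear_chart_injective L hφ hx)
  obtain ⟨v, hv⟩ := h1 (0, 1)
  have hv' : dmap (E := EuclideanSpace ℝ (Fin d)) (E' := EuclideanSpace ℝ (Fin c) × ℂ)
        (fun x => L (φ x)) x v = (0, 1) := hv
  have h2 := (dmap_branch_model_eq_zero_iff hp hk hφ hψ hmodel hx hx0 v).2 (by rw [hv'])
  have h3 : v = 0 := hinj (h2.trans (map_zero _).symm)
  rw [h3, map_zero] at hv'
  simpa using congrArg Prod.snd hv'

end BranchModel

/-! ### Coordinates of the branch locus near the image of a ramified point. -/

section BranchLocus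

variable {d c : ℕ}
  {M : Type*} [TopologicalSpace M] [ChartedSpace (EuclideanSpace ℝ (Fin d)) M]
  {Y : Type*} [TopologicalSpace Y] [ChartedSpace (EuclideanSpace ℝ (Fin d)) Y]
  {B : Type*} [TopologicalSpace B] [ChartedSpace (EuclideanSpace ℝ (Fin c)) B]
  [IsManifold (𝓡 c) ∞ B]

/-- A local coordinate system of the branch locus near the image of a ramified point. -/
structure IsBranchCoordinate (p : M → Y) (ι : B → Y) (x₀ : M) (b₀ : B)
    (r : Y → EuclideanSpace ℝ (Fin c)) : Prop where
  smooth : ContMDiffAt (𝓡 d) 𝓘(ℝ, EuclideanSpace ℝ (Fin c)) ∞ r (p x₀)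
  injective : Function.Injective (dmap (E := EuclideanSpace ℝ (Fin c))
    (E' := EuclideanSpace ℝ (Fin c)) (r ∘ ι) b₀)
  ker_le : ∀ v : EuclideanSpace ℝ (Fin d), dmap (E := EuclideanSpace ℝ (Fin d))
    (E' := EuclideanSpace ℝ (Fin c)) (r ∘ p) x₀ v = 0 →
    dmap (E := EuclideanSpace ℝ (Fin d)) (E' := EuclideanSpace ℝ (Fin d)) p x₀ v = 0
  range_le : ∀ a : EuclideanSpace ℝ (Fin c), ∃ v : EuclideanSpace ℝ (Fin d),
    dmap (E := EuclideanSpace ℝ (Fin d)) (E' := EuclideanSpace ℝ (Fin d)) p x₀ v =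
    dmap (E := EuclideanSpace ℝ (Fin c)) (E' := EuclideanSpace ℝ (Fin d)) ι b₀ a

/-- In the model the ramification locus is z = 0 and p maps it by u ↦ (u, 0). This section of Y lies
in the image of ι, so it lifts to κ : ℝ^c → B. With r the ℝ^c component of the chart of Y, r ∘ ι ∘ κ
is the identity; by equality of dimensions r ∘ ι and κ have invertible derivatives at the base
points. So B coincides with the second-coordinate-zero locus near p x₀, and every point near x₀ that
lies over B is ramified. -/
lemma exists_isBranchCoordinate {p : M → Y} {ι : B → Y}
    (hp : ContMDiff (𝓡 d) (𝓡 d) ∞ p) (hι : Manifold.IsSmoothEmbedding (𝓡 c) (𝓡 d) ∞ ι)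
    (hsing : ∀ x, ¬ Function.Injective
      (dmap (E := EuclideanSpace ℝ (Fin d)) (E' := EuclideanSpace ℝ (Fin d)) p x) →
      x ∈ ramificationSet p)
    (himage : p '' ramificationSet p ⊆ Set.range ι) {x₀ : M}
    (hmodel : HasBranchModelAt (d := d) c p x₀) {b₀ : B} (hb₀ : ι b₀ = p x₀) :
    d = 2 + c ∧ (∃ r : Y → EuclideanSpace ℝ (Fin c), IsBranchCoordinate (d := d) p ι x₀ b₀ r) ∧
      ∀ᶠ x in 𝓝 x₀, p x ∈ Set.range ι → x ∈ ramificationSet p := by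
  obtain ⟨k, hk, L, φ, hφ, ψ, hψ, hx₀, hL0, hmodel⟩ := hmodel
  have hd : d = 2 + c := by
    have := L.toLinearEquiv.finrank_eq
    simp [Module.finrank_prod] at this
    omega
  have hR : ∀ x ∈ φ.source, (L (φ x)).2 = 0 → x ∈ ramificationSet p := fun x hx hx0 =>
    hsing x (not_injective_dmap_branch_model hp hk hφ hψ hmodel hx hx0)
  -- the section of the ramification locus
  obtain ⟨X, hXs, hX0, hX⟩ : ∃ X : EuclideanSpace ℝ (Fin c) → M,
      ContMDiffAt (𝓡 c) (𝓡 d) ∞ X 0 ∧ X 0 = x₀ ∧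
      ∀ᶠ u in 𝓝 0, X u ∈ φ.source ∧ L (φ (X u)) = (u, 0) := by
    have hφ0 : φ x₀ = 0 := L.injective (hL0.trans (map_zero L).symm)
    have hJ : ContDiff ℝ ∞ (fun u : EuclideanSpace ℝ (Fin c) => L.symm (u, (0 : ℂ))) :=
      L.symm.contDiff.comp (contDiff_id.prodMk contDiff_const)
    have hJ0 : L.symm ((0 : EuclideanSpace ℝ (Fin c)), (0 : ℂ)) = φ x₀ := by
      rw [hφ0]; exact map_zero L.symm
    have ht : φ x₀ ∈ φ.target := φ.map_source hx₀
    refine ⟨fun u => φ.symm (L.symm (u, 0)), ?_, ?_, ?_⟩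
    · refine ContMDiffAt.comp (g := φ.symm) (0 : EuclideanSpace ℝ (Fin c)) ?_
        hJ.contMDiff.contMDiffAt
      rw [hJ0]
      exact contMDiffAt_symm_of_mem_maximalAtlas hφ ht
    · simp only [hJ0]
      exact φ.left_inv hx₀
    · have : ∀ᶠ u in 𝓝 (0 : EuclideanSpace ℝ (Fin c)), L.symm (u, (0 : ℂ)) ∈ φ.target :=
        hJ.continuous.continuousAt.eventually (φ.open_target.mem_nhds (hJ0.symm ▸ ht :))
      filter_upwards [this] with u hu
      refine ⟨φ.map_target hu, ?_⟩
      rw [φ.right_inv hu]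
      exact L.apply_symm_apply _
  obtain ⟨κ, hκ⟩ : ∃ κ : EuclideanSpace ℝ (Fin c) → B, ∀ᶠ u in 𝓝 0, ι (κ u) = p (X u) := by
    have : Nonempty B := ⟨b₀⟩
    refine ⟨fun u => Function.invFun ι (p (X u)), ?_⟩
    filter_upwards [hX] with u ⟨hu1, hu2⟩
    exact Function.invFun_eq (himage ⟨X u, hR _ hu1 (by rw [hu2]), rfl⟩)
  have hκ0 : κ 0 = b₀ :=
    hι.isEmbedding.injective (hκ.self_of_nhds.trans ((congrArg p hX0).trans hb₀.symm))
  have hpX : ContMDiffAt (𝓡 c) (𝓡 d) ∞ (p ∘ X) 0 := hp.contMDiffAt.comp 0 hXs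
  have hικ : ι ∘ κ =ᶠ[𝓝 0] p ∘ X := hκ
  -- The lift is continuous because ι is a topological embedding, and then smooth because ι is an
  -- immersion and ι ∘ κ is smooth.
  have hκs : ContMDiffAt (𝓡 c) (𝓡 c) ∞ κ 0 := by
    rw [ContMDiffAt.iff_comp_isImmersionAt (hι.isImmersion.isImmersionAt (κ 0))]
    refine ⟨?_, hpX.congr_of_eventuallyEq hικ⟩
    rw [hι.isEmbedding.isInducing.continuousAt_iff]
    exact hpX.continuousAt.congr hικ.symm
  set r : Y → EuclideanSpace ℝ (Fin c) := fun y => (L (ψ y)).1 with hr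
  have hA' := contMDiffAt_linear_chart L hψ (hmodel x₀ hx₀).1
  have hrs : ContMDiffAt (𝓡 d) 𝓘(ℝ, EuclideanSpace ℝ (Fin c)) ∞ r (p x₀) :=
    ContMDiffAt.comp (g := Prod.fst) (f := fun y => L (ψ y)) (p x₀)
      (contDiff_fst.contMDiff).contMDiffAt hA'
  have hι0 : ContMDiffAt (𝓡 c) (𝓡 d) ∞ ι b₀ := hι.contMDiff.contMDiffAt
  have hrι : ContMDiffAt (𝓡 c) 𝓘(ℝ, EuclideanSpace ℝ (Fin c)) ∞ (r ∘ ι) b₀ :=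
    ContMDiffAt.comp b₀ (by rw [hb₀]; exact hrs) hι0
  have hrικ : (r ∘ ι) ∘ κ =ᶠ[𝓝 0] id := by
    filter_upwards [hκ, hX] with u hu ⟨hu1, hu2⟩
    simp only [Function.comp_apply, hu, hr, (hmodel _ hu1).2, hu2, id]
  have hD1 := dmap_comp_of_eq (E := EuclideanSpace ℝ (Fin c)) (E' := EuclideanSpace ℝ (Fin c))
    (G := r ∘ ι) hκ0 (hrι.mdifferentiableAt (by simp)) (hκs.mdifferentiableAt (by simp))
  rw [dmap_congr hrικ, dmap_id] at hD1
  have hκinj : Function.Injective (dmap (E := EuclideanSpace ℝ (Fin c))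
      (E' := EuclideanSpace ℝ (Fin c)) κ 0) := fun u w huw => by
    have h := fun u => DFunLike.congr_fun hD1 u
    exact (h u).trans ((congrArg _ huw).trans (h w).symm)
  have hκsurj : Function.Surjective (dmap (E := EuclideanSpace ℝ (Fin c))
      (E' := EuclideanSpace ℝ (Fin c)) κ 0) :=
    LinearMap.injective_iff_surjective (f := (dmap (E := EuclideanSpace ℝ (Fin c))
      (E' := EuclideanSpace ℝ (Fin c)) κ 0 :
      EuclideanSpace ℝ (Fin c) →ₗ[ℝ] EuclideanSpace ℝ (Fin c))).1 hκinj
  have hrinj : Function.Injective (dmap (E := EuclideanSpace ℝ (Fin c))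
      (E' := EuclideanSpace ℝ (Fin c)) (r ∘ ι) b₀) := by
    refine LinearMap.injective_iff_surjective (f := (dmap (E := EuclideanSpace ℝ (Fin c))
      (E' := EuclideanSpace ℝ (Fin c)) (r ∘ ι) b₀ :
      EuclideanSpace ℝ (Fin c) →ₗ[ℝ] EuclideanSpace ℝ (Fin c))).2 fun u => ?_
    exact ⟨_, (DFunLike.congr_fun hD1 u).symm⟩
  refine ⟨hd, ⟨r, hrs, hrinj, fun v hv => ?_, fun a => ?_⟩, ?_⟩
  · have hx0 : (L (φ x₀)).2 = 0 := by rw [hL0]; rfl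
    have h1 := dmap_branch_model hp hk hφ hψ hmodel hx₀ hx0 v
    refine (dmap_branch_model_eq_zero_iff hp hk hφ hψ hmodel hx₀ hx0 v).2 ?_
    have h2 := dmap_comp_of_eq (E := EuclideanSpace ℝ (Fin d)) (E' := EuclideanSpace ℝ (Fin d))
      (G := r) (rfl : p x₀ = p x₀) (hrs.mdifferentiableAt (by simp))
      (hp.contMDiffAt.mdifferentiableAt (by simp))
    have h3 := dmap_comp_of_eq (E := EuclideanSpace ℝ (Fin d))
      (E' := EuclideanSpace ℝ (Fin c) × ℂ) (F := fun y => L (ψ y))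
      (G := Prod.fst) (rfl : L (ψ (p x₀)) = L (ψ (p x₀)))
      differentiableAt_fst.mdifferentiableAt (hA'.mdifferentiableAt (by simp))
    rw [dmap_eq_fderiv, fderiv_fst] at h3
    have h4 := (DFunLike.congr_fun h2 v).symm.trans hv
    have h5 := (DFunLike.congr_fun h3 (dmap (E := EuclideanSpace ℝ (Fin d))
      (E' := EuclideanSpace ℝ (Fin d)) p x₀ v)).symm.trans h4
    exact (congrArg Prod.fst h1).symm.trans h5
  · obtain ⟨u, rfl⟩ := hκsurj a
    have h1 := dmap_comp_of_eq (E := EuclideanSpace ℝ (Fin c)) (E' := EuclideanSpace ℝ (Fin c))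
      (G := ι) hκ0 (hι0.mdifferentiableAt (by simp)) (hκs.mdifferentiableAt (by simp))
    have h2 := dmap_comp_of_eq (E := EuclideanSpace ℝ (Fin c)) (E' := EuclideanSpace ℝ (Fin d))
      (G := p) hX0 (hp.contMDiffAt.mdifferentiableAt (by simp)) (hXs.mdifferentiableAt (by simp))
    rw [← dmap_congr hικ, h1] at h2
    exact ⟨_, (DFunLike.congr_fun h2 u).symm⟩
  -- Local injectivity of r ∘ ι gives b = κ(r(ι b)) near b₀, so ι b has vanishing ℂ coordinate. For
  -- p x = ι b this reads z^k = 0, hence z = 0 and x is ramified.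
  · obtain ⟨V, hV, hVinj⟩ := exists_injOn_of_injective_dmap
      (hrι.of_le (by exact_mod_cast le_top)) hrinj
    have hr0 : (r ∘ ι) b₀ = 0 := by
      simp only [Function.comp_apply, hb₀, hr, (hmodel x₀ hx₀).2, hL0]
      rfl
    have hlim : Filter.Tendsto (r ∘ ι) (𝓝 b₀) (𝓝 0) := hr0 ▸ hrι.continuousAt
    have hκV : ∀ᶠ u in 𝓝 (0 : EuclideanSpace ℝ (Fin c)), κ u ∈ V :=
      hκs.continuousAt.eventually (by rw [hκ0]; exact hV)
    have hb : ∀ᶠ b in 𝓝 b₀, (L (ψ (ι b))).2 = 0 := by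
      filter_upwards [hV, hlim.eventually hκV, hlim.eventually hκ, hlim.eventually hX,
        hlim.eventually hrικ] with b h1 h2 h3 h4 h5
      have h6 : κ ((r ∘ ι) b) = b := hVinj h2 h1 h5
      rw [h6] at h3
      rw [h3, (hmodel _ h4.1).2, h4.2]
      exact zero_pow (by omega)
    rw [hι.isEmbedding.isInducing.nhds_eq_comap, Filter.eventually_comap, hb₀] at hb
    filter_upwards [hp.continuous.continuousAt.eventually hb, φ.open_source.mem_nhds hx₀]
      with x hx hxs ⟨b, hbx⟩
    refine hR x hxs ?_
    have h1 := hx b hbx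
    rw [hbx, (hmodel x hxs).2] at h1
    exact pow_eq_zero_iff (by omega) |>.1 h1

end BranchLocus

/-! ### The sign of df on the normal fibres. -/

section NormalSign

variable {d c : ℕ}
  {M : Type*} [TopologicalSpace M] [ChartedSpace (EuclideanSpace ℝ (Fin d)) M]
  {Y : Type*} [TopologicalSpace Y] [ChartedSpace (EuclideanSpace ℝ (Fin d)) Y]
  {B : Type*} [TopologicalSpace B] [ChartedSpace (EuclideanSpace ℝ (Fin c)) B]
  {p : M → Y} {ι : B → Y} {f : M → ℂ} {r : Y → EuclideanSpace ℝ (Fin c)}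

/-- The map to `ℂ × ℝ^c` given by the fibre coordinate and a coordinate of the branch locus. -/
def braidCoordinate (p : M → Y) (f : M → ℂ) (r : Y → EuclideanSpace ℝ (Fin c)) (x : M) :
    ℂ × EuclideanSpace ℝ (Fin c) := (f x, r (p x))

lemma contMDiffAt_braidCoordinate {x : M} (hp : ContMDiff (𝓡 d) (𝓡 d) ∞ p)
    (hf : ContMDiff (𝓡 d) 𝓘(ℝ, ℂ) ∞ f)
    (hr : ContMDiffAt (𝓡 d) 𝓘(ℝ, EuclideanSpace ℝ (Fin c)) ∞ r (p x)) :
    ContMDiffAt (𝓡 d) 𝓘(ℝ, ℂ × EuclideanSpace ℝ (Fin c)) ∞ (braidCoordinate p f r) x :=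
  hf.contMDiffAt.prodMk_space (hr.comp x hp.contMDiffAt)

lemma dmap_braidCoordinate {x : M} (hp : ContMDiff (𝓡 d) (𝓡 d) ∞ p)
    (hf : ContMDiff (𝓡 d) 𝓘(ℝ, ℂ) ∞ f)
    (hr : MDifferentiableAt (𝓡 d) 𝓘(ℝ, EuclideanSpace ℝ (Fin c)) r (p x))
    (v : EuclideanSpace ℝ (Fin d)) :
    dmap (E := EuclideanSpace ℝ (Fin d)) (E' := ℂ × EuclideanSpace ℝ (Fin c))
      (braidCoordinate p f r) x v =
    (dmap (E := EuclideanSpace ℝ (Fin d)) (E' := ℂ) f x v,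
      dmap (E := EuclideanSpace ℝ (Fin d)) (E' := EuclideanSpace ℝ (Fin c)) r (p x)
        (dmap (E := EuclideanSpace ℝ (Fin d)) (E' := EuclideanSpace ℝ (Fin d)) p x v)) := by
  have h1 : MDifferentiableAt (𝓡 d) 𝓘(ℝ, ℂ) f x := hf.contMDiffAt.mdifferentiableAt (by simp)
  have h2 : MDifferentiableAt (𝓡 d) (𝓡 d) p x := hp.contMDiffAt.mdifferentiableAt (by simp)
  have h3 := MDifferentiableAt.prodMk_space h1 (MDifferentiableAt.comp x hr h2)
  have h4 := dmap_comp_of_eq (E := EuclideanSpace ℝ (Fin d)) (E' := EuclideanSpace ℝ (Fin d))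
    (G := r) (rfl : p x = p x) hr h2
  have h5 := dmap_comp_of_eq (E := EuclideanSpace ℝ (Fin d))
    (E' := ℂ × EuclideanSpace ℝ (Fin c)) (G := Prod.fst) (rfl : braidCoordinate p f r x = _)
    differentiableAt_fst.mdifferentiableAt h3
  have h6 := dmap_comp_of_eq (E := EuclideanSpace ℝ (Fin d))
    (E' := ℂ × EuclideanSpace ℝ (Fin c)) (G := Prod.snd) (rfl : braidCoordinate p f r x = _)
    differentiableAt_snd.mdifferentiableAt h3
  rw [dmap_eq_fderiv, fderiv_fst] at h5
  rw [dmap_eq_fderiv, fderiv_snd] at h6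
  exact Prod.ext (DFunLike.congr_fun h5 v).symm
    ((DFunLike.congr_fun h6 v).symm.trans (DFunLike.congr_fun h4 v))

/-- A vector killed by d(r ∘ p) lies in ker dp, and there df is injective because the braid is an
immersion. -/
lemma IsBranchCoordinate.injective_dmap_braidCoordinate {x₀ : M} {b₀ : B}
    (hr : IsBranchCoordinate (d := d) p ι x₀ b₀ r) (hp : ContMDiff (𝓡 d) (𝓡 d) ∞ p)
    (hf : ContMDiff (𝓡 d) 𝓘(ℝ, ℂ) ∞ f)
    (himm : ∀ v : EuclideanSpace ℝ (Fin d),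
      dmap (E := EuclideanSpace ℝ (Fin d)) (E' := EuclideanSpace ℝ (Fin d)) p x₀ v = 0 →
      dmap (E := EuclideanSpace ℝ (Fin d)) (E' := ℂ) f x₀ v = 0 → v = 0) :
    Function.Injective (dmap (E := EuclideanSpace ℝ (Fin d))
      (E' := ℂ × EuclideanSpace ℝ (Fin c)) (braidCoordinate p f r) x₀) := by
  refine (injective_iff_map_eq_zero _).2 fun v hv => ?_
  have hrd := hr.smooth.mdifferentiableAt (by simp)
  rw [dmap_braidCoordinate hp hf hrd] at hv
  refine himm v (hr.ker_le v ?_) (congrArg Prod.fst hv)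
  have h4 := dmap_comp_of_eq (E := EuclideanSpace ℝ (Fin d)) (E' := EuclideanSpace ℝ (Fin d))
    (G := r) (rfl : p x₀ = p x₀) hrd (hp.contMDiffAt.mdifferentiableAt (by simp))
  rw [h4]
  exact congrArg Prod.snd hv

/-- On a frame adapted to the normal fibre the determinant splits into the area of (df v, df w) and
the determinant of a frame of B. The sign of the area is thus read off from the orientations of M
and B. -/
lemma det_braidCoordinate (h : d = 2 + c) {x : M} {b : B} (hb : ι b = p x)
    (hp : ContMDiff (𝓡 d) (𝓡 d) ∞ p) (hf : ContMDiff (𝓡 d) 𝓘(ℝ, ℂ) ∞ f)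
    (hι : ContMDiff (𝓡 c) (𝓡 d) ∞ ι)
    (hr : MDifferentiableAt (𝓡 d) 𝓘(ℝ, EuclideanSpace ℝ (Fin c)) r (p x))
    {v w : EuclideanSpace ℝ (Fin d)} {u : Fin c → EuclideanSpace ℝ (Fin d)}
    {a : Fin c → EuclideanSpace ℝ (Fin c)}
    (hv : dmap (E := EuclideanSpace ℝ (Fin d)) (E' := EuclideanSpace ℝ (Fin d)) p x v = 0)
    (hw : dmap (E := EuclideanSpace ℝ (Fin d)) (E' := EuclideanSpace ℝ (Fin d)) p x w = 0)
    (hu : ∀ i, dmap (E := EuclideanSpace ℝ (Fin d)) (E' := EuclideanSpace ℝ (Fin d)) p x (u i) =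
      dmap (E := EuclideanSpace ℝ (Fin c)) (E' := EuclideanSpace ℝ (Fin d)) ι b (a i)) :
    (prodBasis c h).det (fun i => dmap (E := EuclideanSpace ℝ (Fin d))
      (E' := ℂ × EuclideanSpace ℝ (Fin c)) (braidCoordinate p f r) x
        (Fin.append ![v, w] u (Fin.cast h i))) =
    (starRingEnd ℂ (dmap (E := EuclideanSpace ℝ (Fin d)) (E' := ℂ) f x v) *
        dmap (E := EuclideanSpace ℝ (Fin d)) (E' := ℂ) f x w).im *
      (EuclideanSpace.basisFun (Fin c) ℝ).toBasis.det (fun i =>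
        dmap (E := EuclideanSpace ℝ (Fin c)) (E' := EuclideanSpace ℝ (Fin c)) (r ∘ ι) b (a i)) := by
  have h4 := dmap_comp_of_eq (E := EuclideanSpace ℝ (Fin c)) (E' := EuclideanSpace ℝ (Fin d))
    (G := r) hb hr (hι.contMDiffAt.mdifferentiableAt (by simp))
  have h5 := prodBasis_det_append h (dmap (E := EuclideanSpace ℝ (Fin d)) (E' := ℂ) f x v)
    (dmap (E := EuclideanSpace ℝ (Fin d)) (E' := ℂ) f x w)
    (fun i => dmap (E := EuclideanSpace ℝ (Fin d))
      (E' := ℂ × EuclideanSpace ℝ (Fin c)) (braidCoordinate p f r) x (u i))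
  rw [h4]
  refine Eq.trans (congrArg _ (funext fun i => ?_)) (h5.trans (congrArg _ (congrArg _ (funext fun i => ?_))))
  · generalize Fin.cast h i = j
    refine Fin.addCases (fun j => ?_) (fun j => ?_) j
    · simp only [Fin.append_left]
      fin_cases j
      · exact (dmap_braidCoordinate hp hf hr v).trans (Prod.ext rfl (by simp [hv]))
      · exact (dmap_braidCoordinate hp hf hr w).trans (Prod.ext rfl (by simp [hw]))
    · simp only [Fin.append_right]
  · rw [dmap_braidCoordinate hp hf hr, hu]
    rfl

variable [IsManifold (𝓡 d) ∞ M] [IsManifold (𝓡 c) ∞ B]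

/-- Near a ramified point, the derivative of the fibre coordinate has a constant sign on positive
pairs of normal vectors, which changes with the orientation of the branch locus. -/
lemma IsBranchCoordinate.exists_normal_sign (h : d = 2 + c) (hc : c ≠ 0)
    (oM : ManifoldOrientation d M) (oB : ManifoldOrientation c B)
    {x₀ : M} {b₀ : B} (hb₀ : ι b₀ = p x₀)
    (hr : IsBranchCoordinate (d := d) p ι x₀ b₀ r) (hp : ContMDiff (𝓡 d) (𝓡 d) ∞ p)
    (hf : ContMDiff (𝓡 d) 𝓘(ℝ, ℂ) ∞ f)
    (hι : Manifold.IsSmoothEmbedding (𝓡 c) (𝓡 d) ∞ ι) [IsManifold (𝓡 d) ∞ Y]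
    (himm : ∀ v : EuclideanSpace ℝ (Fin d),
      dmap (E := EuclideanSpace ℝ (Fin d)) (E' := EuclideanSpace ℝ (Fin d)) p x₀ v = 0 →
      dmap (E := EuclideanSpace ℝ (Fin d)) (E' := ℂ) f x₀ v = 0 → v = 0) :
    ∃ s : ℝ, s ≠ 0 ∧ ∀ᶠ x in 𝓝 x₀, ∀ (oB' : ManifoldOrientation c B) (b : B), ι b = p x →
      ∀ v w : EuclideanSpace ℝ (Fin d), IsPositiveNormalPair oM oB' ι p x v w →
      (oB'.modelAt b = oB.modelAt b →
        0 < s * (starRingEnd ℂ (dmap (E := EuclideanSpace ℝ (Fin d)) (E' := ℂ) f x v) *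
          dmap (E := EuclideanSpace ℝ (Fin d)) (E' := ℂ) f x w).im) ∧
      (oB'.modelAt b = -oB.modelAt b →
        s * (starRingEnd ℂ (dmap (E := EuclideanSpace ℝ (Fin d)) (E' := ℂ) f x v) *
          dmap (E := EuclideanSpace ℝ (Fin d)) (E' := ℂ) f x w).im < 0) := by
  obtain ⟨s₁, hs₁, h1⟩ := oM.exists_sign (by omega) (prodBasis c h)
    ((contMDiffAt_braidCoordinate hp hf hr.smooth).of_le (by exact_mod_cast le_top))
    (hr.injective_dmap_braidCoordinate hp hf himm)
  have hrι : ContMDiffAt (𝓡 c) 𝓘(ℝ, EuclideanSpace ℝ (Fin c)) ∞ (r ∘ ι) b₀ :=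
    ContMDiffAt.comp b₀ (by rw [hb₀]; exact hr.smooth) hι.contMDiff.contMDiffAt
  obtain ⟨s₂, hs₂, h2⟩ := oB.exists_sign hc (EuclideanSpace.basisFun (Fin c) ℝ).toBasis
    (hrι.of_le (by exact_mod_cast le_top)) hr.injective
  have h3 : ∀ᶠ y in 𝓝 (p x₀), MDifferentiableAt (𝓡 d) 𝓘(ℝ, EuclideanSpace ℝ (Fin c)) r y := by
    have := (contMDiffAt_iff_contMDiffAt_nhds (n := 1) (by simp)).1
      (hr.smooth.of_le (by exact_mod_cast le_top))
    filter_upwards [this] with y hy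
    exact hy.mdifferentiableAt one_ne_zero
  rw [hι.isEmbedding.isInducing.nhds_eq_comap, Filter.eventually_comap, hb₀] at h2
  -- Here s₁ and s₂ compare the orientations of M and B with coordinates. The product of the two
  -- signed determinants is s₁ s₂ times the area times the square of the determinant on B, so s₁ s₂
  -- gives the sign of the area.
  refine ⟨s₁ * s₂, mul_ne_zero hs₁ hs₂, ?_⟩
  filter_upwards [h1, hp.continuous.continuousAt.eventually h2,
    hp.continuous.continuousAt.eventually h3] with x hx1 hx2 hx3 oB' b hb v w
    ⟨hv, hw, h', b', a, u, hb', ha, hu, hfr⟩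
  obtain rfl : b' = b := hι.isEmbedding.injective (hb'.trans hb.symm)
  have e1 := hx1 _ hfr
  have e3 := det_braidCoordinate (f := f) h hb hp hf hι.contMDiff hx3 hv hw hu
  have e4 := e1.trans_eq (congrArg (s₁ * ·) e3)
  have hsq := mul_self_nonneg ((EuclideanSpace.basisFun (Fin c) ℝ).toBasis.det (fun i =>
    dmap (E := EuclideanSpace ℝ (Fin c)) (E' := EuclideanSpace ℝ (Fin c)) (r ∘ ι) b' (a i)))
  refine ⟨fun ho => ?_, fun ho => ?_⟩
  · have ha' : oB.IsPositiveFrame b' a := by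
      obtain ⟨β, hβ, hβa⟩ := ha
      exact ⟨β, hβ.trans ho, hβa⟩
    have e2 := hx2 b' hb a ha'
    nlinarith [mul_pos e4 e2]
  · obtain ⟨a₀, ha₀⟩ : ∃ a₀ : Fin c → EuclideanSpace ℝ (Fin c), oB.IsPositiveFrame b' a₀ :=
      oB.exists_isPositiveFrame hc b'
    have e2 := ha₀.alternating_neg ha ho
      (s₂ • (EuclideanSpace.basisFun (Fin c) ℝ).toBasis.det.compLinearMap
        (dmap (E := EuclideanSpace ℝ (Fin c)) (E' := EuclideanSpace ℝ (Fin c)) (r ∘ ι) b' :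
          EuclideanSpace ℝ (Fin c) →ₗ[ℝ] EuclideanSpace ℝ (Fin c))) (hx2 b' hb a₀ ha₀)
    change s₂ * (EuclideanSpace.basisFun (Fin c) ℝ).toBasis.det (fun i =>
      dmap (E := EuclideanSpace ℝ (Fin c)) (E' := EuclideanSpace ℝ (Fin c)) (r ∘ ι) b' (a i)) < 0 at e2
    nlinarith [mul_neg_of_pos_of_neg e4 e2]

lemma IsBranchCoordinate.exists_isPositiveNormalPair (h : d = 2 + c) (hc : c ≠ 0)
    (oM : ManifoldOrientation d M) (oB : ManifoldOrientation c B)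
    {x₀ : M} {b₀ : B} (hb₀ : ι b₀ = p x₀)
    (hr : IsBranchCoordinate (d := d) p ι x₀ b₀ r) (hp : ContMDiff (𝓡 d) (𝓡 d) ∞ p)
    (hf : ContMDiff (𝓡 d) 𝓘(ℝ, ℂ) ∞ f) (hι : ContMDiff (𝓡 c) (𝓡 d) ∞ ι)
    (himm : ∀ v : EuclideanSpace ℝ (Fin d),
      dmap (E := EuclideanSpace ℝ (Fin d)) (E' := EuclideanSpace ℝ (Fin d)) p x₀ v = 0 →
      dmap (E := EuclideanSpace ℝ (Fin d)) (E' := ℂ) f x₀ v = 0 → v = 0) :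
    ∃ v w : EuclideanSpace ℝ (Fin d), IsPositiveNormalPair oM oB ι p x₀ v w := by
  have hrd := hr.smooth.mdifferentiableAt (n := ∞) (by simp)
  set T := dmap (E := EuclideanSpace ℝ (Fin d))
      (E' := ℂ × EuclideanSpace ℝ (Fin c)) (braidCoordinate p f r) x₀ with hT
  have hTinj : Function.Injective T := hr.injective_dmap_braidCoordinate hp hf himm
  have hTsurj : Function.Surjective T :=
    (LinearMap.injective_iff_surjective_of_finrank_eq_finrank
      (f := (T : EuclideanSpace ℝ (Fin d) →ₗ[ℝ] ℂ × EuclideanSpace ℝ (Fin c)))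
      (by simp [Module.finrank_prod, h])).1 hTinj
  obtain ⟨a, ha⟩ : ∃ a : Fin c → EuclideanSpace ℝ (Fin c), oB.IsPositiveFrame b₀ a :=
    oB.exists_isPositiveFrame hc b₀
  obtain ⟨e, he⟩ : ∃ e : Fin d → EuclideanSpace ℝ (Fin d), oM.IsPositiveFrame x₀ e :=
    oM.exists_isPositiveFrame (by omega) x₀
  set D := (EuclideanSpace.basisFun (Fin c) ℝ).toBasis.det (fun i =>
        dmap (E := EuclideanSpace ℝ (Fin c)) (E' := EuclideanSpace ℝ (Fin c)) (r ∘ ι) b₀ (a i))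
  have hD : D ≠ 0 := ha.det_ne_zero _ (L := (dmap (E := EuclideanSpace ℝ (Fin c))
    (E' := EuclideanSpace ℝ (Fin c)) (r ∘ ι) b₀ :
      EuclideanSpace ℝ (Fin c) →ₗ[ℝ] EuclideanSpace ℝ (Fin c))) hr.injective
  set A := (prodBasis c h).det.compLinearMap
    (T : EuclideanSpace ℝ (Fin d) →ₗ[ℝ] ℂ × EuclideanSpace ℝ (Fin c)) with hA
  have hAe : A e ≠ 0 := he.det_ne_zero (prodBasis c h)
    (L := (T : EuclideanSpace ℝ (Fin d) →ₗ[ℝ] ℂ × EuclideanSpace ℝ (Fin c))) hTinj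
  obtain ⟨v, hv⟩ := hTsurj (1, 0)
  -- The factor A e * D corrects the orientation: the determinant of the constructed frame is A e
  -- times D², of the same sign as on the positive frame e.
  obtain ⟨w, hw⟩ := hTsurj (((A e * D : ℝ) : ℂ) * Complex.I, 0)
  choose u hu using fun i => hTsurj (0, dmap (E := EuclideanSpace ℝ (Fin c))
    (E' := EuclideanSpace ℝ (Fin c)) (r ∘ ι) b₀ (a i))
  have hcomp := dmap_comp_of_eq (E := EuclideanSpace ℝ (Fin d)) (E' := EuclideanSpace ℝ (Fin d))
    (G := r) (rfl : p x₀ = p x₀) hrd (hp.contMDiffAt.mdifferentiableAt (by simp))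
  have hcompι := dmap_comp_of_eq (E := EuclideanSpace ℝ (Fin c)) (E' := EuclideanSpace ℝ (Fin d))
    (G := r) hb₀ hrd (hι.contMDiffAt.mdifferentiableAt (by simp))
  have hTapp : ∀ z, T z = _ := fun z => dmap_braidCoordinate hp hf hrd z
  have hker : ∀ z, (T z).2 = 0 →
      dmap (E := EuclideanSpace ℝ (Fin d)) (E' := EuclideanSpace ℝ (Fin d)) p x₀ z = 0 := by
    intro z hz
    refine hr.ker_le z ?_
    rw [hTapp] at hz
    rw [hcomp]
    exact hz
  have hpv := hker v (by rw [hv])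
  have hpw := hker w (by rw [hw])
  -- A lift z of the vector exists, and u i differs from it by a vector killed by d(r ∘ p), hence by
  -- dp.
  have hpu : ∀ i, dmap (E := EuclideanSpace ℝ (Fin d)) (E' := EuclideanSpace ℝ (Fin d)) p x₀ (u i) =
      dmap (E := EuclideanSpace ℝ (Fin c)) (E' := EuclideanSpace ℝ (Fin d)) ι b₀ (a i) := by
    intro i
    obtain ⟨z, hz⟩ := hr.range_le (a i)
    rw [← hz, ← sub_eq_zero, ← map_sub]
    refine hker _ ?_
    have e1 : (T z).2 = dmap (E := EuclideanSpace ℝ (Fin c))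
        (E' := EuclideanSpace ℝ (Fin c)) (r ∘ ι) b₀ (a i) := by
      rw [hTapp, hcompι]
      exact congrArg _ hz
    rw [map_sub, Prod.snd_sub, hu, e1, sub_self]
  have hfv : dmap (E := EuclideanSpace ℝ (Fin d)) (E' := ℂ) f x₀ v = 1 :=
    congrArg Prod.fst ((hTapp v).symm.trans hv)
  have hfw : dmap (E := EuclideanSpace ℝ (Fin d)) (E' := ℂ) f x₀ w = ((A e * D : ℝ) : ℂ) * Complex.I :=
    congrArg Prod.fst ((hTapp w).symm.trans hw)
  have hdet := det_braidCoordinate (f := f) h hb₀ hp hf hι hrd hpv hpw hpu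
  rw [hfv, hfw] at hdet
  refine ⟨v, w, hpv, hpw, h, b₀, a, u, hb₀, ha, hpu, ?_⟩
  refine he.of_alternating_pos (A e • A) ?_ ?_
  · exact mul_self_pos.2 hAe
  · have e2 : A (fun i => Fin.append ![v, w] u (Fin.cast h i)) = A e * D * D := by
      refine hdet.trans ?_
      simp [D]
    change 0 < A e * A (fun i => Fin.append ![v, w] u (Fin.cast h i))
    rw [e2]
    have := mul_self_pos.2 (mul_ne_zero hAe hD)
    nlinarith

end NormalSign

/-! ### Reversing orientations and locally constant properties of ramified points. -/

section Reorientation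

variable {c : ℕ} {B : Type*} [TopologicalSpace B] [ChartedSpace (EuclideanSpace ℝ (Fin c)) B]
  [IsManifold (𝓡 c) ∞ B]

open Classical in
/-- Reverse an orientation outside an open and closed set. -/
def ManifoldOrientation.reverseOutside (o : ManifoldOrientation c B) (σ : B → Prop)
    (hσ : ∀ b, ∀ᶠ b' in 𝓝 b, σ b' ↔ σ b) : ManifoldOrientation c B where
  at_ b := if σ b then o.at_ b else -o.at_ b
  locally_constant b := by
    filter_upwards [o.locally_constant b, hσ b] with b' ⟨h, h₀, hmap⟩ hb'
    refine ⟨h, h₀, ?_⟩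
    by_cases hb : σ b
    · rw [if_pos hb, if_pos (hb'.2 hb)]
      exact hmap
    · rw [if_neg hb, if_neg (fun h => hb (hb'.1 h)), Orientation.map_neg, Orientation.map_neg, hmap]

lemma ManifoldOrientation.reverseOutside_of_pos (o : ManifoldOrientation c B) {σ : B → Prop}
    (hσ : ∀ b, ∀ᶠ b' in 𝓝 b, σ b' ↔ σ b) {b : B} (hb : σ b) :
    (o.reverseOutside σ hσ).modelAt b = o.modelAt b := if_pos hb

lemma ManifoldOrientation.reverseOutside_of_neg (o : ManifoldOrientation c B) {σ : B → Prop}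
    (hσ : ∀ b, ∀ᶠ b' in 𝓝 b, σ b' ↔ σ b) {b : B} (hb : ¬ σ b) :
    (o.reverseOutside σ hσ).modelAt b = -o.modelAt b := if_neg hb

end Reorientation

lemma isClosed_ramificationSet {M Y : Type*} [TopologicalSpace M] (p : M → Y) :
    IsClosed (ramificationSet p) := by
  rw [← isOpen_compl_iff, isOpen_iff_mem_nhds]
  intro x hx
  obtain ⟨U, hU, hinj⟩ : ∃ U ∈ 𝓝 x, Set.InjOn p U := not_not.1 hx
  filter_upwards [eventually_mem_nhds_iff.2 hU] with y hy
  exact fun h => h ⟨U, hy, hinj⟩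

/-- A locally constant property of the ramified points of a branched covering whose branch locus is
not multiply ramified depends only on the component of the branch locus. -/
lemma NotMultiplyRamified.iff_of_eventually_iff {M Y : Type*} [TopologicalSpace M]
    [TopologicalSpace Y] {p : M → Y} {B : Set Y} (h : NotMultiplyRamified p B) {P : M → Prop}
    (hopen : ∀ x ∈ ramificationSet p, ∀ᶠ x' in 𝓝 x, p x' ∈ B → x' ∈ ramificationSet p)
    (hP : ∀ x ∈ ramificationSet p, ∀ᶠ x' in 𝓝 x, x' ∈ ramificationSet p → (P x' ↔ P x))
    {b : Y} (hb : b ∈ B) {x x' : M} (hx : x ∈ ramificationSet p) (hx' : x' ∈ ramificationSet p)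
    (hxb : p x ∈ connectedComponentIn B b) (hxb' : p x' ∈ connectedComponentIn B b) :
    P x ↔ P x' := by
  classical
  set S := p ⁻¹' connectedComponentIn B b with hS
  -- The code is 0 for unramified points, 1 or 2 for ramified points with or without P. It is
  -- locally constant over the component of the branch locus, because ramified points are both
  -- closed and, by `hopen`, open there. Hence it is constant on the component of the preimage that
  -- contains x and x'.
  let g : M → ℕ := fun x => if x ∈ ramificationSet p then (if P x then 1 else 2) else 0
  have hg : ContinuousOn g S := by
    intro y hy
    refine ContinuousWithinAt.congr_of_eventuallyEq (f := fun _ => g y)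
      continuousWithinAt_const ?_ rfl
    by_cases hyR : y ∈ ramificationSet p
    · filter_upwards [mem_nhdsWithin_of_mem_nhds (hopen y hyR),
        mem_nhdsWithin_of_mem_nhds (hP y hyR), self_mem_nhdsWithin] with z hz hzP hzS
      have hzR := hz (connectedComponentIn_subset _ _ hzS)
      simp only [g, hzR, hyR, if_true, hzP hzR]
    · filter_upwards [mem_nhdsWithin_of_mem_nhds
        ((isClosed_ramificationSet p).isOpen_compl.mem_nhds hyR)] with z hz
      simp only [g, if_neg hz, if_neg hyR]
  have hK := h b hb x hx x' hx' hxb hxb'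
  have h1 : g x = g x' :=
    IsPreconnected.constant (s := connectedComponentIn S x) isPreconnected_connectedComponentIn
      (hg.mono (connectedComponentIn_subset _ _)) (mem_connectedComponentIn hxb)
      (by rw [hK]; exact mem_connectedComponentIn hxb')
  simp only [g, hx, hx', if_true] at h1
  by_cases h2 : P x <;> by_cases h3 : P x' <;> simp_all

/-! ### The orientation of the branch locus. -/

section BranchOrientation

variable {d c : ℕ}
  {M : Type*} [TopologicalSpace M] [ChartedSpace (EuclideanSpace ℝ (Fin d)) M]
  [IsManifold (𝓡 d) ∞ M]
  {Y : Type*} [TopologicalSpace Y] [ChartedSpace (EuclideanSpace ℝ (Fin d)) Y]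
  [IsManifold (𝓡 d) ∞ Y]
  {B : Type*} [TopologicalSpace B] [ChartedSpace (EuclideanSpace ℝ (Fin c)) B]
  [IsManifold (𝓡 c) ∞ B]
  {p : M → Y} {ι : B → Y} {f : M → ℂ}

/-- The orientation of the branch locus of a braiding for which the fibre coordinate preserves the
orientation of the normal bundle of the ramification locus. -/
theorem exists_branch_orientation (hc : c ≠ 0)
    (oM : ManifoldOrientation d M) (oB : ManifoldOrientation c B)
    (hp : IsBranchedCovering (d := d) c p (Set.range ι)) (hf : ContMDiff (𝓡 d) 𝓘(ℝ, ℂ) ∞ f)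
    (hι : Manifold.IsSmoothEmbedding (𝓡 c) (𝓡 d) ∞ ι)
    (himm : ∀ (x : M) (v : EuclideanSpace ℝ (Fin d)),
      dmap (E := EuclideanSpace ℝ (Fin d)) (E' := EuclideanSpace ℝ (Fin d)) p x v = 0 →
      dmap (E := EuclideanSpace ℝ (Fin d)) (E' := ℂ) f x v = 0 → v = 0)
    (hram : NotMultiplyRamified p (Set.range ι)) :
    ∃ oB' : ManifoldOrientation c B, ∀ x ∈ ramificationSet p,
      (∃ v w : EuclideanSpace ℝ (Fin d), IsPositiveNormalPair oM oB' ι p x v w) ∧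
      ∀ v w : EuclideanSpace ℝ (Fin d), IsPositiveNormalPair oM oB' ι p x v w →
        0 < (starRingEnd ℂ (dmap (E := EuclideanSpace ℝ (Fin d)) (E' := ℂ) f x v) *
          dmap (E := EuclideanSpace ℝ (Fin d)) (E' := ℂ) f x w).im := by
  set R := ramificationSet p with hRdef
  have hsing : ∀ x, ¬ Function.Injective
      (dmap (E := EuclideanSpace ℝ (Fin d)) (E' := EuclideanSpace ℝ (Fin d)) p x) → x ∈ R :=
    fun x hx => (hp.singular_iff x).2 fun h => hx h.1
  have hmem : ∀ x ∈ R, ∃ b, ι b = p x := fun x hx => hp.image_eq.subset ⟨x, hx, rfl⟩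
  have hloc := fun (x : M) (hx : x ∈ R) (b : B) (hb : ι b = p x) =>
    exists_isBranchCoordinate hp.smooth hι hsing hp.image_eq.subset (hp.model x hx) hb
  have hopen : ∀ x ∈ R, ∀ᶠ x' in 𝓝 x, p x' ∈ Set.range ι → x' ∈ R := fun x hx => by
    obtain ⟨b, hb⟩ := hmem x hx
    exact (hloc x hx b hb).2.2
  have hpair : ∀ x ∈ R, ∀ o : ManifoldOrientation c B, ∃ v w : EuclideanSpace ℝ (Fin d),
      IsPositiveNormalPair oM o ι p x v w := fun x hx o => by
    obtain ⟨b, hb⟩ := hmem x hx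
    obtain ⟨h, ⟨r, hr⟩, -⟩ := hloc x hx b hb
    exact hr.exists_isPositiveNormalPair h hc oM o hb hp.smooth hf hι.contMDiff (himm x)
  set area : M → EuclideanSpace ℝ (Fin d) → EuclideanSpace ℝ (Fin d) → ℝ := fun x v w =>
    (starRingEnd ℂ (dmap (E := EuclideanSpace ℝ (Fin d)) (E' := ℂ) f x v) *
      dmap (E := EuclideanSpace ℝ (Fin d)) (E' := ℂ) f x w).im with harea
  have hsign : ∀ x ∈ R, ∃ s : ℝ, s ≠ 0 ∧ ∀ᶠ x' in 𝓝 x, ∀ (o : ManifoldOrientation c B) (b : B),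
      ι b = p x' → ∀ v w : EuclideanSpace ℝ (Fin d), IsPositiveNormalPair oM o ι p x' v w →
      (o.modelAt b = oB.modelAt b → 0 < s * area x' v w) ∧
      (o.modelAt b = -oB.modelAt b → s * area x' v w < 0) := fun x hx => by
    obtain ⟨b, hb⟩ := hmem x hx
    obtain ⟨h, ⟨r, hr⟩, -⟩ := hloc x hx b hb
    exact hr.exists_normal_sign h hc oM oB hb hp.smooth hf hι (himm x)
  set P : M → Prop := fun x => ∀ v w : EuclideanSpace ℝ (Fin d),
    IsPositiveNormalPair oM oB ι p x v w → 0 < area x v w with hPdef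
  -- Positive normal pairs exist at every ramified point, so P is not vacuous there and is decided
  -- by the local sign s.
  have hPs : ∀ x ∈ R, ∃ s : ℝ, s ≠ 0 ∧ ∀ᶠ x' in 𝓝 x, x' ∈ R → ((P x' ↔ 0 < s) ∧
      ∀ (o : ManifoldOrientation c B) (b : B),
        ι b = p x' → ∀ v w : EuclideanSpace ℝ (Fin d), IsPositiveNormalPair oM o ι p x' v w →
        (o.modelAt b = oB.modelAt b → 0 < s * area x' v w) ∧
        (o.modelAt b = -oB.modelAt b → s * area x' v w < 0)) := fun x hx => by
    obtain ⟨s, hs, h⟩ := hsign x hx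
    refine ⟨s, hs, ?_⟩
    filter_upwards [h] with x' hx' hR'
    obtain ⟨b, hb⟩ := hmem x' hR'
    refine ⟨⟨fun hP => ?_, fun hs v w hvw => ?_⟩, hx'⟩
    · obtain ⟨v, w, hvw⟩ := hpair x' hR' oB
      exact (pos_iff_pos_of_mul_pos ((hx' oB b hb v w hvw).1 rfl)).2 (hP v w hvw)
    · exact (pos_iff_pos_of_mul_pos ((hx' oB b hb v w hvw).1 rfl)).1 hs
  have hPloc : ∀ x ∈ R, ∀ᶠ x' in 𝓝 x, x' ∈ R → (P x' ↔ P x) := fun x hx => by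
    obtain ⟨s, -, h⟩ := hPs x hx
    filter_upwards [h] with x' hx' hR'
    exact (hx' hR').1.trans (h.self_of_nhds hx).1.symm
  -- σ singles out the components of B over which the reference orientation already has the right
  -- sign at some ramified point, hence at all of them since B is not multiply ramified. It is
  -- locally constant because components of the manifold B are open.
  set σ : B → Prop := fun b => ∃ x ∈ R, p x ∈ connectedComponentIn (Set.range ι) (ι b) ∧ P x
    with hσdef
  have hσ : ∀ b, ∀ᶠ b' in 𝓝 b, σ b' ↔ σ b := fun b => by
    have : LocallyConnectedSpace B := ChartedSpace.locallyConnectedSpace (EuclideanSpace ℝ (Fin c)) B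
    filter_upwards [isOpen_connectedComponent.mem_nhds (mem_connectedComponent (x := b))] with b' hb'
    have h1 : ι b' ∈ connectedComponentIn (Set.range ι) (ι b) :=
      (isPreconnected_connectedComponent.image ι hι.isEmbedding.continuous.continuousOn
        ).subset_connectedComponentIn ⟨b, mem_connectedComponent, rfl⟩
          (Set.image_subset_range _ _) ⟨b', hb', rfl⟩
    simp only [hσdef, connectedComponentIn_eq h1]
  refine ⟨oB.reverseOutside σ hσ, fun x hx => ⟨hpair x hx _, fun v w hvw => ?_⟩⟩
  obtain ⟨b, hb⟩ := hmem x hx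
  have hxb : p x ∈ connectedComponentIn (Set.range ι) (ι b) := by
    rw [hb]
    exact mem_connectedComponentIn ⟨b, hb⟩
  obtain ⟨s, hs0, hs⟩ := hPs x hx
  obtain ⟨hPx, hsx⟩ := hs.self_of_nhds hx
  have hsx := hsx _ b hb v w hvw
  change 0 < area x v w
  by_cases hσb : σ b
  · obtain ⟨x', hx', hxb', hP'⟩ := hσb
    have hP : P x := (hram.iff_of_eventually_iff hopen hPloc ⟨b, rfl⟩ hx' hx hxb' hxb).1 hP'
    exact (pos_iff_pos_of_mul_pos (hsx.1 (oB.reverseOutside_of_pos hσ ⟨x', hx', hxb', hP'⟩))).1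
      (hPx.1 hP)
  · have hs : s < 0 := lt_of_le_of_ne (not_lt.1 fun h => hσb ⟨x, hx, hxb, hPx.2 h⟩) hs0
    exact pos_of_mul_neg_right (hsx.2 (oB.reverseOutside_of_neg hσ hσb)) hs.le

end BranchOrientation

/-! ### Pull-back of α + r² dθ. -/

section PullbackProduct

variable {n : ℕ}
  {M : Type*} [TopologicalSpace M] [ChartedSpace (EuclideanSpace ℝ (Fin (2 * n + 1))) M]
  {Y : Type*} [TopologicalSpace Y] [ChartedSpace (EuclideanSpace ℝ (Fin (2 * n + 1))) Y]

lemma pullback_addRSqDTheta (α : OneForm (𝓡 (2 * n + 1)) Y) {F₁ : M → Y} {F₂ : M → ℂ} {x : M}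
    (h₁ : MDifferentiableAt (𝓡 (2 * n + 1)) (𝓡 (2 * n + 1)) F₁ x)
    (h₂ : MDifferentiableAt (𝓡 (2 * n + 1)) 𝓘(ℝ, ℂ) F₂ x) :
    OneForm.pullback (I := 𝓡 (2 * n + 1)) (fun x => (F₁ x, F₂ x)) (addRSqDTheta α) x =
      OneForm.pullback (I := 𝓡 (2 * n + 1)) F₁ α x +
        OneForm.pullback (I := 𝓡 (2 * n + 1)) F₂ rSqDTheta x := by
  have h : MDifferentiableAt (𝓡 (2 * n + 1)) ((𝓡 (2 * n + 1)).prod 𝓘(ℝ, ℂ))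
    (fun x => (F₁ x, F₂ x)) x := h₁.prodMk h₂
  have e1 : mfderiv (𝓡 (2 * n + 1)) (𝓡 (2 * n + 1)) F₁ x = _ :=
    mfderiv_comp (g := (Prod.fst : Y × ℂ → Y)) (f := fun x => (F₁ x, F₂ x)) x
      (mdifferentiableAt_fst (I := 𝓡 (2 * n + 1)) (I' := 𝓘(ℝ, ℂ))) h
  have e2 : mfderiv (𝓡 (2 * n + 1)) 𝓘(ℝ, ℂ) F₂ x = _ :=
    mfderiv_comp (g := (Prod.snd : Y × ℂ → ℂ)) (f := fun x => (F₁ x, F₂ x)) x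
      (mdifferentiableAt_snd (I := 𝓡 (2 * n + 1)) (I' := 𝓘(ℝ, ℂ))) h
  unfold OneForm.pullback
  rw [e1, e2]
  rfl

/-- r² dθ is quadratic under real scaling, so scaling the fibre coordinate by s corresponds to the
parameter s² of the linear path. -/
lemma pullback_smul_rSqDTheta {f : M → ℂ} {x : M}
    (hf : MDifferentiableAt (𝓡 (2 * n + 1)) 𝓘(ℝ, ℂ) f x) (s : ℝ) :
    OneForm.pullback (I := 𝓡 (2 * n + 1)) (fun x => s • f x) rSqDTheta x =
      s ^ 2 • OneForm.pullback (I := 𝓡 (2 * n + 1)) f rSqDTheta x := by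
  have h1 := dmap_comp_of_eq (E := EuclideanSpace ℝ (Fin (2 * n + 1))) (E' := ℂ) (F := f)
    (G := fun z : ℂ => s • z) (rfl : f x = f x)
    (differentiable_id.const_smul s).differentiableAt.mdifferentiableAt hf
  have h2 : fderiv ℝ (fun z : ℂ => s • z) (f x) = s • ContinuousLinearMap.id ℝ ℂ := by
    exact (s • ContinuousLinearMap.id ℝ ℂ).fderiv
  rw [dmap_eq_fderiv, h2] at h1
  refine ContinuousLinearMap.ext fun (v : EuclideanSpace ℝ (Fin (2 * n + 1))) => ?_
  have h3 := DFunLike.congr_fun h1 v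
  change (starRingEnd ℂ (s • f x) * dmap (E := EuclideanSpace ℝ (Fin (2 * n + 1))) (E' := ℂ)
    ((fun z : ℂ => s • z) ∘ f) x v).im = s ^ 2 * (starRingEnd ℂ (f x) *
      dmap (E := EuclideanSpace ℝ (Fin (2 * n + 1))) (E' := ℂ) f x v).im
  rw [h3]
  change (starRingEnd ℂ (s • f x) * s • dmap (E := EuclideanSpace ℝ (Fin (2 * n + 1))) (E' := ℂ)
    f x v).im = _
  simp [Complex.mul_im]
  ring

end PullbackProduct

/-! ### Transport of the ramification data by a diffeomorphism of the base. -/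

section Transport

lemma ramificationSet_comp_injective {M Y Y' : Type*} [TopologicalSpace M] (p : M → Y) {g : Y → Y'}
    (hg : Function.Injective g) : ramificationSet (g ∘ p) = ramificationSet p := by
  ext x
  refine not_congr (exists_congr fun U => and_congr_right fun _ => ?_)
  exact ⟨fun h => fun y hy z hz hyz => h hy hz (congrArg g hyz), fun h => hg.comp_injOn h⟩

variable {d c : ℕ}
  {M : Type*} [TopologicalSpace M] [ChartedSpace (EuclideanSpace ℝ (Fin d)) M]
  [IsManifold (𝓡 d) ∞ M]
  {Y : Type*} [TopologicalSpace Y] [ChartedSpace (EuclideanSpace ℝ (Fin d)) Y]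
  {B : Type*} [TopologicalSpace B] [ChartedSpace (EuclideanSpace ℝ (Fin c)) B]
  [IsManifold (𝓡 c) ∞ B]

/-- The derivative of D is injective, so neither the kernel of dp nor the lifting of frames of B
changes. -/
lemma isPositiveNormalPair_diffeomorph_comp {oM : ManifoldOrientation d M}
    {oB : ManifoldOrientation c B} {ι : B → Y} {p : M → Y} (hι : ContMDiff (𝓡 c) (𝓡 d) ∞ ι)
    (hp : ContMDiff (𝓡 d) (𝓡 d) ∞ p) (D : Y ≃ₘ^∞⟮𝓡 d, 𝓡 d⟯ Y) {x : M}
    {v w : EuclideanSpace ℝ (Fin d)} :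
    IsPositiveNormalPair oM oB (D ∘ ι) (D ∘ p) x v w ↔ IsPositiveNormalPair oM oB ι p x v w := by
  have hinj : ∀ y, Function.Injective (dmap (E := EuclideanSpace ℝ (Fin d))
      (E' := EuclideanSpace ℝ (Fin d)) D y) := fun y =>
    (D.mfderivToContinuousLinearEquiv (by simp) y).injective
  have hD : ∀ y, MDifferentiableAt (𝓡 d) (𝓡 d) D y := fun y =>
    D.contMDiff.contMDiffAt.mdifferentiableAt (by simp)
  have h1 : ∀ x (u : EuclideanSpace ℝ (Fin d)), mfderiv (𝓡 d) (𝓡 d) (D ∘ p) x u =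
      dmap (E := EuclideanSpace ℝ (Fin d)) (E' := EuclideanSpace ℝ (Fin d)) D (p x)
        (dmap (E := EuclideanSpace ℝ (Fin d)) (E' := EuclideanSpace ℝ (Fin d)) p x u) := fun x u =>
    DFunLike.congr_fun (mfderiv_comp x (hD _) (hp.contMDiffAt.mdifferentiableAt (by simp))) u
  have h0 : ∀ u : EuclideanSpace ℝ (Fin d), mfderiv (𝓡 d) (𝓡 d) (D ∘ p) x u = 0 ↔
      mfderiv (𝓡 d) (𝓡 d) p x u = 0 := fun u => by
    rw [h1]
    exact map_eq_zero_iff _ (hinj (p x))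
  have h2 : ∀ b, ι b = p x → ∀ (a : EuclideanSpace ℝ (Fin c)) (u : EuclideanSpace ℝ (Fin d)),
      dmap (E := EuclideanSpace ℝ (Fin d)) (E' := EuclideanSpace ℝ (Fin d)) (D ∘ p) x u =
        dmap (E := EuclideanSpace ℝ (Fin c)) (E' := EuclideanSpace ℝ (Fin d)) (D ∘ ι) b a ↔
      dmap (E := EuclideanSpace ℝ (Fin d)) (E' := EuclideanSpace ℝ (Fin d)) p x u =
        dmap (E := EuclideanSpace ℝ (Fin c)) (E' := EuclideanSpace ℝ (Fin d)) ι b a := by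
    intro b hb a u
    have h3 := dmap_comp_of_eq (E := EuclideanSpace ℝ (Fin c)) (E' := EuclideanSpace ℝ (Fin d))
      (G := D) hb (hD _) (hι.contMDiffAt.mdifferentiableAt (by simp))
    have h4 := dmap_comp_of_eq (E := EuclideanSpace ℝ (Fin d)) (E' := EuclideanSpace ℝ (Fin d))
      (G := D) (rfl : p x = p x) (hD _) (hp.contMDiffAt.mdifferentiableAt (by simp))
    rw [h3, h4]
    exact (hinj (p x)).eq_iff
  constructor
  · rintro ⟨hv, hw, h, b, a, u, hb, ha, hu, hf⟩
    have hb' := D.injective hb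
    exact ⟨(h0 v).1 hv, (h0 w).1 hw, h, b, a, u, hb', ha,
      fun i => (h2 b hb' (a i) (u i)).1 (hu i), hf⟩
  · rintro ⟨hv, hw, h, b, a, u, hb, ha, hu, hf⟩
    exact ⟨(h0 v).2 hv, (h0 w).2 hw, h, b, a, u, congrArg D hb, ha,
      fun i => (h2 b hb (a i) (u i)).2 (hu i), hf⟩

end Transport

/-! ### The isotopy of embeddings. -/

section Isotopy

variable {n : ℕ}
  {M : Type*} [TopologicalSpace M] [T2Space M] [CompactSpace M]
  [ChartedSpace (EuclideanSpace ℝ (Fin (2 * n + 1))) M] [IsManifold (𝓡 (2 * n + 1)) ∞ M]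
  {Y : Type*} [TopologicalSpace Y]
  [ChartedSpace (EuclideanSpace ℝ (Fin (2 * n + 1))) Y] [IsManifold (𝓡 (2 * n + 1)) ∞ Y]

omit [T2Space M] in
-- At ε = 0 the map lands in the zero section. Since M is compact and U open, it still lands in U
-- for all small ε.
lemma exists_scale_mem {q : M → Y} {f : M → ℂ} (hq : Continuous q) (hf : Continuous f)
    {U : Set (Y × ℂ)} (hU : IsOpen U) (h0 : ∀ y, (y, (0 : ℂ)) ∈ U) {t₁ : ℝ} (ht₁ : 0 < t₁) :
    ∃ ε : ℝ, 0 < ε ∧ ε ≤ 1 ∧ ε ^ 2 ≤ t₁ ∧ ∀ x, (q x, ε • f x) ∈ U := by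
  have h1 : ∀ᶠ ε in 𝓝 (0 : ℝ), ∀ x ∈ (Set.univ : Set M), (q x, ε • f x) ∈ U := by
    refine isCompact_univ.eventually_forall_of_forall_eventually fun x _ => ?_
    have hc : Continuous fun z : ℝ × M => (q z.2, z.1 • f z.2) := by fun_prop
    exact hc.continuousAt.eventually (hU.mem_nhds (by simpa using h0 (q x)))
  have h2 : ∀ᶠ ε in 𝓝 (0 : ℝ), ε ^ 2 < t₁ :=
    (continuous_pow 2).continuousAt.eventually (gt_mem_nhds (by simpa using ht₁))
  have h3 : ∀ᶠ ε in 𝓝 (0 : ℝ), ε < 1 := gt_mem_nhds one_pos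
  have h4 : ∀ᶠ ε in 𝓝[>] (0 : ℝ), 0 < ε := self_mem_nhdsWithin
  obtain ⟨ε, hε, h5, h6, h7⟩ := (h4.and (((h1.and (h2.and h3))).filter_mono nhdsWithin_le_nhds)).exists
  exact ⟨ε, hε, h7.le, h6.le, fun x => h5 x (Set.mem_univ x)⟩

/-- The isotopy of a braid that moves the base along an ambient isotopy, shrinks the fibre
coordinate to `ε` times its size and reparametrizes the source. -/
def braidIsotopy (e : M → Y × ℂ) (Φ : ℝ → Y → Y) (Ψ : ℝ → M → M) (ε t : ℝ) (x : M) : Y × ℂ :=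
  (Φ t (e (Ψ t x)).1, (1 - t * (1 - ε)) • (e (Ψ t x)).2)

omit [T2Space M] [CompactSpace M] in
lemma isIsotopyFrom_braidIsotopy {e : M → Y × ℂ}
    (he : Manifold.IsSmoothEmbedding (𝓡 (2 * n + 1)) ((𝓡 (2 * n + 1)).prod 𝓘(ℝ, ℂ)) ∞ e)
    (hdisk : ∀ x, (e x).2 ∈ Metric.closedBall (0 : ℂ) 1)
    {Φ : ℝ → Y → Y} (hΦ : IsAmbientIsotopy (2 * n + 1) Φ) {Ψ : ℝ → M → M}
    (hΨ : ContMDiff (𝓘(ℝ, ℝ).prod (𝓡 (2 * n + 1))) (𝓡 (2 * n + 1)) ∞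
      (fun q : ℝ × M => Ψ q.1 q.2)) (hΨ0 : Ψ 0 = id)
    (hΨD : ∀ t, ∃ D : M ≃ₘ^∞⟮𝓡 (2 * n + 1), 𝓡 (2 * n + 1)⟯ M, ⇑D = Ψ t)
    {ε : ℝ} (hε : 0 < ε) (hε1 : ε ≤ 1) :
    IsIsotopyFrom (d := 2 * n + 1) e (braidIsotopy e Φ Ψ ε) := by
  -- The scaling factor runs from 1 to ε within (0, 1]: it is invertible, and it keeps the image in
  -- the disk.
  have hs : ∀ t ∈ Set.Icc (0 : ℝ) 1, 0 < 1 - t * (1 - ε) ∧ 1 - t * (1 - ε) ≤ 1 := fun t ht =>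
    ⟨by nlinarith [ht.1, ht.2], by nlinarith [ht.1, ht.2]⟩
  refine ⟨?_, ?_, fun t ht => ?_, fun t ht x => ?_⟩
  · have h1 : ContMDiff (𝓘(ℝ, ℝ).prod (𝓡 (2 * n + 1))) ((𝓡 (2 * n + 1)).prod 𝓘(ℝ, ℂ)) ∞
      (fun q : ℝ × M => e (Ψ q.1 q.2)) := he.contMDiff.comp hΨ
    have h2 : ContMDiff (𝓘(ℝ, ℝ).prod (𝓡 (2 * n + 1))) (𝓡 (2 * n + 1)) ∞
      (fun q : ℝ × M => Φ q.1 (e (Ψ q.1 q.2)).1) :=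
      hΦ.smooth.comp (contMDiff_fst.prodMk (contMDiff_fst.comp h1))
    have h3 : ContMDiff (𝓘(ℝ, ℝ).prod (𝓡 (2 * n + 1))) 𝓘(ℝ, ℝ) ∞
      (fun q : ℝ × M => 1 - q.1 * (1 - ε)) :=
      ContMDiff.comp (g := fun t : ℝ => 1 - t * (1 - ε)) (f := Prod.fst)
        (ContDiff.contMDiff (by fun_prop)) contMDiff_fst
    exact h2.prodMk (h3.smul (contMDiff_snd.comp h1))
  · funext x
    simp [braidIsotopy, hΦ.start, hΨ0]
  · obtain ⟨D, hD⟩ := hΨD t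
    obtain ⟨D', hD'⟩ := hΦ.diffeo t ht
    let S : ℂ ≃L[ℝ] ℂ := ContinuousLinearEquiv.smulLeft (Units.mk0 _ (hs t ht).1.ne')
    have h1 := IsSmoothEmbedding.diffeomorph_comp D (D'.prodCongr S.toDiffeomorph) he
    have h2 : braidIsotopy e Φ Ψ ε t = D'.prodCongr S.toDiffeomorph ∘ e ∘ D := by
      funext x
      simp only [braidIsotopy, ← hD, ← hD']
      rfl
    rw [h2]
    exact h1
  · have h1 := hs t ht
    have h2 := hdisk (Ψ t x)
    rw [mem_closedBall_zero_iff] at h2 ⊢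
    simp only [braidIsotopy, norm_smul, Real.norm_eq_abs, abs_of_pos h1.1]
    nlinarith [norm_nonneg (e (Ψ t x)).2]

end Isotopy

section Immersion

variable {d : ℕ}
  {M : Type*} [TopologicalSpace M] [ChartedSpace (EuclideanSpace ℝ (Fin d)) M]
  {Y : Type*} [TopologicalSpace Y] [ChartedSpace (EuclideanSpace ℝ (Fin d)) Y]

lemma eq_zero_of_dmap_fst_snd_eq_zero {e : M → Y × ℂ}
    (he : Manifold.IsSmoothEmbedding (𝓡 d) ((𝓡 d).prod 𝓘(ℝ, ℂ)) ∞ e) (x : M)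
    (v : EuclideanSpace ℝ (Fin d))
    (h₁ : dmap (E := EuclideanSpace ℝ (Fin d)) (E' := EuclideanSpace ℝ (Fin d))
      (fun x => (e x).1) x v = 0)
    (h₂ : dmap (E := EuclideanSpace ℝ (Fin d)) (E' := ℂ) (fun x => (e x).2) x v = 0) : v = 0 := by
  have hinj := IsImmersionAt.mfderiv_injective (he.isImmersion.isImmersionAt x)
  have h := mfderiv_prodMk (x := x)
    ((contMDiff_fst.comp he.contMDiff).contMDiffAt.mdifferentiableAt (by simp))
    ((contMDiff_snd.comp he.contMDiff).contMDiffAt.mdifferentiableAt (by simp))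
  refine (injective_iff_map_eq_zero _).1 hinj v ?_
  refine (DFunLike.congr_fun h v).trans ?_
  exact Prod.ext h₁ h₂

end Immersion

end ContactBraid

end

/-! ### The theorem. -/

theorem theorem4p1 {n m : ℕ}
    {M : Type*} [TopologicalSpace M] [T2Space M] [CompactSpace M]
    [ChartedSpace (EuclideanSpace ℝ (Fin (2 * n + 1))) M] [IsManifold (𝓡 (2 * n + 1)) ∞ M]
    {Y : Type*} [TopologicalSpace Y] [T2Space Y] [CompactSpace Y]
    [ChartedSpace (EuclideanSpace ℝ (Fin (2 * n + 1))) Y] [IsManifold (𝓡 (2 * n + 1)) ∞ Y]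
    {B : Type*} [TopologicalSpace B]
    [ChartedSpace (EuclideanSpace ℝ (Fin (2 * m + 1))) B] [IsManifold (𝓡 (2 * m + 1)) ∞ B]
    (oM : ContactBraid.ManifoldOrientation (2 * n + 1) M)
    (oY : ContactBraid.ManifoldOrientation (2 * n + 1) Y)
    (ι : B → Y) (hι : Manifold.IsSmoothEmbedding (𝓡 (2 * m + 1)) (𝓡 (2 * n + 1)) ∞ ι)
    (hB : Nonempty (ContactBraid.ManifoldOrientation (2 * m + 1) B))
    (e : M → Y × ℂ)
    (he : ContactBraid.IsBraid (d := 2 * n + 1) (2 * m + 1) e (Set.range ι))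
    (hram : ContactBraid.NotMultiplyRamified (fun x => (e x).1) (Set.range ι)) :
    ∃ oB : ContactBraid.ManifoldOrientation (2 * m + 1) B,
      ∀ α : ContactBraid.OneForm (𝓡 (2 * n + 1)) Y, ContactBraid.IsContactForm oY α →
      ∀ Φ : ℝ → Y → Y, ContactBraid.IsAmbientIsotopy (2 * n + 1) Φ →
        ContactBraid.IsPositiveContactSubmanifold oB (Φ 1 ∘ ι) α →
      ∀ β : ContactBraid.OneForm (𝓡 (2 * n + 1)) M,
        ContactBraid.IsInducedContactForm oM oB (Φ 1 ∘ ι) (fun x => Φ 1 (e x).1) α β →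
      ∀ U : Set (Y × ℂ), IsOpen U → (∀ y : Y, (y, (0 : ℂ)) ∈ U) →
        ∃ F : ℝ → M → Y × ℂ, ContactBraid.IsIsotopyFrom (d := 2 * n + 1) e F ∧
          ContactBraid.IsContactEmbedding (F 1) β (ContactBraid.addRSqDTheta α) ∧
          ∀ x, F 1 x ∈ U := by
  obtain ⟨oB₀⟩ := hB
  have hp : ContMDiff (𝓡 (2 * n + 1)) (𝓡 (2 * n + 1)) ∞ (fun x => (e x).1) := he.branched.smooth
  have hf : ContMDiff (𝓡 (2 * n + 1)) 𝓘(ℝ, ℂ) ∞ (fun x => (e x).2) :=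
    contMDiff_snd.comp he.embedding.contMDiff
  -- The orientation depends only on the braid and the orientation of M, so it is fixed before α and
  -- the ambient isotopy.
  obtain ⟨oB, hoB⟩ := ContactBraid.exists_branch_orientation (by omega) oM oB₀ he.branched hf hι
    (ContactBraid.eq_zero_of_dmap_fst_snd_eq_zero he.embedding) hram
  refine ⟨oB, fun α hα Φ hΦ hBα β₁ hβ₁ U hU hU0 => ?_⟩
  obtain ⟨β, η, hβ, hβ0, hβ1, hβc, hη, hηpos⟩ := hβ₁
  obtain ⟨D, hD⟩ := hΦ.diffeo 1 ⟨zero_le_one, le_rfl⟩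
  set q : M → Y := fun x => Φ 1 (e x).1 with hqdef
  have hqD : q = D ∘ fun x => (e x).1 := by rw [hD]; rfl
  have hιD : Φ 1 ∘ ι = D ∘ ι := by rw [hD]
  have hq : ContMDiff (𝓡 (2 * n + 1)) (𝓡 (2 * n + 1)) ∞ q := by
    rw [hqD]
    exact D.contMDiff.comp hp
  have hι' : ContMDiff (𝓡 (2 * m + 1)) (𝓡 (2 * n + 1)) ∞ (Φ 1 ∘ ι) := by
    rw [hιD]
    exact D.contMDiff.comp hι.contMDiff
  set R := ContactBraid.ramificationSet (fun x => (e x).1) with hR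
  have hRq : ContactBraid.ramificationSet q = R := by
    rw [hqD]
    exact ContactBraid.ramificationSet_comp_injective _ D.injective
  have hpair : ∀ {x : M} {v w : EuclideanSpace ℝ (Fin (2 * n + 1))},
      ContactBraid.IsPositiveNormalPair oM oB (Φ 1 ∘ ι) q x v w ↔
      ContactBraid.IsPositiveNormalPair oM oB ι (fun x => (e x).1) x v w := fun {x v w} => by
    rw [hqD, hιD]
    exact ContactBraid.isPositiveNormalPair_diffeomorph_comp hι.contMDiff hp D
  set κ := ContactBraid.OneForm.pullback (I := 𝓡 (2 * n + 1)) (fun x => (e x).2)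
    ContactBraid.rSqDTheta with hκ
  have hκs : κ.IsSmooth := ContactBraid.isSmooth_rSqDTheta.pullback hf
  have hqα := hα.1.pullback (F := q) hq
  -- Its value at ε² will be the pull-back of α + r² dθ by (q, ε f), and its velocity κ = f^*(r² dθ)
  -- is positive on the normal fibres by the choice of `oB`.
  set γ := ContactBraid.linearPath (ContactBraid.OneForm.pullback (I := 𝓡 (2 * n + 1)) q α) κ
    with hγdef
  have hγ : ContactBraid.IsSmoothPath γ := ContactBraid.isSmoothPath_linearPath hqα hκs
  obtain ⟨t₁, ht₁, hconv⟩ := ContactBraid.exists_nondegenerate_range (R := R) (oB := oB) hq hι' hα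
    hBα (fun x hx => by
      have h1 : Function.Bijective (ContactBraid.dmap (E := EuclideanSpace ℝ (Fin (2 * n + 1)))
          (E' := EuclideanSpace ℝ (Fin (2 * n + 1))) (fun x => (e x).1) x) :=
        not_not.1 (mt (he.branched.singular_iff x).2 hx)
      have h2 : Function.Bijective (ContactBraid.dmap (E := EuclideanSpace ℝ (Fin (2 * n + 1)))
          (E' := EuclideanSpace ℝ (Fin (2 * n + 1))) D (e x).1) :=
        (D.mfderivToContinuousLinearEquiv (by simp) (e x).1).bijective
      have h3 := ContactBraid.dmap_comp_of_eq (E := EuclideanSpace ℝ (Fin (2 * n + 1)))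
        (E' := EuclideanSpace ℝ (Fin (2 * n + 1))) (F := fun x => (e x).1) (G := D) (x := x) rfl
        (D.contMDiff.contMDiffAt.mdifferentiableAt (by simp))
        (hp.contMDiffAt.mdifferentiableAt (by simp))
      rw [hqD]
      change Function.Bijective (ContactBraid.dmap (E := EuclideanSpace ℝ (Fin (2 * n + 1)))
          (E' := EuclideanSpace ℝ (Fin (2 * n + 1))) (D ∘ fun x => (e x).1) x)
      rw [h3]
      exact h2.comp h1)
    (fun x hx => by
      obtain ⟨v, w, hvw⟩ := (hoB x hx).1
      exact ⟨v, w, hpair.2 hvw⟩)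
    hβ hγ hβ0 (ContactBraid.linearPath_zero _ _) hβc hη
    (ContactBraid.isInitialVelocity_linearPath _ κ) (fun x hx => hηpos x (hRq ▸ hx))
    (fun x hx v w hvw => by
      rw [hκ]
      refine (ContactBraid.d_pullback_rSqDTheta hf x v w).symm ▸ ?_
      exact mul_pos two_pos ((hoB x hx).2 v w (hpair.1 hvw)))
  -- One ε meets both demands: ε² lies in the range of nondegeneracy, and the scaled image lies in
  -- U.
  obtain ⟨ε, hε, hε1, hεt, hεU⟩ := ContactBraid.exists_scale_mem hq.continuous hf.continuous hU hU0
    ht₁.1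
  have hε2 : ε ^ 2 ∈ Set.Ioc (0 : ℝ) 1 := ⟨by positivity, hεt.trans ht₁.2⟩
  -- The family runs from β 1, the given form, to γ at ε², so Ψ 1 pulls the latter back to a
  -- positive multiple of the former.
  obtain ⟨Ψ, hΨ, hΨ0, hΨD, hΨ1⟩ := ContactBraid.exists_gray_isotopy
    (ContactBraid.isSmoothFamily_concatFamily hβ hγ hε2)
    (ContactBraid.isNondegenerate_concatFamily hε2 (fun t ht => (hβc t ht).isNondegenerate)
      (fun s hs => hconv s hs _ ⟨hε2.1, hεt⟩))
    (fun s hs => by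
      rw [ContactBraid.concatFamily_of_nonpos hs, ContactBraid.concatFamily_of_nonpos le_rfl])
    (fun s hs => by
      rw [ContactBraid.concatFamily_of_one_le hs, ContactBraid.concatFamily_of_one_le le_rfl])
  rw [ContactBraid.concatFamily_of_nonpos le_rfl, ContactBraid.concatFamily_of_one_le le_rfl,
    hβ1] at hΨ1
  have hF := ContactBraid.isIsotopyFrom_braidIsotopy he.embedding he.mem_disk hΦ hΨ hΨ0 hΨD hε hε1
  have hF1 : ContactBraid.braidIsotopy e Φ Ψ ε 1 =
      fun x => ((q ∘ Ψ 1) x, ((fun x => ε • (e x).2) ∘ Ψ 1) x) := by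
    funext x
    simp [ContactBraid.braidIsotopy, hqdef]
  refine ⟨_, hF, ⟨hF.embedding 1 ⟨zero_le_one, le_rfl⟩, fun x => ?_⟩, fun x => ?_⟩
  · obtain ⟨c, hc, hcx⟩ := hΨ1 x
    refine ⟨c, hc, Eq.trans ?_ hcx⟩
    have hΨd : MDifferentiableAt (𝓡 (2 * n + 1)) (𝓡 (2 * n + 1)) (Ψ 1) x :=
      (ContactBraid.contMDiff_slice hΨ 1).contMDiffAt.mdifferentiableAt (by simp)
    have hqd : MDifferentiableAt (𝓡 (2 * n + 1)) (𝓡 (2 * n + 1)) q (Ψ 1 x) :=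
      hq.contMDiffAt.mdifferentiableAt (by simp)
    have hfd : MDifferentiableAt (𝓡 (2 * n + 1)) 𝓘(ℝ, ℂ) (fun x => (e x).2) (Ψ 1 x) :=
      hf.contMDiffAt.mdifferentiableAt (by simp)
    have hεf : MDifferentiableAt (𝓡 (2 * n + 1)) 𝓘(ℝ, ℂ) (fun x => ε • (e x).2) (Ψ 1 x) :=
      hfd.const_smul ε
    rw [hF1, ContactBraid.pullback_addRSqDTheta α (hqd.comp x hΨd) (hεf.comp x hΨd)]
    have e1 := ContactBraid.OneForm.pullback_comp (α := α) hΨd hqd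
    have e2 := ContactBraid.OneForm.pullback_comp (α := ContactBraid.rSqDTheta) hΨd hεf
    rw [e1, e2]
    have e3 := ContactBraid.pullback_smul_rSqDTheta hfd ε
    have e4 : γ (ε ^ 2) (Ψ 1 x) = ContactBraid.OneForm.pullback (I := 𝓡 (2 * n + 1)) q α (Ψ 1 x) +
        ContactBraid.OneForm.pullback (I := 𝓡 (2 * n + 1)) (fun x => ε • (e x).2)
          ContactBraid.rSqDTheta (Ψ 1 x) := by
      rw [e3]
      rfl
    conv_rhs => unfold ContactBraid.OneForm.pullback
    rw [e4]
    rfl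
  · rw [hF1]
    exact hεU (Ψ 1 x)
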